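/- Setting. Let $(\mathcal S,\mathcal A,\mathsf P,r,\gamma)$ be a finite discounted constrained MDP with $\gamma\in(0,1)$, positive rewards $r_0,\dots,r_m$, initial distribution $\rho$ and thresholds $c\in\mathbb R^m$. For a stationary policy $\pi$ let $V_i^\pi(\rho)=\mathbb E[\sum_t\gamma^t r_i(s_t,a_t)]$ (with $s_0\sim\rho$), $\mathcal H(\pi)=-\mathbb E[\sum_t\gamma^t\log\pi(a_t|s_t)]$, $\nu_\rho^\pi(s,a)=(1-\gamma)\sum_t\gamma^t\Pr(s_t=s,a_t=a)$, and $$\mathcal L_{\tau,\mu}(\pi,\lambda)=V_0^\pi(\rho)+\sum_{i=1}^m\lambda_i(V_i^\pi(\rho)-c_i)+\tau\mathcal H(\pi)+\tfrac\mu2\|\lambda\|_2^2 .$$ Let $V_0^*(\rho)$ be the supremum of $V_0^\pi(\rho)$ over policies with $V_i^\pi(\rho)\ge c_i$ for $i=1,\dots,m$. A policy $\tilde\pi$ is $\epsilon$-optimal if $V_0^*(\rho)-V_0^{\tilde\pi}(\rho)\le\epsilon$ and $\sum_{i=1}^m\max\{0,c_i-V_i^{\tilde\pi}(\rho)\}\le\epsilon$.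 Put $r_{i,\max}=\max_{s,a} r_i(s,a)$, $R_{\max}=(\sum_{i=1}^m r_{i,\max}^2)^{1/2}$. Assumptions. (Slater) For some $\xi>0$ there is a policy $\pi_\xi$ with $V_i^{\pi_\xi}(\rho)\ge c_i+\xi$ for all $i=1,\dots,m$. Put $B=\frac{r_{0,\max}}{(1-\gamma)\xi}$ and $\Lambda=[0,2B]^m$. (Uniform ergodicity) There are constants $C_M\ge\frac12$ (automatic if $|\mathcal S|\ge2$) and $\beta\in(0,1)$ such that for every $\lambda\in\Lambda$ the policy $\pi^*_{\tau,\lambda}$ maximizing $\mathcal L_{\tau,\mu}(\cdot,\lambda)$, for the $\tau,\mu$ used below, induces a Markov chain with a stationary distribution $\chi$ satisfying $\sup_s d_{TV}(\mathbb P(s_t\in\cdot\,|\,s_0=s),\chi)\le C_M\beta^t$ for all $t\ge0$. Algorithm AR-CPO. Let $L_\nu=\lceil\log_\beta(C_M^{-1})\rceil+(1-\beta)^{-1}+1$, $L_d=\frac{2R_{\max}^2L_\nu}{(1-\gamma)^2\tau}+\mu$, $\alpha=\sqrt{\mu/(2L_d)}$, $q=\frac{2\alpha-\mu/L_d}{2-\mu/L_d}$,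 $\eta=\frac{\alpha}{\mu(1-\alpha)}$. Start from $\lambda_0=\bar\lambda_0=0$; for $t=1,\dots,T$ set $\underline\lambda_t=(1-q)\bar\lambda_{t-1}+q\lambda_{t-1}$, $\pi_t=\mathrm{RegPO}(\delta,\underline\lambda_t,\tau)$, $g_t=V^{\pi_t}(\rho)-c+\mu\underline\lambda_t$, $\lambda_t=\arg\min_{\lambda\in\Lambda}\{\eta[\langle g_t,\lambda\rangle+\frac\mu2\|\lambda-\underline\lambda_t\|_2^2]+\frac12\|\lambda-\lambda_{t-1}\|_2^2\}$, $\bar\lambda_t=(1-\alpha)\bar\lambda_{t-1}+\alpha\lambda_t$. With $w_1=(1-\alpha)^{T-1}$ and $w_t=\alpha(1-\alpha)^{T-t}$ for $t\ge2$, output $\tilde\pi(a|s)=\frac{\sum_t w_t\nu_\rho^{\pi_t}(s,a)}{\sum_{a'}\sum_t w_t\nu_\rho^{\pi_t}(s,a')}$ (uniform at states where the denominator is $0$). With $r_\lambda=r_0+\sum_i\lambda_ir_i$ and $K=\lceil\log(\frac{2(r_{0,\max}+BR_{\max})}{(1-\gamma)\delta\tau})/\log(1/\gamma)\rceil$ (replaced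 by $0$ if negative), RegPO is either (NPG) $K+1$ updates $\theta\leftarrow\theta+\frac{1-\gamma}{\tau}(\mathcal F_\rho^\theta)^\dagger\nabla_\theta[V_{r_\lambda}^{\pi_\theta}(\rho)+\tau\mathcal H(\pi_\theta)]$ from $\theta=0$, where $\pi_\theta(a|s)\propto e^{\theta(s,a)}$ and $\mathcal F_\rho^\theta$ is the Fisher information matrix $\mathbb E_{(s,a)\sim\nu_\rho^{\pi_\theta}}[\nabla_\theta\log\pi_\theta(a|s)\nabla_\theta\log\pi_\theta(a|s)^\top]$, with output $\pi_\theta$; or (SoftQ) $K$ updates $Q(s,a)\leftarrow r_\lambda(s,a)+\gamma\,\mathbb E_{s'\sim\mathsf P(\cdot|s,a)}[\tau\log\sum_{a'}e^{Q(s',a')/\tau}]$ from $Q=0$, with output $\pi(a|s)\propto e^{Q(s,a)/\tau}$. Each inner update, and each evaluation of $V^{\pi_t}(\rho)$, costs one oracle query. Claim. There are constants $\kappa_\tau,\kappa_\mu,\kappa_\delta,\kappa_T,a>0$ and $k\in\mathbb N$, depending only on $m$, $|\mathcal A|$, $r_{0,\max}$, $R_{\max}$, $\xi$, $C_M$, $\beta$,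 such that for every $0<\epsilon\le\frac12$ and every such constrained MDP (with any $\gamma\in(0,1)$, $\mathcal S$, $\mathsf P$, $\rho$, $c$), with the choices $$\tau=\kappa_\tau(1-\gamma)\epsilon,\quad \mu=\kappa_\mu(1-\gamma)^2\epsilon,\quad \delta=\kappa_\delta(1-\gamma)^k\epsilon^2,\quad T=\Big\lceil\frac{\kappa_T}{(1-\gamma)^{5/2}\epsilon}\log\frac1{(1-\gamma)\epsilon}\Big\rceil,$$ if the two assumptions hold, then AR-CPO, with either RegPO-NPG or RegPO-SoftQ, outputs an $\epsilon$-optimal policy, and the total number of oracle queries is at most $a\,G\,(\log G)^2$ with $G=\frac{1}{(1-\gamma)^{3.5}\epsilon}$; that is, the complexity is $\tilde{\mathcal O}\big(\frac1{(1-\gamma)^{3.5}\epsilon}\big)$. -/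

import Mathlib

noncomputable section

/-! ### Computations that count oracle queries -/

/-- A result together with the number of oracle queries that were spent on it. -/
structure Counted (α : Type*) where
  val : α
  queries : ℕ

/-- Run `step` exactly `n` times from `x`, adding up the queries. -/
def Counted.loop {α : Type*} (step : α → Counted α) : ℕ → α → Counted α
  | 0, x => ⟨x, 0⟩
  | n + 1, x => ⟨(step (Counted.loop step n x).val).val,
      (Counted.loop step n x).queries + (step (Counted.loop step n x).val).queries⟩

/-! ### Moore-Penrose inverse, partial derivatives, minimizers -/

/-- The four Penrose equations. -/
def IsMoorePenrose {ι : Type*} [Fintype ι] (A X : Matrix ι ι ℝ) : Prop :=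
  A * X * A = A ∧ X * A * X = X ∧
    (A * X).transpose = A * X ∧ (X * A).transpose = X * A

theorem exists_symm_moorePenrose {ι : Type*} [Fintype ι] (A : Matrix ι ι ℝ)
    (hA : A.IsHermitian) :
    ∃ X : Matrix ι ι ℝ, X.transpose = X ∧ IsMoorePenrose A X := by
  classical
  obtain ⟨U, d, hU, hU', hd⟩ : ∃ (U : Matrix ι ι ℝ) (d : ι → ℝ),
      U.transpose * U = 1 ∧ U * U.transpose = 1 ∧
        A = U * Matrix.diagonal d * U.transpose := by
    refine ⟨hA.eigenvectorUnitary, hA.eigenvalues, ?_, ?_, ?_⟩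
    · simpa [Matrix.star_eq_conjTranspose] using
        (Unitary.mem_iff.1 hA.eigenvectorUnitary.2).1
    · simpa [Matrix.star_eq_conjTranspose] using
        (Unitary.mem_iff.1 hA.eigenvectorUnitary.2).2
    · have h := hA.spectral_theorem
      rw [Unitary.conjStarAlgAut_apply] at h
      simpa [Matrix.star_eq_conjTranspose, Function.comp_def] using h
  have key : ∀ d e : ι → ℝ, (U * Matrix.diagonal d * U.transpose) *
      (U * Matrix.diagonal e * U.transpose) =
        U * Matrix.diagonal (fun i => d i * e i) * U.transpose := by
    intro d e
    calc _ = U * Matrix.diagonal d * (U.transpose * U) * Matrix.diagonal e * U.transpose := by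
          simp only [Matrix.mul_assoc]
      _ = _ := by
          rw [hU, Matrix.mul_one, Matrix.mul_assoc U, Matrix.diagonal_mul_diagonal]
  have keyT : ∀ d : ι → ℝ, (U * Matrix.diagonal d * U.transpose).transpose =
      U * Matrix.diagonal d * U.transpose := by
    intro d
    simp [Matrix.transpose_mul, Matrix.mul_assoc]
  have h0 : ∀ x : ℝ, x * x⁻¹ * x = x := fun x => mul_inv_mul_cancel x
  have h1 : ∀ x : ℝ, x⁻¹ * x * x⁻¹ = x⁻¹ := fun x => by
    simpa using mul_inv_mul_cancel x⁻¹
  refine ⟨U * Matrix.diagonal (fun i => (d i)⁻¹) * U.transpose, keyT _, ?_, ?_, ?_, ?_⟩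
  · rw [hd, key, key]; simp only [h0]
  · rw [hd, key, key]; simp only [h1]
  · rw [hd, key, keyT]
  · rw [hd, key, keyT]

theorem exists_moorePenrose {ι : Type*} [Fintype ι] (A : Matrix ι ι ℝ) :
    ∃ X : Matrix ι ι ℝ, IsMoorePenrose A X := by
  classical
  obtain ⟨Y, hY, h1, h2, h3, h4⟩ := exists_symm_moorePenrose (A.transpose * A) (by
    simpa using Matrix.isHermitian_conjTranspose_mul_self A)
  refine ⟨Y * A.transpose, ?_, ?_, ?_, ?_⟩
  · have h : A.conjTranspose * A * (Y * (A.transpose * A) - 1) = 0 := by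
      rw [Matrix.conjTranspose_eq_transpose_of_trivial, Matrix.mul_sub, Matrix.mul_one,
        ← Matrix.mul_assoc, h1, sub_self]
    rw [Matrix.conjTranspose_mul_self_mul_eq_zero, Matrix.mul_sub, Matrix.mul_one, sub_eq_zero] at h
    simpa only [Matrix.mul_assoc] using h
  · calc _ = Y * (A.transpose * A) * Y * A.transpose := by simp only [Matrix.mul_assoc]
      _ = _ := by rw [h2]
  · rw [Matrix.transpose_mul, Matrix.transpose_mul, Matrix.transpose_transpose, hY,
      Matrix.mul_assoc]
  · rw [Matrix.mul_assoc, h4]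

/-- The Moore-Penrose inverse `A†` (it is unique, see `pinv_unique`). -/
def pinv {ι : Type*} [Fintype ι] (A : Matrix ι ι ℝ) : Matrix ι ι ℝ :=
  Classical.choose (exists_moorePenrose A)

theorem pinv_spec {ι : Type*} [Fintype ι] (A : Matrix ι ι ℝ) : IsMoorePenrose A (pinv A) :=
  Classical.choose_spec (exists_moorePenrose A)

theorem pinv_unique {ι : Type*} [Fintype ι] {A X : Matrix ι ι ℝ} (h : IsMoorePenrose A X) :
    X = pinv A := by
  obtain ⟨h1, h2, h3, h4⟩ := h
  obtain ⟨g1, g2, g3, g4⟩ := pinv_spec A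
  set Y := pinv A
  have e1 : A * X = A * Y := by
    calc A * X = (A * X).transpose := h3.symm
      _ = ((A * Y) * (A * X)).transpose := by
          rw [← Matrix.mul_assoc (A * Y), g1]
      _ = (A * X) * (A * Y) := by rw [Matrix.transpose_mul, h3, g3]
      _ = A * Y := by rw [← Matrix.mul_assoc, h1]
  have e2 : X * A = Y * A := by
    calc X * A = (X * A).transpose := h4.symm
      _ = ((X * A) * (Y * A)).transpose := by
          rw [Matrix.mul_assoc X, ← Matrix.mul_assoc A, g1]
      _ = (Y * A) * (X * A) := by rw [Matrix.transpose_mul, h4, g4]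
      _ = Y * A := by rw [Matrix.mul_assoc Y, ← Matrix.mul_assoc A, h1]
  calc X = X * A * X := h2.symm
    _ = Y * A * Y := by rw [e2, Matrix.mul_assoc, e1, ← Matrix.mul_assoc]
    _ = Y := g2

/-- The partial derivative of `f` at `θ` in the coordinate `i`. -/
def partialDeriv {ι : Type*} [DecidableEq ι] (f : (ι → ℝ) → ℝ) (θ : ι → ℝ) (i : ι) : ℝ :=
  deriv (fun x : ℝ => f (Function.update θ i x)) (θ i)

/-- A minimizer of `f` over `K`, whenever one exists. -/
def argminOn {m : ℕ} (f : (Fin m → ℝ) → ℝ) (K : Set (Fin m → ℝ)) : Fin m → ℝ :=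
  Classical.epsilon (fun x => x ∈ K ∧ IsMinOn f K x)

/-- The box `Λ = {λ ∈ ℝ₊ᵐ : λ_i ≤ 2 B}`. -/
def dualBox (m : ℕ) (B : ℝ) : Set (Fin m → ℝ) :=
  {l | ∀ i, 0 ≤ l i ∧ l i ≤ 2 * B}

theorem argminOn_dualBox_spec {m : ℕ} (f : (Fin m → ℝ) → ℝ) (hf : Continuous f) {B : ℝ}
    (hB : 0 ≤ B) : argminOn f (dualBox m B) ∈ dualBox m B ∧
      IsMinOn f (dualBox m B) (argminOn f (dualBox m B)) := by
  have hK : dualBox m B = Set.Icc (fun _ => 0) (fun _ => 2 * B) := by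
    ext l
    simp [dualBox, Pi.le_def, forall_and]
  have hc : IsCompact (dualBox m B) := by rw [hK]; exact isCompact_Icc
  have hne : (dualBox m B).Nonempty := ⟨0, fun i => ⟨le_rfl, by simpa using hB⟩⟩
  obtain ⟨x, hx, hmin⟩ := hc.exists_isMinOn hne hf.continuousOn
  exact Classical.epsilon_spec (p := fun x => x ∈ dualBox m B ∧ IsMinOn f (dualBox m B) x)
    ⟨x, hx, hmin⟩

/-! ### Constrained Markov decision processes -/

/-- A finite discounted constrained MDP with transition kernel `P s a s'`, positive rewards
`r 0` (objective) and `r 1, …, r m` (constraints), discount factor `γ ∈ (0,1)`, initial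
distribution `ρ` and thresholds `c`. -/
structure ConstrainedMDP (S A : Type*) [Fintype S] [Fintype A] (m : ℕ) where
  P : S → A → S → ℝ
  P_nonneg : ∀ s a s', 0 ≤ P s a s'
  P_sum : ∀ s a, ∑ s', P s a s' = 1
  r : Fin (m + 1) → S → A → ℝ
  r_pos : ∀ i s a, 0 < r i s a
  γ : ℝ
  γ_pos : 0 < γ
  γ_lt_one : γ < 1
  ρ : S → ℝ
  ρ_nonneg : ∀ s, 0 ≤ ρ s
  ρ_sum : ∑ s, ρ s = 1
  c : Fin m → ℝ

/-- Stationary policies `π(a|s)`, written `π s a`. -/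
def IsPolicy {S A : Type*} [Fintype A] (π : S → A → ℝ) : Prop :=
  (∀ s a, 0 ≤ π s a) ∧ ∀ s, ∑ a, π s a = 1

/-- The softmax policy with logits `θ`. -/
def softmaxPolicy {S A : Type*} [Fintype A] (θ : S × A → ℝ) : S → A → ℝ :=
  fun s a => Real.exp (θ (s, a)) / ∑ a', Real.exp (θ (s, a'))

/-- The two entropy-regularized policy optimizers: natural policy gradient and
soft Q-learning. -/
inductive RegPO
  | npg
  | softQ

/-- The input parameters of AR-CPO other than the number of iterations. -/
structure ARCPOParams where
  η : ℝ
  α : ℝ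
  q : ℝ
  τ : ℝ
  μ : ℝ
  δ : ℝ
  B : ℝ

/-- The variables of AR-CPO after an iteration: `λ_t`, `\bar λ_t`, `π_t` and the number of oracle
queries made so far. -/
structure ARCPOState (S A : Type*) (m : ℕ) where
  lam : Fin m → ℝ
  lamBar : Fin m → ℝ
  pol : S → A → ℝ
  queries : ℕ

namespace ConstrainedMDP

variable {S A : Type*} [Fintype S] [Fintype A] {m : ℕ}

/-- The law of the state `s_t` under `π` when `s_0` has the law `d`. -/
def stateDist (M : ConstrainedMDP S A m) (π : S → A → ℝ) (d : S → ℝ) : ℕ → S → ℝ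
  | 0 => d
  | t + 1 => fun s' => ∑ s, ∑ a, M.stateDist π d t s * π s a * M.P s a s'

/-- `E[∑_t γ^t f(s_t, a_t) | s_0 = s]` under `π`. -/
def valueAt [DecidableEq S] (M : ConstrainedMDP S A m) (f : S → A → ℝ) (π : S → A → ℝ)
    (s : S) : ℝ :=
  ∑' t : ℕ, M.γ ^ t * ∑ s', ∑ a, M.stateDist π (Pi.single s 1) t s' * π s' a * f s' a

/-- `E_{s_0 ∼ ρ}` of `valueAt`. -/
def value [DecidableEq S] (M : ConstrainedMDP S A m) (f : S → A → ℝ) (π : S → A → ℝ) : ℝ :=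
  ∑ s, M.ρ s * M.valueAt f π s

/-- The objective value `V_0^π(ρ)`. -/
def V0 [DecidableEq S] (M : ConstrainedMDP S A m) (π : S → A → ℝ) : ℝ := M.value (M.r 0) π

/-- The constraint values `V_i^π(ρ)`, `i = 1, …, m` (indexed from zero). -/
def V [DecidableEq S] (M : ConstrainedMDP S A m) (π : S → A → ℝ) (i : Fin m) : ℝ :=
  M.value (M.r i.succ) π

/-- The discounted state-action visitation distribution `ν_ρ^π`. -/
def visitation (M : ConstrainedMDP S A m) (π : S → A → ℝ) (s : S) (a : A) : ℝ :=
  (1 - M.γ) * ∑' t : ℕ, M.γ ^ t * (M.stateDist π M.ρ t s * π s a)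

/-- `r_{i,max}`. -/
def rmax (M : ConstrainedMDP S A m) (i : Fin (m + 1)) : ℝ := ⨆ x : S × A, M.r i x.1 x.2

/-- `R_max`, the Euclidean norm of `(r_{1,max}, …, r_{m,max})`. -/
def Rmax (M : ConstrainedMDP S A m) : ℝ := √(∑ i : Fin m, M.rmax i.succ ^ 2)

/-- The optimal value of the constrained problem. -/
def optValue [DecidableEq S] (M : ConstrainedMDP S A m) : ℝ :=
  sSup {v | ∃ π, IsPolicy π ∧ (∀ i, M.c i ≤ M.V π i) ∧ v = M.V0 π}

/-- An `ε`-optimal policy: optimality gap and `ℓ¹` constraint violation are at most `ε`. -/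
def IsEpsOptimal [DecidableEq S] (M : ConstrainedMDP S A m) (ε : ℝ) (π : S → A → ℝ) : Prop :=
  IsPolicy π ∧ M.optValue - M.V0 π ≤ ε ∧ ∑ i, max 0 (M.c i - M.V π i) ≤ ε

/-- The discounted entropy (`0 log 0 = 0`). -/
def entropy [DecidableEq S] (M : ConstrainedMDP S A m) (π : S → A → ℝ) : ℝ :=
  -M.value (fun s a => Real.log (π s a)) π

/-- The regularized Lagrangian `L_{τ,μ}(π, λ)`. -/
def regLagrangian [DecidableEq S] (M : ConstrainedMDP S A m) (τ μ : ℝ) (π : S → A → ℝ)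
    (l : Fin m → ℝ) : ℝ :=
  M.V0 π + ∑ i, l i * (M.V π i - M.c i) + τ * M.entropy π + μ / 2 * ∑ i, l i ^ 2

/-- Slater condition with margin `ξ`. -/
def Slater [DecidableEq S] (M : ConstrainedMDP S A m) (ξ : ℝ) : Prop :=
  ∃ π, IsPolicy π ∧ ∀ i, M.c i + ξ ≤ M.V π i

/-- The state chain induced by `π` converges geometrically, in total variation and uniformly in
the initial state, to a stationary distribution. -/
def IsUniformlyErgodic [DecidableEq S] (M : ConstrainedMDP S A m) (C β : ℝ)
    (π : S → A → ℝ) : Prop :=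
  ∃ χ : S → ℝ, (∀ s, 0 ≤ χ s) ∧ ∑ s, χ s = 1 ∧ M.stateDist π χ 1 = χ ∧
    ∀ (t : ℕ) (s : S),
      1 / 2 * ∑ s', |M.stateDist π (Pi.single s 1) t s' - χ s'| ≤ C * β ^ t

/-- For each `λ ∈ Λ` the maximizer of `L_{τ,μ}(·, λ)` over all policies induces a uniformly
ergodic chain, with constants `C`, `β` that do not depend on `λ`. -/
def ErgodicAssumption [DecidableEq S] (M : ConstrainedMDP S A m) (C β B τ μ : ℝ) : Prop :=
  ∀ l ∈ dualBox m B, ∃ π, IsPolicy π ∧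
    IsMaxOn (fun π' => M.regLagrangian τ μ π' l) {π' | IsPolicy π'} π ∧
    M.IsUniformlyErgodic C β π

/-! ### The policy optimizers -/

/-- `r_λ = r_0 + ∑ λ_i r_i`. -/
def rLam (M : ConstrainedMDP S A m) (l : Fin m → ℝ) (s : S) (a : A) : ℝ :=
  M.r 0 s a + ∑ i : Fin m, l i * M.r i.succ s a

/-- `V_{τ,λ}^π(ρ)`. -/
def regValue [DecidableEq S] (M : ConstrainedMDP S A m) (τ : ℝ) (l : Fin m → ℝ)
    (π : S → A → ℝ) : ℝ :=
  M.value (M.rLam l) π + τ * M.entropy π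

/-- The Fisher information matrix of the softmax parametrization. -/
def fisher [DecidableEq S] [DecidableEq A] (M : ConstrainedMDP S A m) (θ : S × A → ℝ) :
    Matrix (S × A) (S × A) ℝ :=
  fun x y => ∑ s, ∑ a, M.visitation (softmaxPolicy θ) s a *
    (partialDeriv (fun θ' => Real.log (softmaxPolicy θ' s a)) θ x *
      partialDeriv (fun θ' => Real.log (softmaxPolicy θ' s a)) θ y)

/-- One natural policy gradient update, with step size `(1 - γ) / τ`. -/
def npgStep [DecidableEq S] [DecidableEq A] (M : ConstrainedMDP S A m) (τ : ℝ)
    (l : Fin m → ℝ) (θ : S × A → ℝ) : S × A → ℝ :=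
  θ + ((1 - M.γ) / τ) • (pinv (M.fisher θ)).mulVec
    (fun x => partialDeriv (fun θ' => M.regValue τ l (softmaxPolicy θ')) θ x)

/-- The soft Bellman operator. -/
def softBellman (M : ConstrainedMDP S A m) (τ : ℝ) (l : Fin m → ℝ) (Q : S × A → ℝ) :
    S × A → ℝ :=
  fun x => M.rLam l x.1 x.2 +
    M.γ * ∑ s', M.P x.1 x.2 s' * (τ * Real.log (∑ a', Real.exp (Q (s', a') / τ)))

/-- The number `K` of inner iterations. -/
def innerIters (M : ConstrainedMDP S A m) (B δ τ : ℝ) : ℕ :=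
  ⌈Real.log (2 * (M.rmax 0 + B * M.Rmax) / ((1 - M.γ) * δ * τ)) / Real.log (1 / M.γ)⌉₊

/-- `RegPO(δ, λ, τ)`. Each update (an exact natural gradient, or an application of the soft
Bellman operator) costs one query. The natural policy gradient loop runs over `k = 0, …, K`, the
soft Q-learning loop over `k = 0, …, K - 1`. -/
def regPO [DecidableEq S] [DecidableEq A] (M : ConstrainedMDP S A m) (B δ τ : ℝ)
    (l : Fin m → ℝ) : RegPO → Counted (S → A → ℝ)
  | .npg =>
      let out := Counted.loop (fun θ => ⟨M.npgStep τ l θ, 1⟩) (M.innerIters B δ τ + 1) 0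
      ⟨softmaxPolicy out.val, out.queries⟩
  | .softQ =>
      let out := Counted.loop (fun Q => ⟨M.softBellman τ l Q, 1⟩) (M.innerIters B δ τ) 0
      ⟨softmaxPolicy (fun x => out.val x / τ), out.queries⟩

/-! ### AR-CPO -/

/-- The first `t` iterations of AR-CPO. The evaluation of `V^{π_t}(ρ)` is charged as one further
query. The policy stored for `t = 0` is a placeholder that is never used. -/
def arcpo [DecidableEq S] [DecidableEq A] (M : ConstrainedMDP S A m) (p : ARCPOParams)
    (o : RegPO) : ℕ → ARCPOState S A m
  | 0 => ⟨0, 0, fun _ _ => 0, 0⟩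
  | t + 1 =>
      let st := M.arcpo p o t
      let lamUnd : Fin m → ℝ := (1 - p.q) • st.lamBar + p.q • st.lam
      let out := M.regPO p.B p.δ p.τ lamUnd o
      let grad : Fin m → ℝ := fun i => M.V out.val i - M.c i + p.μ * lamUnd i
      let lam := argminOn (fun l =>
        p.η * (∑ i, grad i * l i + p.μ / 2 * ∑ i, (l i - lamUnd i) ^ 2)
          + 1 / 2 * ∑ i, (l i - st.lam i) ^ 2) (dualBox m p.B)
      ⟨lam, (1 - p.α) • st.lamBar + p.α • lam, out.val, st.queries + out.queries + 1⟩

/-- The weight of the policy `π_t` in the output after `T` iterations. -/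
def outputWeight (α : ℝ) (T t : ℕ) : ℝ :=
  if t = 1 then (1 - α) ^ (T - 1) else α * (1 - α) ^ (T - t)

/-- The weighted visitation distribution of `π_1, …, π_T`. -/
def outputVisitation [DecidableEq S] [DecidableEq A] (M : ConstrainedMDP S A m)
    (p : ARCPOParams) (o : RegPO) (T : ℕ) (s : S) (a : A) : ℝ :=
  ∑ t ∈ Finset.Icc 1 T, outputWeight p.α T t * M.visitation (M.arcpo p o t).pol s a

open Classical in
/-- The output policy. At states that are never visited, where the defining quotient
is `0 / 0`, it is uniform. -/
def arcpoOutput [DecidableEq S] [DecidableEq A] (M : ConstrainedMDP S A m) (p : ARCPOParams)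
    (o : RegPO) (T : ℕ) : S → A → ℝ :=
  fun s a =>
    if ∑ a', M.outputVisitation p o T s a' = 0 then 1 / (Fintype.card A : ℝ)
    else M.outputVisitation p o T s a / ∑ a', M.outputVisitation p o T s a'

/-- The radius `B = r_{0,max} / ((1 - γ) ξ)`. -/
def radius (M : ConstrainedMDP S A m) (ξ : ℝ) : ℝ := M.rmax 0 / ((1 - M.γ) * ξ)

/-- `L_ν = ⌈log_β (C⁻¹)⌉ + (1 - β)⁻¹ + 1`. -/
def Lnu (C β : ℝ) : ℝ := (⌈Real.logb β C⁻¹⌉ : ℝ) + (1 - β)⁻¹ + 1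

/-- `L_d = 2 R_max² L_ν / ((1 - γ)² τ) + μ`. -/
def Ld (M : ConstrainedMDP S A m) (C β τ μ : ℝ) : ℝ :=
  2 * M.Rmax ^ 2 * Lnu C β / ((1 - M.γ) ^ 2 * τ) + μ

/-- The parameters of AR-CPO for given `τ, μ, δ`: radius `B`, and step sizes
`α = √(μ / (2 L_d))`, `q = (2 α - μ / L_d) / (2 - μ / L_d)`, `η = α / (μ (1 - α))`. -/
def params (M : ConstrainedMDP S A m) (ξ C β τ μ δ : ℝ) : ARCPOParams where
  η := √(μ / (2 * M.Ld C β τ μ)) / (μ * (1 - √(μ / (2 * M.Ld C β τ μ))))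
  α := √(μ / (2 * M.Ld C β τ μ))
  q := (2 * √(μ / (2 * M.Ld C β τ μ)) - μ / M.Ld C β τ μ) / (2 - μ / M.Ld C β τ μ)
  τ := τ
  μ := μ
  δ := δ
  B := M.radius ξ

end ConstrainedMDP

end

/-!
The dual function `D(λ) = max_π L_{τ,μ}(π, λ)` is `μ`-strongly convex, and AR-CPO is an inexact
accelerated projected gradient method for it on the box. For each iterate `π_t` the function
`L(π_t, ·)` is a quadratic lower bound of `D`, exact up to the inner error at the extrapolation
point. Unrolling the accelerated method (`accelerated_step`, `le_of_contraction`) therefore bounds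
`D(\bar λ_T)` by the weighted average of the `L(π_t, λ)`, for every `λ` in the box at once, up to
`(1 - α)^T` times the initial gap and the inner error divided by `α`. Values are linear along
mixtures of occupancies (`value_mix`), so this average is essentially the Lagrangian of the output
policy, and `D(\bar λ_T)` dominates the constrained optimum: the output is an approximate saddle
point (`optValue_le_lagrangian`). Testing with `λ = 0` gives the optimality gap, testing with
`λ = 2B` on the violated constraints gives the violation, since Slater's condition makes `B` an
exact penalty (`V0_sub_le_optValue`).

Acceleration needs the upper model of `D` with curvature `L_d` (`regLagrangian_sub_le`). By the
master identity `sum_occ_eq` the regularized value of `π` is the optimal one minus `τ` times the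
occupancy average of the relative entropy to the softmax policy of the fixed point of the soft
Bellman operator. Softmax policies are Lipschitz in the multiplier, and near a uniformly ergodic
policy values are Lipschitz in the policy with a constant that loses only one power of
`1 / (1 - γ)` (`abs_value_sub_le_of_ergodic`). Positivity of the rewards, used both for the
multipliers and for the values, gains the constant factors that the logarithm in `L_ν` costs.
Ergodicity is assumed for some maximizer, which is pinned down only on the reachable states
(`Reach`); the occupancies of full-support policies live exactly there.

The inner loops converge linearly at rate `γ`. Soft Q-learning is a contraction. A natural policy
gradient step with step size `(1 - γ) / τ` is a step of soft policy iteration on reachable states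
(`softmaxPolicy_npgStep`): the gradient is the Fisher matrix applied to the advantage, so the
pseudo-inverse returns the advantage up to a function of the state, which softmax ignores.

With `τ ~ (1 - γ) ε` and `μ ~ (1 - γ)² ε` the step size `α` is of order `(1 - γ)^{5/2} ε`
(`stepSize_bounds`), and `K` is of order `log(·) / (1 - γ)`; the product of the two loop lengths
is the claimed query count.
-/

/-! ### Occupancies and values -/

namespace ConstrainedMDP

theorem single_one_nonneg {S : Type*} [DecidableEq S] (s : S) :
    ∀ s', 0 ≤ (Pi.single s (1 : ℝ) : S → ℝ) s' := fun s' => by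
  by_cases h : s' = s
  · subst h; simp
  · simp [h]

variable {S A : Type*} [Fintype S] [Fintype A] {m : ℕ}

theorem stateDist_nonneg (M : ConstrainedMDP S A m) {π : S → A → ℝ} (hπ : IsPolicy π)
    {d : S → ℝ} (hd : ∀ s, 0 ≤ d s) (t : ℕ) (s : S) : 0 ≤ M.stateDist π d t s := by
  induction t generalizing s with
  | zero => exact hd s
  | succ t ih =>
    exact Finset.sum_nonneg fun s' _ => Finset.sum_nonneg fun a _ =>
      mul_nonneg (mul_nonneg (ih s') (hπ.1 s' a)) (M.P_nonneg _ _ _)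

theorem stateDist_sum (M : ConstrainedMDP S A m) {π : S → A → ℝ} (hπ : IsPolicy π)
    (d : S → ℝ) (t : ℕ) : ∑ s, M.stateDist π d t s = ∑ s, d s := by
  induction t with
  | zero => rfl
  | succ t ih =>
    rw [← ih]
    simp only [stateDist]
    rw [Finset.sum_comm]
    refine Finset.sum_congr rfl fun s _ => ?_
    rw [Finset.sum_comm]
    simp_rw [← Finset.mul_sum, M.P_sum, mul_one, ← Finset.mul_sum, hπ.2, mul_one]

theorem stateDist_le_sum (M : ConstrainedMDP S A m) {π : S → A → ℝ} (hπ : IsPolicy π)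
    {d : S → ℝ} (hd : ∀ s, 0 ≤ d s) (t : ℕ) (s : S) : M.stateDist π d t s ≤ ∑ s, d s := by
  rw [← M.stateDist_sum hπ d t]
  exact Finset.single_le_sum (fun s _ => M.stateDist_nonneg hπ hd t s) (Finset.mem_univ s)

theorem stateDist_succ' (M : ConstrainedMDP S A m) (π : S → A → ℝ) (d : S → ℝ) (t : ℕ) :
    M.stateDist π d (t + 1) = M.stateDist π (M.stateDist π d 1) t := by
  induction t with
  | zero => rfl
  | succ t ih => rw [stateDist, ih]; rfl

theorem stateDist_eq_sum_single [DecidableEq S] (M : ConstrainedMDP S A m) (π : S → A → ℝ)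
    (d : S → ℝ) (t : ℕ) (s' : S) :
    M.stateDist π d t s' = ∑ s, d s * M.stateDist π (Pi.single s 1) t s' := by
  induction t generalizing s' with
  | zero => simp [stateDist, Pi.single_apply]
  | succ t ih =>
    simp only [stateDist]
    simp_rw [ih, Finset.sum_mul, Finset.mul_sum]
    rw [Finset.sum_congr rfl fun s _ => Finset.sum_comm, Finset.sum_comm]
    refine Finset.sum_congr rfl fun s _ => Finset.sum_congr rfl fun s' _ =>
      Finset.sum_congr rfl fun a _ => by ring

/-- The unnormalized discounted occupancy `∑_t γ^t Pr(s_t = s)` of the states, for the initial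
law `d`. -/
noncomputable def occ (M : ConstrainedMDP S A m) (π : S → A → ℝ) (d : S → ℝ) (s : S) : ℝ :=
  ∑' t : ℕ, M.γ ^ t * M.stateDist π d t s

theorem summable_occ (M : ConstrainedMDP S A m) {π : S → A → ℝ} (hπ : IsPolicy π)
    {d : S → ℝ} (hd : ∀ s, 0 ≤ d s) (s : S) :
    Summable fun t : ℕ => M.γ ^ t * M.stateDist π d t s :=
  Summable.of_nonneg_of_le
    (fun t => mul_nonneg (pow_nonneg M.γ_pos.le t) (M.stateDist_nonneg hπ hd t s))
    (fun t => mul_le_mul_of_nonneg_left (M.stateDist_le_sum hπ hd t s) (pow_nonneg M.γ_pos.le t))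
    ((summable_geometric_of_lt_one M.γ_pos.le M.γ_lt_one).mul_right _)

theorem stateDist_le_occ (M : ConstrainedMDP S A m) {π : S → A → ℝ} (hπ : IsPolicy π)
    {d : S → ℝ} (hd : ∀ s, 0 ≤ d s) (t : ℕ) (s : S) :
    M.γ ^ t * M.stateDist π d t s ≤ M.occ π d s :=
  (M.summable_occ hπ hd s).le_tsum t fun t _ =>
    mul_nonneg (pow_nonneg M.γ_pos.le t) (M.stateDist_nonneg hπ hd t s)

theorem le_occ (M : ConstrainedMDP S A m) {π : S → A → ℝ} (hπ : IsPolicy π)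
    {d : S → ℝ} (hd : ∀ s, 0 ≤ d s) (s : S) : d s ≤ M.occ π d s := by
  simpa [stateDist] using M.stateDist_le_occ hπ hd 0 s

theorem occ_nonneg (M : ConstrainedMDP S A m) {π : S → A → ℝ} (hπ : IsPolicy π)
    {d : S → ℝ} (hd : ∀ s, 0 ≤ d s) (s : S) : 0 ≤ M.occ π d s :=
  tsum_nonneg fun t => mul_nonneg (pow_nonneg M.γ_pos.le t) (M.stateDist_nonneg hπ hd t s)

/-- The total occupancy is `1 / (1 - γ)` times the initial mass. -/
theorem occ_sum (M : ConstrainedMDP S A m) {π : S → A → ℝ} (hπ : IsPolicy π)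
    {d : S → ℝ} (hd : ∀ s, 0 ≤ d s) : ∑ s, M.occ π d s = (∑ s, d s) / (1 - M.γ) := by
  unfold occ
  rw [← Summable.tsum_finsetSum fun s _ => M.summable_occ hπ hd s]
  simp_rw [← Finset.mul_sum, M.stateDist_sum hπ]
  rw [tsum_mul_right, tsum_geometric_of_lt_one M.γ_pos.le M.γ_lt_one]
  ring

/-- The forward (flow) equation of the occupancy. -/
theorem occ_flow (M : ConstrainedMDP S A m) {π : S → A → ℝ} (hπ : IsPolicy π)
    {d : S → ℝ} (hd : ∀ s, 0 ≤ d s) (s' : S) :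
    M.occ π d s' = d s' + M.γ * ∑ s, ∑ a, M.occ π d s * π s a * M.P s a s' := by
  conv_lhs => rw [occ, (M.summable_occ hπ hd s').tsum_eq_zero_add]
  simp only [pow_zero, one_mul, stateDist]
  congr 1
  have h : ∀ t : ℕ, M.γ ^ (t + 1) * ∑ s, ∑ a, M.stateDist π d t s * π s a * M.P s a s' =
      ∑ s, (M.γ ^ t * M.stateDist π d t s) * (M.γ * ∑ a, π s a * M.P s a s') := by
    intro t
    rw [Finset.mul_sum]
    refine Finset.sum_congr rfl fun s _ => ?_
    simp_rw [Finset.mul_sum]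
    exact Finset.sum_congr rfl fun a _ => by ring
  simp_rw [h]
  rw [Summable.tsum_finsetSum fun s _ => (M.summable_occ hπ hd s).mul_right _, Finset.mul_sum]
  refine Finset.sum_congr rfl fun s _ => ?_
  rw [tsum_mul_right]
  simp_rw [Finset.mul_sum]
  exact Finset.sum_congr rfl fun a _ => by rw [occ]; ring

/-- The master identity: the value of `π` is the initial average of an arbitrary function `v`
plus the occupancy average of the Bellman residual of `v`. Performance differences, Bellman
equations and the policy gradient are all instances. -/
theorem sum_occ_eq (M : ConstrainedMDP S A m) {π : S → A → ℝ} (hπ : IsPolicy π)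
    {d : S → ℝ} (hd : ∀ s, 0 ≤ d s) (f : S → A → ℝ) (v : S → ℝ) :
    ∑ s, ∑ a, M.occ π d s * π s a * f s a = ∑ s, d s * v s +
      ∑ s, M.occ π d s *
        (∑ a, π s a * (f s a + M.γ * ∑ s', M.P s a s' * v s') - v s) := by
  have h1 : ∑ s', M.occ π d s' * v s' = ∑ s', d s' * v s' +
      ∑ s, ∑ a, M.occ π d s * π s a * (M.γ * ∑ s', M.P s a s' * v s') := by
    have : ∀ s', M.occ π d s' * v s' = d s' * v s' +
        ∑ s, ∑ a, M.occ π d s * π s a * (M.γ * (M.P s a s' * v s')) := by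
      intro s'
      conv_lhs => rw [M.occ_flow hπ hd s']
      rw [add_mul, Finset.mul_sum, Finset.sum_mul]
      congr 1
      refine Finset.sum_congr rfl fun s _ => ?_
      rw [Finset.mul_sum, Finset.sum_mul]
      exact Finset.sum_congr rfl fun a _ => by ring
    simp_rw [this, Finset.sum_add_distrib]
    congr 1
    rw [Finset.sum_comm]
    refine Finset.sum_congr rfl fun s _ => ?_
    rw [Finset.sum_comm]
    exact Finset.sum_congr rfl fun a _ => by simp_rw [Finset.mul_sum]
  have h2 : ∀ s, M.occ π d s *
      (∑ a, π s a * (f s a + M.γ * ∑ s', M.P s a s' * v s') - v s) =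
      ∑ a, M.occ π d s * π s a * f s a +
        ∑ a, M.occ π d s * π s a * (M.γ * ∑ s', M.P s a s' * v s') - M.occ π d s * v s := by
    intro s
    rw [mul_sub, Finset.mul_sum, ← Finset.sum_add_distrib]
    congr 1
    exact Finset.sum_congr rfl fun a _ => by ring
  simp_rw [h2, Finset.sum_sub_distrib, Finset.sum_add_distrib]
  rw [h1]
  ring

theorem continuous_occ_of_continuous (M : ConstrainedMDP S A m) {p : ℝ → S → A → ℝ}
    (hp : ∀ t, IsPolicy (p t)) (hc : ∀ s a, Continuous fun t => p t s a) (s : S) :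
    Continuous fun t => M.occ (p t) M.ρ s := by
  have h : ∀ (n : ℕ) (s : S), Continuous fun t => M.stateDist (p t) M.ρ n s := by
    intro n
    induction n with
    | zero => exact fun s => continuous_const
    | succ n ih =>
      exact fun s => continuous_finsetSum _ fun s' _ => continuous_finsetSum _ fun a _ =>
        ((ih s').mul (hc s' a)).mul continuous_const
  refine continuous_tsum (fun n => continuous_const.mul (h n s))
    (summable_geometric_of_lt_one M.γ_pos.le M.γ_lt_one) fun n t => ?_
  have h0 := M.stateDist_nonneg (hp t) M.ρ_nonneg n s
  have h1 := M.stateDist_le_sum (hp t) M.ρ_nonneg n s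
  rw [M.ρ_sum] at h1
  rw [Real.norm_eq_abs, abs_of_nonneg (mul_nonneg (pow_nonneg M.γ_pos.le n) h0)]
  exact mul_le_of_le_one_right (pow_nonneg M.γ_pos.le n) h1

theorem visitation_eq (M : ConstrainedMDP S A m) (π : S → A → ℝ) (s : S) (a : A) :
    M.visitation π s a = (1 - M.γ) * (M.occ π M.ρ s * π s a) := by
  unfold visitation occ
  rw [← tsum_mul_right]
  simp_rw [mul_assoc]

section Value

variable [DecidableEq S]

theorem sum_single_mul (s : S) (v : S → ℝ) :
    ∑ s', (Pi.single s (1 : ℝ) : S → ℝ) s' * v s' = v s := by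
  simp [Pi.single_apply]

theorem sum_single_one (s : S) : ∑ s', (Pi.single s (1 : ℝ) : S → ℝ) s' = 1 := by
  simp [Pi.single_apply]

theorem valueAt_eq (M : ConstrainedMDP S A m) {π : S → A → ℝ} (hπ : IsPolicy π)
    (f : S → A → ℝ) (s : S) :
    M.valueAt f π s = ∑ s', ∑ a, M.occ π (Pi.single s 1) s' * π s' a * f s' a := by
  have h : ∀ t : ℕ, M.γ ^ t * ∑ s', ∑ a, M.stateDist π (Pi.single s 1) t s' * π s' a * f s' a =
      ∑ s', (M.γ ^ t * M.stateDist π (Pi.single s 1) t s') * ∑ a, π s' a * f s' a := by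
    intro t
    simp_rw [Finset.mul_sum]
    exact Finset.sum_congr rfl fun s _ => Finset.sum_congr rfl fun a _ => by ring
  unfold valueAt
  simp_rw [h]
  rw [Summable.tsum_finsetSum fun s' _ =>
    (M.summable_occ hπ (single_one_nonneg s) s').mul_right _]
  refine Finset.sum_congr rfl fun s' _ => ?_
  rw [tsum_mul_right, Finset.mul_sum]
  exact Finset.sum_congr rfl fun a _ => by rw [occ]; ring

theorem occ_eq_sum_single (M : ConstrainedMDP S A m) {π : S → A → ℝ} (hπ : IsPolicy π)
    (d : S → ℝ) (s' : S) : M.occ π d s' = ∑ s, d s * M.occ π (Pi.single s 1) s' := by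
  unfold occ
  have h : ∀ t : ℕ, M.γ ^ t * M.stateDist π d t s' =
      ∑ s, d s * (M.γ ^ t * M.stateDist π (Pi.single s 1) t s') := by
    intro t
    rw [M.stateDist_eq_sum_single, Finset.mul_sum]
    exact Finset.sum_congr rfl fun s _ => by ring
  simp_rw [h]
  rw [Summable.tsum_finsetSum fun s _ => (M.summable_occ hπ (single_one_nonneg s) s').mul_left _]
  exact Finset.sum_congr rfl fun s _ => tsum_mul_left

theorem sum_mul_valueAt (M : ConstrainedMDP S A m) {π : S → A → ℝ} (hπ : IsPolicy π)
    (f : S → A → ℝ) (d : S → ℝ) :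
    ∑ s, d s * M.valueAt f π s = ∑ s, ∑ a, M.occ π d s * π s a * f s a := by
  simp_rw [M.valueAt_eq hπ, Finset.mul_sum]
  rw [Finset.sum_comm]
  refine Finset.sum_congr rfl fun s' _ => ?_
  rw [Finset.sum_comm]
  refine Finset.sum_congr rfl fun a _ => ?_
  rw [M.occ_eq_sum_single hπ d, Finset.sum_mul, Finset.sum_mul]
  exact Finset.sum_congr rfl fun s _ => by ring

theorem value_eq (M : ConstrainedMDP S A m) {π : S → A → ℝ} (hπ : IsPolicy π)
    (f : S → A → ℝ) : M.value f π = ∑ s, ∑ a, M.occ π M.ρ s * π s a * f s a :=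
  M.sum_mul_valueAt hπ f M.ρ

/-- The backward (Bellman) equation of a fixed policy. -/
theorem valueAt_bellman (M : ConstrainedMDP S A m) {π : S → A → ℝ} (hπ : IsPolicy π)
    (f : S → A → ℝ) (s : S) :
    M.valueAt f π s = ∑ a, π s a * (f s a + M.γ * ∑ s', M.P s a s' * M.valueAt f π s') := by
  have h0 : ∀ s', M.occ π (Pi.single s 1) s' =
      (Pi.single s (1 : ℝ) : S → ℝ) s' + M.γ * M.occ π (M.stateDist π (Pi.single s 1) 1) s' := by
    intro s'
    conv_lhs => rw [occ, (M.summable_occ hπ (single_one_nonneg s) s').tsum_eq_zero_add]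
    rw [occ, ← tsum_mul_left]
    simp only [pow_zero, one_mul]
    congr 1
    exact tsum_congr fun t => by rw [M.stateDist_succ', pow_succ]; ring
  have h1 : ∀ s', M.stateDist π (Pi.single s 1) 1 s' = ∑ a, π s a * M.P s a s' := by
    intro s'
    simp only [stateDist, Pi.single_apply]
    rw [Finset.sum_eq_single s]
    · simp
    · intro b _ hb
      simp [hb]
    · simp
  have h2 := M.sum_mul_valueAt hπ f (M.stateDist π (Pi.single s 1) 1)
  rw [M.valueAt_eq hπ]
  simp_rw [h0, add_mul, Finset.sum_add_distrib]
  have h3 : ∑ s', ∑ a, M.γ * M.occ π (M.stateDist π (Pi.single s 1) 1) s' * π s' a * f s' a =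
      M.γ * ∑ s', M.stateDist π (Pi.single s 1) 1 s' * M.valueAt f π s' := by
    rw [h2]
    simp_rw [Finset.mul_sum]
    exact Finset.sum_congr rfl fun s _ => Finset.sum_congr rfl fun a _ => by ring
  rw [h3]
  simp_rw [h1, mul_add, Finset.sum_add_distrib]
  congr 1
  · rw [Finset.sum_eq_single s]
    · simp
    · intro b _ hb
      simp [hb]
    · simp
  · rw [Finset.mul_sum]
    simp_rw [Finset.sum_mul, Finset.mul_sum]
    rw [Finset.sum_comm]
    exact Finset.sum_congr rfl fun a _ => Finset.sum_congr rfl fun s _ => by ring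

/-- The performance difference of two policies, weighted by the occupancy of the second one. -/
theorem value_sub_value (M : ConstrainedMDP S A m) {π π' : S → A → ℝ} (hπ : IsPolicy π)
    (hπ' : IsPolicy π') (f : S → A → ℝ) :
    M.value f π' - M.value f π = ∑ s, M.occ π' M.ρ s * ∑ a, (π' s a - π s a) *
      (f s a + M.γ * ∑ s', M.P s a s' * M.valueAt f π s') := by
  rw [M.value_eq hπ', M.sum_occ_eq hπ' M.ρ_nonneg f (M.valueAt f π)]
  change M.value f π + _ - _ = _
  rw [add_sub_cancel_left]
  refine Finset.sum_congr rfl fun s _ => ?_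
  congr 1
  conv_lhs => rw [M.valueAt_bellman hπ]
  rw [← Finset.sum_sub_distrib]
  exact Finset.sum_congr rfl fun a _ => by ring

theorem valueAt_mono (M : ConstrainedMDP S A m) {π : S → A → ℝ} (hπ : IsPolicy π)
    {f : S → A → ℝ} {b : ℝ} (hf : ∀ s a, f s a ≤ b) (s : S) :
    M.valueAt f π s ≤ b / (1 - M.γ) := by
  have h : ∑ s', ∑ a, M.occ π (Pi.single s 1) s' * π s' a * b = b / (1 - M.γ) := by
    simp_rw [← Finset.sum_mul, ← Finset.mul_sum, hπ.2, mul_one]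
    rw [M.occ_sum hπ (single_one_nonneg s), sum_single_one]
    ring
  rw [M.valueAt_eq hπ, ← h]
  exact Finset.sum_le_sum fun s' _ => Finset.sum_le_sum fun a _ =>
    mul_le_mul_of_nonneg_left (hf _ _)
      (mul_nonneg (M.occ_nonneg hπ (single_one_nonneg s) _) (hπ.1 _ _))

theorem valueAt_nonneg (M : ConstrainedMDP S A m) {π : S → A → ℝ} (hπ : IsPolicy π)
    {f : S → A → ℝ} (hf : ∀ s a, 0 ≤ π s a * f s a) (s : S) : 0 ≤ M.valueAt f π s := by
  rw [M.valueAt_eq hπ]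
  exact Finset.sum_nonneg fun s' _ => Finset.sum_nonneg fun a _ => by
    rw [mul_assoc]
    exact mul_nonneg (M.occ_nonneg hπ (single_one_nonneg s) _) (hf _ _)

theorem value_le (M : ConstrainedMDP S A m) {π : S → A → ℝ} (hπ : IsPolicy π)
    {f : S → A → ℝ} {b : ℝ} (hf : ∀ s a, f s a ≤ b) : M.value f π ≤ b / (1 - M.γ) := by
  calc M.value f π ≤ ∑ s, M.ρ s * (b / (1 - M.γ)) := Finset.sum_le_sum fun s _ =>
        mul_le_mul_of_nonneg_left (M.valueAt_mono hπ hf s) (M.ρ_nonneg s)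
    _ = b / (1 - M.γ) := by rw [← Finset.sum_mul, M.ρ_sum, one_mul]

theorem value_nonneg (M : ConstrainedMDP S A m) {π : S → A → ℝ} (hπ : IsPolicy π)
    {f : S → A → ℝ} (hf : ∀ s a, 0 ≤ π s a * f s a) : 0 ≤ M.value f π :=
  Finset.sum_nonneg fun s _ => mul_nonneg (M.ρ_nonneg s) (M.valueAt_nonneg hπ hf s)

end Value

end ConstrainedMDP

/-! ### Softmax distributions on a finite set -/

section RelativeEntropy

variable {A : Type*} [Fintype A]

/-- The termwise bound behind Gibbs' inequality. -/
theorem sub_le_mul_log_sub_log {p q : ℝ} (hp : 0 ≤ p) (hq : 0 < q) :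
    p - q ≤ p * (Real.log p - Real.log q) := by
  rcases hp.eq_or_lt with rfl | hp
  · simpa using hq.le
  · have h := Real.one_sub_inv_le_log_of_pos (div_pos hp hq)
    rw [Real.log_div hp.ne' hq.ne', inv_div] at h
    have h2 := mul_le_mul_of_nonneg_left h hp.le
    have h3 : p * (1 - q / p) = p - q := by field_simp
    rwa [h3] at h2

theorem eq_of_sub_eq_mul_log_sub_log {p q : ℝ} (hp : 0 ≤ p) (hq : 0 < q)
    (h : p * (Real.log p - Real.log q) = p - q) : p = q := by
  rcases hp.eq_or_lt with rfl | hp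
  · simp at h; linarith
  · by_contra hne
    have h1 := Real.log_lt_sub_one_of_pos (div_pos hq hp)
      (fun h => hne ((div_eq_one_iff_eq hp.ne').1 h).symm)
    rw [Real.log_div hq.ne' hp.ne'] at h1
    have h2 := mul_lt_mul_of_pos_left h1 hp
    have h3 : p * (q / p - 1) = q - p := by field_simp
    rw [h3] at h2
    linarith

theorem sum_mul_log_sub_log_nonneg {p q : A → ℝ} (hp : ∀ a, 0 ≤ p a) (hp1 : ∑ a, p a = 1)
    (hq : ∀ a, 0 < q a) (hq1 : ∑ a, q a = 1) :
    0 ≤ ∑ a, p a * (Real.log (p a) - Real.log (q a)) := by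
  have h : ∑ a, (p a - q a) ≤ ∑ a, p a * (Real.log (p a) - Real.log (q a)) :=
    Finset.sum_le_sum fun a _ => sub_le_mul_log_sub_log (hp a) (hq a)
  rwa [Finset.sum_sub_distrib, hp1, hq1, sub_self] at h

theorem eq_of_sum_mul_log_sub_log_eq_zero {p q : A → ℝ} (hp : ∀ a, 0 ≤ p a)
    (hp1 : ∑ a, p a = 1) (hq : ∀ a, 0 < q a) (hq1 : ∑ a, q a = 1)
    (h : ∑ a, p a * (Real.log (p a) - Real.log (q a)) = 0) : p = q := by
  have h0 : ∑ a, (p a - q a) = ∑ a, p a * (Real.log (p a) - Real.log (q a)) := by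
    rw [Finset.sum_sub_distrib, hp1, hq1, sub_self, h]
  have h1 := (Finset.sum_eq_sum_iff_of_le
    fun a _ => sub_le_mul_log_sub_log (hp a) (hq a)).1 h0
  funext a
  exact eq_of_sub_eq_mul_log_sub_log (hp a) (hq a) (h1 a (Finset.mem_univ a)).symm

/-- The relative entropy of the action distributions at the state `s`. -/
noncomputable def klAt {S : Type*} (π π' : S → A → ℝ) (s : S) : ℝ :=
  ∑ a, π s a * (Real.log (π s a) - Real.log (π' s a))

theorem klAt_nonneg {S : Type*} {π π' : S → A → ℝ} (hπ : IsPolicy π) (hπ' : IsPolicy π')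
    (hpos : ∀ s a, 0 < π' s a) (s : S) : 0 ≤ klAt π π' s :=
  sum_mul_log_sub_log_nonneg (hπ.1 s) (hπ.2 s) (hpos s) (hπ'.2 s)

theorem klAt_self {S : Type*} (π : S → A → ℝ) (s : S) : klAt π π s = 0 := by simp [klAt]

end RelativeEntropy

section Softmax

variable {A : Type*} [Fintype A]

/-- The softmax distribution on a finite set. -/
noncomputable def softmaxDist (x : A → ℝ) (a : A) : ℝ := Real.exp (x a) / ∑ a', Real.exp (x a')

/-- The soft maximum `τ log ∑ exp (x / τ)` at temperature `τ`. -/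
noncomputable def softMaximum (τ : ℝ) (x : A → ℝ) : ℝ := τ * Real.log (∑ a, Real.exp (x a / τ))

theorem softmaxPolicy_eq {S : Type*} (θ : S × A → ℝ) (s : S) :
    softmaxPolicy θ s = softmaxDist fun a => θ (s, a) := rfl

theorem softmaxDist_add_const (x : A → ℝ) (k : ℝ) :
    softmaxDist (fun a => x a + k) = softmaxDist x := by
  funext a
  unfold softmaxDist
  simp_rw [Real.exp_add]
  rw [← Finset.sum_mul, mul_div_mul_right _ _ (Real.exp_pos k).ne']

theorem softMaximum_zero (τ : ℝ) :
    softMaximum τ (fun _ : A => 0) = τ * Real.log (Fintype.card A) := by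
  simp [softMaximum]

variable [Nonempty A]

theorem sum_exp_pos (x : A → ℝ) : 0 < ∑ a, Real.exp (x a) :=
  Finset.sum_pos (fun _ _ => Real.exp_pos _) Finset.univ_nonempty

theorem softmaxDist_pos (x : A → ℝ) (a : A) : 0 < softmaxDist x a :=
  div_pos (Real.exp_pos _) (sum_exp_pos x)

theorem softmaxDist_sum (x : A → ℝ) : ∑ a, softmaxDist x a = 1 := by
  unfold softmaxDist
  rw [← Finset.sum_div, div_self (sum_exp_pos x).ne']

theorem isPolicy_softmaxPolicy {S : Type*} (θ : S × A → ℝ) : IsPolicy (softmaxPolicy θ) :=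
  ⟨fun s a => (softmaxDist_pos (fun a => θ (s, a)) a).le,
    fun s => softmaxDist_sum fun a => θ (s, a)⟩

theorem softmaxPolicy_pos {S : Type*} (θ : S × A → ℝ) (s : S) (a : A) :
    0 < softmaxPolicy θ s a := softmaxDist_pos (fun a => θ (s, a)) a

theorem log_softmaxDist (x : A → ℝ) (a : A) :
    Real.log (softmaxDist x a) = x a - Real.log (∑ a', Real.exp (x a')) := by
  rw [softmaxDist, Real.log_div (Real.exp_pos _).ne' (sum_exp_pos x).ne', Real.log_exp]

/-- The Gibbs variational identity: the entropy-regularized average of `x` under `p` falls short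
of the soft maximum by the relative entropy of `p` to the softmax distribution. -/
theorem sum_mul_sub_log_eq {τ : ℝ} (hτ : τ ≠ 0) {p : A → ℝ} (hp1 : ∑ a, p a = 1) (x : A → ℝ) :
    ∑ a, p a * (x a - τ * Real.log (p a)) = softMaximum τ x -
      τ * ∑ a, p a * (Real.log (p a) - Real.log (softmaxDist (fun a => x a / τ) a)) := by
  simp_rw [log_softmaxDist, softMaximum]
  set Z := Real.log (∑ a, Real.exp (x a / τ))
  have h : τ * Z = ∑ a, p a * (τ * Z) := by rw [← Finset.sum_mul, hp1, one_mul]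
  rw [h, Finset.mul_sum, ← Finset.sum_sub_distrib]
  refine Finset.sum_congr rfl fun a _ => ?_
  field_simp
  ring

theorem sum_mul_sub_log_le {τ : ℝ} (hτ : 0 < τ) {p : A → ℝ} (hp : ∀ a, 0 ≤ p a)
    (hp1 : ∑ a, p a = 1) (x : A → ℝ) :
    ∑ a, p a * (x a - τ * Real.log (p a)) ≤ softMaximum τ x := by
  rw [sum_mul_sub_log_eq hτ.ne' hp1]
  have := sum_mul_log_sub_log_nonneg hp hp1 (softmaxDist_pos fun a => x a / τ)
    (softmaxDist_sum _)
  nlinarith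

theorem sum_softmaxDist_mul_sub_log {τ : ℝ} (hτ : τ ≠ 0) (x : A → ℝ) :
    ∑ a, softmaxDist (fun a => x a / τ) a *
      (x a - τ * Real.log (softmaxDist (fun a => x a / τ) a)) = softMaximum τ x := by
  rw [sum_mul_sub_log_eq hτ (softmaxDist_sum _)]
  simp

theorem softMaximum_le_add {τ : ℝ} (hτ : 0 < τ) {x y : A → ℝ} {c : ℝ}
    (h : ∀ a, x a ≤ y a + c) : softMaximum τ x ≤ softMaximum τ y + c := by
  have h1 : Real.log (∑ a, Real.exp (x a / τ)) ≤
      Real.log (∑ a, Real.exp (y a / τ)) + c / τ := by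
    rw [← Real.log_exp (c / τ), ← Real.log_mul (sum_exp_pos _).ne' (Real.exp_pos _).ne',
      Finset.sum_mul]
    refine Real.log_le_log (sum_exp_pos _) (Finset.sum_le_sum fun a _ => ?_)
    rw [← Real.exp_add, ← add_div]
    exact Real.exp_le_exp.2 (by gcongr; exact h a)
  have h2 := mul_le_mul_of_nonneg_left h1 hτ.le
  rw [mul_add, mul_div_cancel₀ _ hτ.ne'] at h2
  exact h2

theorem abs_log_softmaxDist_sub_le {x y : A → ℝ} {c : ℝ} (h : ∀ a, |x a - y a| ≤ c) (a : A) :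
    |Real.log (softmaxDist x a) - Real.log (softmaxDist y a)| ≤ 2 * c := by
  rw [log_softmaxDist, log_softmaxDist]
  have h1 := softMaximum_le_add one_pos (x := x) (y := y) (c := c)
    fun a => by linarith [(abs_le.1 (h a)).2]
  have h2 := softMaximum_le_add one_pos (x := y) (y := x) (c := c)
    fun a => by linarith [(abs_le.1 (h a)).1]
  simp only [softMaximum, one_mul, div_one] at h1 h2
  have h3 := abs_le.1 (h a)
  rw [abs_le]
  constructor <;> linarith

/-- The covariance bound `|Cov_p(u, σ)| ≤ h` for `|u| ≤ h` and `|σ| ≤ 1`. -/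
theorem abs_sum_mul_sub_mean_le {p u σ : A → ℝ} (hp : ∀ a, 0 ≤ p a) (hp1 : ∑ a, p a = 1)
    {h : ℝ} (hu : ∀ a, |u a| ≤ h) (hσ : ∀ a, |σ a| ≤ 1) :
    |∑ a, σ a * (p a * (u a - ∑ b, p b * u b))| ≤ h := by
  set ub := ∑ b, p b * u b with hub
  have hh : 0 ≤ h := (abs_nonneg _).trans (hu (Classical.arbitrary A))
  have h1 : |∑ a, σ a * (p a * (u a - ub))| ≤ ∑ a, p a * |u a - ub| := by
    refine (Finset.abs_sum_le_sum_abs _ _).trans (Finset.sum_le_sum fun a _ => ?_)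
    rw [abs_mul, abs_mul, abs_of_nonneg (hp a)]
    exact mul_le_of_le_one_left (mul_nonneg (hp a) (abs_nonneg _)) (hσ a)
  refine h1.trans (abs_le_of_sq_le_sq' ?_ hh).2
  have h2 : (∑ a, p a * |u a - ub|) ^ 2 ≤ (∑ a, p a) * ∑ a, p a * |u a - ub| ^ 2 := by
    refine Finset.sum_sq_le_sum_mul_sum_of_sq_le_mul _ (fun a _ => hp a)
      (fun a _ => mul_nonneg (hp a) (sq_nonneg _)) fun a _ => le_of_eq (by ring)
  refine h2.trans ?_
  rw [hp1, one_mul]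
  have h3 : ∑ a, p a * |u a - ub| ^ 2 = ∑ a, p a * u a ^ 2 - ub ^ 2 := by
    have : ∀ a, p a * |u a - ub| ^ 2 = p a * u a ^ 2 - 2 * ub * (p a * u a) + ub ^ 2 * p a := by
      intro a
      rw [sq_abs]
      ring
    simp_rw [this, Finset.sum_add_distrib, Finset.sum_sub_distrib, ← Finset.mul_sum, ← hub, hp1]
    ring
  rw [h3]
  have h4 : ∑ a, p a * u a ^ 2 ≤ ∑ a, p a * h ^ 2 := Finset.sum_le_sum fun a _ =>
    mul_le_mul_of_nonneg_left (sq_le_sq' (abs_le.1 (hu a)).1 (abs_le.1 (hu a)).2) (hp a)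
  rw [← Finset.sum_mul, hp1, one_mul] at h4
  nlinarith [sq_nonneg ub]

theorem hasDerivAt_softmaxDist {w : A → ℝ → ℝ} {w' : A → ℝ} {t : ℝ}
    (hw : ∀ a, HasDerivAt (w a) (w' a) t) (a : A) :
    HasDerivAt (fun t => softmaxDist (fun a => w a t) a)
      (softmaxDist (fun a => w a t) a *
        (w' a - ∑ b, softmaxDist (fun a => w a t) b * w' b)) t := by
  have h1 : HasDerivAt (fun t => ∑ b, Real.exp (w b t)) (∑ b, Real.exp (w b t) * w' b) t :=
    HasDerivAt.fun_sum fun b _ => (hw b).exp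
  have h2 := ((hw a).exp).div h1 (sum_exp_pos fun b => w b t).ne'
  refine h2.congr_deriv ?_
  have hZ := (sum_exp_pos fun b => w b t).ne'
  have h3 : ∑ b, softmaxDist (fun a => w a t) b * w' b =
      (∑ b, Real.exp (w b t) * w' b) / ∑ b, Real.exp (w b t) := by
    rw [Finset.sum_div]
    exact Finset.sum_congr rfl fun b _ => by rw [softmaxDist]; ring
  rw [h3, softmaxDist]
  field_simp

/-- The softmax map is nonexpansive from half the oscillation seminorm to the `ℓ¹` norm. -/
theorem sum_abs_softmaxDist_sub_le {x y : A → ℝ} {k h : ℝ} (hxy : ∀ a, |x a - y a - k| ≤ h) :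
    ∑ a, |softmaxDist x a - softmaxDist y a| ≤ h := by
  -- the signs `σ` realize the `ℓ¹` norm; the claim is the mean value inequality along a segment
  set σ : A → ℝ := fun a => SignType.sign (softmaxDist x a - softmaxDist y a) with hσdef
  have hσ : ∀ a, |σ a| ≤ 1 := by
    intro a
    simp only [hσdef]
    rcases lt_trichotomy (softmaxDist x a - softmaxDist y a) 0 with h | h | h <;> simp [h]
  set u : A → ℝ := fun a => x a - y a - k with hu
  set φ : ℝ → ℝ := fun t => ∑ a, σ a * softmaxDist (fun a => y a + t * u a) a with hφ
  have hder : ∀ t, HasDerivAt φ (∑ a, σ a * (softmaxDist (fun a => y a + t * u a) a *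
      (u a - ∑ b, softmaxDist (fun a => y a + t * u a) b * u b))) t := by
    intro t
    refine HasDerivAt.fun_sum fun a _ => HasDerivAt.const_mul _ ?_
    exact hasDerivAt_softmaxDist (w := fun a t => y a + t * u a)
      (fun a => by simpa using ((hasDerivAt_id t).mul_const (u a)).const_add (y a)) a
  have hmv := norm_image_sub_le_of_norm_deriv_le_segment_01' (f := φ) (C := h)
    (fun t _ => (hder t).hasDerivWithinAt) (fun t _ => by
      rw [Real.norm_eq_abs]
      exact abs_sum_mul_sub_mean_le (fun a => (softmaxDist_pos _ a).le) (softmaxDist_sum _)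
        hxy hσ)
  have h0 : φ 0 = ∑ a, σ a * softmaxDist y a := by simp [hφ]
  have h1 : φ 1 = ∑ a, σ a * softmaxDist x a := by
    simp only [hφ, hu, one_mul]
    refine Finset.sum_congr rfl fun a _ => ?_
    rw [← softmaxDist_add_const x (-k)]
    congr 2
    funext b
    ring
  rw [h0, h1, ← Finset.sum_sub_distrib] at hmv
  refine le_trans (le_of_eq ?_) ((le_abs_self _).trans hmv)
  refine Finset.sum_congr rfl fun a _ => ?_
  rw [← mul_sub]
  simp only [hσdef]
  exact (sign_mul_self _).symm

end Softmax

/-! ### The entropy-regularized control problem -/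

namespace ConstrainedMDP

variable {S A : Type*} [Fintype S] [Fintype A] {m : ℕ}

section Rewards

theorem nonempty_states (M : ConstrainedMDP S A m) : Nonempty S := by
  by_contra h
  rw [not_nonempty_iff] at h
  have := M.ρ_sum
  simp at this

theorem r_le_rmax (M : ConstrainedMDP S A m) (i : Fin (m + 1)) (s : S) (a : A) :
    M.r i s a ≤ M.rmax i :=
  le_ciSup (f := fun x : S × A => M.r i x.1 x.2) (Set.finite_range _).bddAbove (s, a)

theorem rmax_pos [Nonempty A] (M : ConstrainedMDP S A m) (i : Fin (m + 1)) : 0 < M.rmax i :=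
  (M.r_pos i (Classical.choice M.nonempty_states) (Classical.arbitrary A)).trans_le
    (M.r_le_rmax i _ _)

theorem Rmax_nonneg (M : ConstrainedMDP S A m) : 0 ≤ M.Rmax := Real.sqrt_nonneg _

theorem Rmax_sq (M : ConstrainedMDP S A m) : M.Rmax ^ 2 = ∑ i : Fin m, M.rmax i.succ ^ 2 :=
  Real.sq_sqrt (Finset.sum_nonneg fun _ _ => sq_nonneg _)

theorem rmax_le_Rmax (M : ConstrainedMDP S A m) (i : Fin m) : M.rmax i.succ ≤ M.Rmax := by
  refine (abs_le_of_sq_le_sq' ?_ M.Rmax_nonneg).2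
  rw [Rmax_sq]
  exact Finset.single_le_sum (f := fun i : Fin m => M.rmax i.succ ^ 2)
    (fun i _ => sq_nonneg _) (Finset.mem_univ i)

theorem sum_rmax_le (M : ConstrainedMDP S A m) : ∑ i : Fin m, M.rmax i.succ ≤ m * M.Rmax := by
  refine (Finset.sum_le_sum fun i _ => M.rmax_le_Rmax i).trans (le_of_eq ?_)
  simp

theorem rLam_nonneg (M : ConstrainedMDP S A m) {l : Fin m → ℝ} (hl : ∀ i, 0 ≤ l i)
    (s : S) (a : A) : 0 ≤ M.rLam l s a :=
  add_nonneg (M.r_pos _ _ _).le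
    (Finset.sum_nonneg fun i _ => mul_nonneg (hl i) (M.r_pos _ _ _).le)

theorem rLam_le (M : ConstrainedMDP S A m) {B : ℝ} {l : Fin m → ℝ} (hl : l ∈ dualBox m B)
    (s : S) (a : A) : M.rLam l s a ≤ M.rmax 0 + 2 * B * (m * M.Rmax) := by
  refine add_le_add (M.r_le_rmax _ _ _) ?_
  rcases Nat.eq_zero_or_pos m with rfl | hm
  · simp
  have hB : 0 ≤ 2 * B := (hl ⟨0, hm⟩).1.trans (hl ⟨0, hm⟩).2
  calc ∑ i : Fin m, l i * M.r i.succ s a ≤ ∑ i : Fin m, 2 * B * M.rmax i.succ :=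
        Finset.sum_le_sum fun i _ =>
          mul_le_mul (hl i).2 (M.r_le_rmax _ _ _) (M.r_pos _ _ _).le hB
    _ = 2 * B * ∑ i : Fin m, M.rmax i.succ := by rw [Finset.mul_sum]
    _ ≤ _ := mul_le_mul_of_nonneg_left M.sum_rmax_le hB

/-- Positivity of the rewards centres the variation of `r_λ`: it oscillates by at most half of
`∑ |λ_i - λ'_i| r_{i,max}` around its mid-range. -/
theorem abs_rLam_sub_le (M : ConstrainedMDP S A m) (l l' : Fin m → ℝ) (s : S) (a : A) :
    |M.rLam l s a - M.rLam l' s a - (∑ i : Fin m, (l i - l' i) * M.rmax i.succ) / 2| ≤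
      (∑ i : Fin m, |l i - l' i| * M.rmax i.succ) / 2 := by
  have h : M.rLam l s a - M.rLam l' s a - (∑ i : Fin m, (l i - l' i) * M.rmax i.succ) / 2 =
      ∑ i : Fin m, (l i - l' i) * (M.r i.succ s a - M.rmax i.succ / 2) := by
    simp only [rLam]
    rw [add_sub_add_left_eq_sub, ← Finset.sum_sub_distrib, Finset.sum_div,
      ← Finset.sum_sub_distrib]
    exact Finset.sum_congr rfl fun i _ => by ring
  rw [h, Finset.sum_div]
  refine (Finset.abs_sum_le_sum_abs _ _).trans (Finset.sum_le_sum fun i _ => ?_)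
  rw [abs_mul, mul_div_assoc]
  refine mul_le_mul_of_nonneg_left ?_ (abs_nonneg _)
  have := M.r_le_rmax i.succ s a
  have := M.r_pos i.succ s a
  rw [abs_le]
  constructor <;> linarith

theorem radius_pos [Nonempty A] (M : ConstrainedMDP S A m) {ξ : ℝ} (hξ : 0 < ξ) : 0 < M.radius ξ :=
  div_pos (M.rmax_pos 0) (mul_pos (sub_pos.2 M.γ_lt_one) hξ)

end Rewards

section SoftBellman

theorem sum_P_mul_le (M : ConstrainedMDP S A m) (s : S) (a : A) {f g : S → ℝ} {c : ℝ}
    (h : ∀ s', 0 < M.P s a s' → f s' ≤ g s' + c) :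
    ∑ s', M.P s a s' * f s' ≤ ∑ s', M.P s a s' * g s' + c := by
  have h1 : c = ∑ s', M.P s a s' * c := by rw [← Finset.sum_mul, M.P_sum, one_mul]
  rw [h1, ← Finset.sum_add_distrib]
  refine Finset.sum_le_sum fun s' _ => ?_
  rw [← mul_add]
  rcases (M.P_nonneg s a s').eq_or_lt with h0 | h0
  · simp [← h0]
  · exact mul_le_mul_of_nonneg_left (h s' h0) h0.le

theorem softBellman_eq (M : ConstrainedMDP S A m) (τ : ℝ) (l : Fin m → ℝ) (Q : S × A → ℝ)
    (s : S) (a : A) : M.softBellman τ l Q (s, a) = M.rLam l s a +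
      M.γ * ∑ s', M.P s a s' * softMaximum τ fun a' => Q (s', a') := rfl

variable [Nonempty A]

theorem softBellman_le_add (M : ConstrainedMDP S A m) {τ : ℝ} (hτ : 0 < τ) {l l' : Fin m → ℝ}
    {b c : ℝ} {Q Q' : S × A → ℝ} (hr : ∀ s a, M.rLam l s a ≤ M.rLam l' s a + b)
    (hQ : ∀ x, Q x ≤ Q' x + c) (x : S × A) :
    M.softBellman τ l Q x ≤ M.softBellman τ l' Q' x + (b + M.γ * c) := by
  obtain ⟨s, a⟩ := x
  rw [softBellman_eq, softBellman_eq]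
  have h := M.sum_P_mul_le s a (f := fun s' => softMaximum τ fun a' => Q (s', a'))
    (g := fun s' => softMaximum τ fun a' => Q' (s', a')) (c := c)
    fun s' _ => softMaximum_le_add hτ fun a' => hQ _
  have := mul_le_mul_of_nonneg_left h M.γ_pos.le
  have := hr s a
  linarith

theorem exists_softBellman_eq_self (M : ConstrainedMDP S A m) {τ : ℝ} (hτ : 0 < τ)
    (l : Fin m → ℝ) : ∃ Q : S × A → ℝ, M.softBellman τ l Q = Q := by
  have hc : ContractingWith ⟨M.γ, M.γ_pos.le⟩ (M.softBellman τ l) := by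
    refine ⟨M.γ_lt_one, LipschitzWith.of_dist_le_mul fun Q Q' => ?_⟩
    have h : ∀ Q Q' : S × A → ℝ, ∀ x, Q x ≤ Q' x + dist Q Q' := fun Q Q' x => by
      have := (Real.dist_eq _ _ ▸ dist_le_pi_dist Q Q' x)
      linarith [le_abs_self (Q x - Q' x)]
    refine (dist_pi_le_iff (mul_nonneg M.γ_pos.le dist_nonneg)).2 fun x => ?_
    have h1 := M.softBellman_le_add hτ (l := l) (l' := l) (b := 0) (by simp) (h Q Q') x
    have h2 := M.softBellman_le_add hτ (l := l) (l' := l) (b := 0) (by simp) (h Q' Q) x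
    rw [dist_comm Q' Q] at h2
    rw [Real.dist_eq, abs_le]
    change -(M.γ * _) ≤ _ ∧ _ ≤ M.γ * _
    constructor <;> linarith
  exact ⟨_, hc.fixedPoint_isFixedPt⟩

/-- Comparison of the fixed points of two soft Bellman operators. -/
theorem softBellman_fixed_le_add (M : ConstrainedMDP S A m) {τ : ℝ} (hτ : 0 < τ)
    {l l' : Fin m → ℝ} {b : ℝ} {Q Q' : S × A → ℝ} (hr : ∀ s a, M.rLam l s a ≤ M.rLam l' s a + b)
    (hQ : M.softBellman τ l Q = Q) (hQ' : M.softBellman τ l' Q' = Q') (x : S × A) :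
    Q x ≤ Q' x + b / (1 - M.γ) := by
  have : Nonempty (S × A) := ⟨x⟩
  obtain ⟨y, hy⟩ := Finite.exists_max fun x => Q x - Q' x
  have h := M.softBellman_le_add hτ hr (Q := Q) (Q' := Q') (c := Q y - Q' y)
    (fun x => by linarith [hy x]) y
  rw [hQ, hQ'] at h
  have hg : 0 < 1 - M.γ := sub_pos.2 M.γ_lt_one
  have h2 : Q y - Q' y ≤ b / (1 - M.γ) := by
    rw [le_div_iff₀ hg]
    linarith
  linarith [hy x]

theorem log_card_nonneg : 0 ≤ Real.log (Fintype.card A) :=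
  Real.log_nonneg (by exact_mod_cast Fintype.card_pos)

theorem softBellman_fixed_nonneg (M : ConstrainedMDP S A m) {τ : ℝ} (hτ : 0 < τ)
    {l : Fin m → ℝ} {Q : S × A → ℝ} (hl : ∀ i, 0 ≤ l i) (hQ : M.softBellman τ l Q = Q)
    (x : S × A) : 0 ≤ Q x := by
  have : Nonempty (S × A) := ⟨x⟩
  obtain ⟨y, hy⟩ := Finite.exists_min Q
  have h1 : ∀ s', 0 ≤ (softMaximum τ fun a' => Q (s', a')) + -Q y := by
    intro s'
    have h := softMaximum_le_add hτ (x := fun _ : A => 0) (y := fun a' => Q (s', a'))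
      (c := -Q y) fun a => by linarith [hy (s', a)]
    rw [softMaximum_zero] at h
    exact (mul_nonneg hτ.le log_card_nonneg).trans h
  have h2 := M.sum_P_mul_le y.1 y.2 (f := fun _ => 0)
    (g := fun s' => softMaximum τ fun a' => Q (s', a')) fun s' _ => h1 s'
  have h3 := congrFun hQ y
  rw [← Prod.mk.eta (p := y), softBellman_eq, Prod.mk.eta] at h3
  simp only [mul_zero, Finset.sum_const_zero] at h2
  have h4 := mul_le_mul_of_nonneg_left h2 M.γ_pos.le
  have h5 := M.rLam_nonneg hl y.1 y.2
  have hg : 0 < 1 - M.γ := sub_pos.2 M.γ_lt_one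
  have : 0 ≤ Q y := by
    by_contra hneg
    nlinarith
  exact this.trans (hy x)

theorem softBellman_fixed_le (M : ConstrainedMDP S A m) {τ : ℝ} (hτ : 0 < τ)
    {l : Fin m → ℝ} {Q : S × A → ℝ} {b : ℝ} (hb : ∀ s a, M.rLam l s a ≤ b)
    (hQ : M.softBellman τ l Q = Q) (x : S × A) :
    Q x + τ * Real.log (Fintype.card A) ≤ (b + τ * Real.log (Fintype.card A)) / (1 - M.γ) := by
  have : Nonempty (S × A) := ⟨x⟩
  obtain ⟨y, hy⟩ := Finite.exists_max Q
  have h1 : ∀ s', (softMaximum τ fun a' => Q (s', a')) ≤ 0 +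
      (τ * Real.log (Fintype.card A) + Q y) := by
    intro s'
    have h := softMaximum_le_add hτ (x := fun a' => Q (s', a')) (y := fun _ : A => 0)
      (c := Q y) fun a => by linarith [hy (s', a)]
    rw [softMaximum_zero] at h
    linarith
  have h2 := M.sum_P_mul_le y.1 y.2 (f := fun s' => softMaximum τ fun a' => Q (s', a'))
    (g := fun _ => 0) fun s' _ => h1 s'
  have h3 := congrFun hQ y
  rw [← Prod.mk.eta (p := y), softBellman_eq, Prod.mk.eta] at h3
  simp only [mul_zero, Finset.sum_const_zero] at h2
  have h4 := mul_le_mul_of_nonneg_left h2 M.γ_pos.le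
  have hg : 0 < 1 - M.γ := sub_pos.2 M.γ_lt_one
  rw [le_div_iff₀ hg]
  have := hb y.1 y.2
  have := mul_le_mul_of_nonneg_right (hy x) hg.le
  nlinarith

theorem softMaximum_fixed_nonneg (M : ConstrainedMDP S A m) {τ : ℝ} (hτ : 0 < τ)
    {l : Fin m → ℝ} {Q : S × A → ℝ} (hl : ∀ i, 0 ≤ l i) (hQ : M.softBellman τ l Q = Q) (s : S) :
    0 ≤ softMaximum τ fun a => Q (s, a) := by
  have h := softMaximum_le_add hτ (x := fun _ : A => 0) (y := fun a' => Q (s, a'))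
    (c := 0) fun a => by simpa using M.softBellman_fixed_nonneg hτ hl hQ (s, a)
  rw [softMaximum_zero, add_zero] at h
  exact (mul_nonneg hτ.le log_card_nonneg).trans h

theorem softMaximum_fixed_le (M : ConstrainedMDP S A m) {τ : ℝ} (hτ : 0 < τ)
    {l : Fin m → ℝ} {Q : S × A → ℝ} {b : ℝ} (hb : ∀ s a, M.rLam l s a ≤ b)
    (hQ : M.softBellman τ l Q = Q) (s : S) :
    (softMaximum τ fun a => Q (s, a)) ≤
      (b + τ * Real.log (Fintype.card A)) / (1 - M.γ) := by
  have h := softMaximum_le_add hτ (x := fun a' => Q (s, a')) (y := fun _ : A => 0)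
    (c := (b + τ * Real.log (Fintype.card A)) / (1 - M.γ) - τ * Real.log (Fintype.card A))
    fun a => by linarith [M.softBellman_fixed_le hτ hb hQ (s, a)]
  rw [softMaximum_zero] at h
  linarith

/-- The softmax policies of two multipliers differ in `ℓ¹` norm by at most half of the natural
Lipschitz bound. -/
theorem sum_abs_softmaxPolicy_sub_le (M : ConstrainedMDP S A m) {τ : ℝ} (hτ : 0 < τ)
    {l l' : Fin m → ℝ} {Q Q' : S × A → ℝ} (hQ : M.softBellman τ l Q = Q)
    (hQ' : M.softBellman τ l' Q' = Q') (s : S) :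
    ∑ a, |softmaxPolicy (fun x => Q x / τ) s a - softmaxPolicy (fun x => Q' x / τ) s a| ≤
      (∑ i : Fin m, |l i - l' i| * M.rmax i.succ) / 2 / (1 - M.γ) / τ := by
  set k := (∑ i : Fin m, (l i - l' i) * M.rmax i.succ) / 2
  set w := (∑ i : Fin m, |l i - l' i| * M.rmax i.succ) / 2
  refine sum_abs_softmaxDist_sub_le (k := k / (1 - M.γ) / τ) fun a => ?_
  have hr : ∀ s a, -w ≤ M.rLam l s a - M.rLam l' s a - k ∧ M.rLam l s a - M.rLam l' s a - k ≤ w :=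
    fun s a => abs_le.1 (M.abs_rLam_sub_le l l' s a)
  have h1 := M.softBellman_fixed_le_add hτ (b := k + w)
    (fun s a => by linarith [(hr s a).2]) hQ hQ' (s, a)
  have h2 := M.softBellman_fixed_le_add hτ (b := w - k)
    (fun s a => by linarith [(hr s a).1]) hQ' hQ (s, a)
  rw [← sub_div, ← sub_div, abs_div, abs_of_pos hτ]
  gcongr
  rw [add_div] at h1
  rw [sub_div] at h2
  rw [abs_le]
  constructor <;> linarith

theorem softQ_convergence (M : ConstrainedMDP S A m) {τ : ℝ} (hτ : 0 < τ)
    {l : Fin m → ℝ} {Q : S × A → ℝ} (hQ : M.softBellman τ l Q = Q)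
    {c : ℝ} (hc : ∀ x, |Q x| ≤ c) (n : ℕ) (x : S × A) :
    |(Counted.loop (fun Q => ⟨M.softBellman τ l Q, 1⟩) n 0).val x - Q x| ≤ M.γ ^ n * c := by
  induction n generalizing x with
  | zero => simpa [Counted.loop] using hc x
  | succ n ih =>
    rw [Counted.loop]
    set Q' := (Counted.loop (fun Q => ⟨M.softBellman τ l Q, 1⟩) n (0 : S × A → ℝ)).val
    have h1 := M.softBellman_le_add hτ (l := l) (l' := l) (b := 0) (by simp) (Q := Q') (Q' := Q)
      (c := M.γ ^ n * c) (fun x => by linarith [(abs_le.1 (ih x)).2]) x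
    have h2 := M.softBellman_le_add hτ (l := l) (l' := l) (b := 0) (by simp) (Q := Q) (Q' := Q')
      (c := M.γ ^ n * c) (fun x => by linarith [(abs_le.1 (ih x)).1]) x
    rw [hQ] at h1 h2
    rw [pow_succ', abs_le]
    constructor <;> linarith

end SoftBellman

section SoftValue

/-- The reward `r_λ - τ log π` whose value is the entropy-regularized value of `π`. -/
noncomputable def softReward (M : ConstrainedMDP S A m) (τ : ℝ) (l : Fin m → ℝ)
    (π : S → A → ℝ) (s : S) (a : A) : ℝ :=
  M.rLam l s a - τ * Real.log (π s a)

/-- The suboptimality of `π` for the regularized problem is the occupancy average of its relative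
entropy to the softmax policy of the fixed point `Q` of the soft Bellman operator. -/
theorem sum_softReward_eq [Nonempty A] (M : ConstrainedMDP S A m) {τ : ℝ} (hτ : τ ≠ 0)
    {l : Fin m → ℝ} {Q : S × A → ℝ} (hQ : M.softBellman τ l Q = Q) {π : S → A → ℝ}
    (hπ : IsPolicy π) {d : S → ℝ} (hd : ∀ s, 0 ≤ d s) :
    ∑ s, ∑ a, M.occ π d s * π s a * M.softReward τ l π s a =
      ∑ s, d s * (softMaximum τ fun a => Q (s, a)) -
        τ * ∑ s, M.occ π d s * klAt π (softmaxPolicy fun x => Q x / τ) s := by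
  rw [M.sum_occ_eq hπ hd _ fun s => softMaximum τ fun a => Q (s, a), Finset.mul_sum,
    sub_eq_add_neg, ← Finset.sum_neg_distrib]
  congr 1
  refine Finset.sum_congr rfl fun s _ => ?_
  have h : ∀ a, M.softReward τ l π s a +
      M.γ * ∑ s', M.P s a s' * (softMaximum τ fun a => Q (s', a)) =
      Q (s, a) - τ * Real.log (π s a) := by
    intro a
    have := congrFun hQ (s, a)
    rw [softBellman_eq] at this
    rw [softReward]
    linarith
  simp_rw [h]
  rw [sum_mul_sub_log_eq hτ (hπ.2 s), klAt]
  simp_rw [softmaxPolicy_eq]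
  ring

variable [DecidableEq S]

theorem regValue_eq (M : ConstrainedMDP S A m) (τ : ℝ) (l : Fin m → ℝ) {π : S → A → ℝ}
    (hπ : IsPolicy π) : M.regValue τ l π = M.value (M.softReward τ l π) π := by
  rw [regValue, entropy, M.value_eq hπ, M.value_eq hπ, M.value_eq hπ, mul_neg, ← sub_eq_add_neg,
    Finset.mul_sum, ← Finset.sum_sub_distrib]
  refine Finset.sum_congr rfl fun s _ => ?_
  rw [Finset.mul_sum, ← Finset.sum_sub_distrib]
  exact Finset.sum_congr rfl fun a _ => by rw [softReward]; ring

theorem value_rLam (M : ConstrainedMDP S A m) (l : Fin m → ℝ) {π : S → A → ℝ}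
    (hπ : IsPolicy π) : M.value (M.rLam l) π = M.V0 π + ∑ i, l i * M.V π i := by
  simp only [V0, V, M.value_eq hπ]
  simp_rw [rLam, mul_add, Finset.sum_add_distrib, Finset.mul_sum]
  congr 1
  rw [Finset.sum_congr rfl fun s _ => Finset.sum_comm, Finset.sum_comm]
  exact Finset.sum_congr rfl fun i _ => Finset.sum_congr rfl fun s _ =>
    Finset.sum_congr rfl fun a _ => by ring

theorem regLagrangian_eq (M : ConstrainedMDP S A m) (τ μ : ℝ) (l : Fin m → ℝ) {π : S → A → ℝ}
    (hπ : IsPolicy π) : M.regLagrangian τ μ π l =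
      M.regValue τ l π - ∑ i, l i * M.c i + μ / 2 * ∑ i, l i ^ 2 := by
  rw [regLagrangian, regValue, M.value_rLam l hπ]
  simp_rw [mul_sub, Finset.sum_sub_distrib]
  ring

variable [Nonempty A]

theorem regValue_eq_sub_kl (M : ConstrainedMDP S A m) {τ : ℝ} (hτ : τ ≠ 0) {l : Fin m → ℝ}
    {Q : S × A → ℝ} (hQ : M.softBellman τ l Q = Q) {π : S → A → ℝ} (hπ : IsPolicy π) :
    M.regValue τ l π = ∑ s, M.ρ s * (softMaximum τ fun a => Q (s, a)) -
      τ * ∑ s, M.occ π M.ρ s * klAt π (softmaxPolicy fun x => Q x / τ) s := by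
  rw [M.regValue_eq τ l hπ, M.value_eq hπ, M.sum_softReward_eq hτ hQ hπ M.ρ_nonneg]

theorem regValue_softmax (M : ConstrainedMDP S A m) {τ : ℝ} (hτ : τ ≠ 0) {l : Fin m → ℝ}
    {Q : S × A → ℝ} (hQ : M.softBellman τ l Q = Q) :
    M.regValue τ l (softmaxPolicy fun x => Q x / τ) =
      ∑ s, M.ρ s * (softMaximum τ fun a => Q (s, a)) := by
  rw [M.regValue_eq_sub_kl hτ hQ (isPolicy_softmaxPolicy _)]
  simp [klAt_self]

theorem regValue_le_softmax (M : ConstrainedMDP S A m) {τ : ℝ} (hτ : 0 < τ) {l : Fin m → ℝ}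
    {Q : S × A → ℝ} (hQ : M.softBellman τ l Q = Q) {π : S → A → ℝ} (hπ : IsPolicy π) :
    M.regValue τ l π ≤ M.regValue τ l (softmaxPolicy fun x => Q x / τ) := by
  rw [M.regValue_softmax hτ.ne' hQ, M.regValue_eq_sub_kl hτ.ne' hQ hπ]
  have : 0 ≤ ∑ s, M.occ π M.ρ s * klAt π (softmaxPolicy fun x => Q x / τ) s :=
    Finset.sum_nonneg fun s _ => mul_nonneg (M.occ_nonneg hπ M.ρ_nonneg s)
      (klAt_nonneg hπ (isPolicy_softmaxPolicy _) (fun s a => softmaxPolicy_pos _ _ _) s)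
  nlinarith

/-- A maximizer of the regularized value is the softmax policy at every state it visits. -/
theorem eq_softmax_of_regValue_eq (M : ConstrainedMDP S A m) {τ : ℝ} (hτ : 0 < τ)
    {l : Fin m → ℝ} {Q : S × A → ℝ} (hQ : M.softBellman τ l Q = Q) {π : S → A → ℝ}
    (hπ : IsPolicy π)
    (h : M.regValue τ l (softmaxPolicy fun x => Q x / τ) ≤ M.regValue τ l π)
    {s : S} (hs : 0 < M.occ π M.ρ s) : π s = softmaxPolicy (fun x => Q x / τ) s := by
  rw [M.regValue_softmax hτ.ne' hQ, M.regValue_eq_sub_kl hτ.ne' hQ hπ] at h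
  have hn : ∀ s, 0 ≤ M.occ π M.ρ s * klAt π (softmaxPolicy fun x => Q x / τ) s := fun s =>
    mul_nonneg (M.occ_nonneg hπ M.ρ_nonneg s)
      (klAt_nonneg hπ (isPolicy_softmaxPolicy _) (fun s a => softmaxPolicy_pos _ _ _) s)
  have h1 : ∑ s, M.occ π M.ρ s * klAt π (softmaxPolicy fun x => Q x / τ) s = 0 :=
    le_antisymm (by nlinarith) (Finset.sum_nonneg fun s _ => hn s)
  have h2 := (Finset.sum_eq_zero_iff_of_nonneg fun s _ => hn s).1 h1 s (Finset.mem_univ s)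
  have h3 : klAt π (softmaxPolicy fun x => Q x / τ) s = 0 :=
    (mul_eq_zero.1 h2).resolve_left hs.ne'
  exact eq_of_sum_mul_log_sub_log_eq_zero (hπ.1 s) (hπ.2 s) (fun a => softmaxPolicy_pos _ _ _)
    ((isPolicy_softmaxPolicy fun x => Q x / τ).2 s) h3

end SoftValue

end ConstrainedMDP

/-! ### Reachable states -/

namespace ConstrainedMDP

variable {S A : Type*} [Fintype S] [Fintype A] {m : ℕ}

/-- The states that can be reached from the initial distribution. Every policy with full support
visits exactly these states; only on them are maximizers of the regularized Lagrangian unique and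
natural gradient steps effective. -/
inductive Reach (M : ConstrainedMDP S A m) : S → Prop
  | init {s : S} : 0 < M.ρ s → Reach M s
  | step {s : S} {a : A} {s' : S} : Reach M s → 0 < M.P s a s' → Reach M s'

theorem stateDist_eq_zero_of_not_reach (M : ConstrainedMDP S A m) (π : S → A → ℝ) {d : S → ℝ}
    (hd : ∀ s, ¬ M.Reach s → d s = 0) (t : ℕ) {s : S} (hs : ¬ M.Reach s) :
    M.stateDist π d t s = 0 := by
  induction t generalizing s with
  | zero => exact hd s hs
  | succ t ih =>
    refine Finset.sum_eq_zero fun s' _ => Finset.sum_eq_zero fun a _ => ?_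
    by_cases hr : M.Reach s'
    · have : M.P s' a s = 0 :=
        ((M.P_nonneg s' a s).eq_or_lt.resolve_right fun h => hs (hr.step h)).symm
      rw [this, mul_zero]
    · rw [ih hr, zero_mul, zero_mul]

theorem occ_eq_zero_of_not_reach (M : ConstrainedMDP S A m) (π : S → A → ℝ) {d : S → ℝ}
    (hd : ∀ s, ¬ M.Reach s → d s = 0) {s : S} (hs : ¬ M.Reach s) : M.occ π d s = 0 := by
  simp [occ, M.stateDist_eq_zero_of_not_reach π hd _ hs]

theorem ρ_eq_zero_of_not_reach (M : ConstrainedMDP S A m) (s : S) (hs : ¬ M.Reach s) :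
    M.ρ s = 0 :=
  ((M.ρ_nonneg s).eq_or_lt.resolve_right fun h => hs (.init h)).symm

theorem reach_of_occ_pos (M : ConstrainedMDP S A m) {π : S → A → ℝ} {s : S}
    (h : 0 < M.occ π M.ρ s) : M.Reach s := by
  by_contra hs
  exact h.ne' (M.occ_eq_zero_of_not_reach π M.ρ_eq_zero_of_not_reach hs)

theorem occ_pos_of_reach (M : ConstrainedMDP S A m) {π : S → A → ℝ} (hπ : IsPolicy π)
    (hfull : ∀ s, 0 < M.occ π M.ρ s → ∀ a, 0 < π s a) {s : S} (hs : M.Reach s) :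
    0 < M.occ π M.ρ s := by
  induction hs with
  | init h => exact h.trans_le (M.le_occ hπ M.ρ_nonneg _)
  | @step s a s' _ hP ih =>
    rw [M.occ_flow hπ M.ρ_nonneg]
    refine add_pos_of_nonneg_of_pos (M.ρ_nonneg _) (mul_pos M.γ_pos ?_)
    have hn : ∀ s a, 0 ≤ M.occ π M.ρ s * π s a * M.P s a s' := fun s a =>
      mul_nonneg (mul_nonneg (M.occ_nonneg hπ M.ρ_nonneg s) (hπ.1 s a)) (M.P_nonneg _ _ _)
    refine (mul_pos (mul_pos ih (hfull s ih a)) hP).trans_le ?_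
    refine (Finset.single_le_sum (fun a _ => hn s a) (Finset.mem_univ a)).trans ?_
    exact Finset.single_le_sum (f := fun s => ∑ a, M.occ π M.ρ s * π s a * M.P s a s')
      (fun s _ => Finset.sum_nonneg fun a _ => hn s a) (Finset.mem_univ s)

end ConstrainedMDP

/-! ### Ergodicity and smoothness of the dual function -/

/-- The mixing series is controlled by `L_ν`. The factor `4` makes up for the logarithm in `L_ν`,
which is negative for `C < 1`: `C ≥ 1/2` and `log 2 < 3/4` keep `L_ν` of order `1 / (1 - β)`. -/
theorem tsum_min_le {C β : ℝ} (hC : 1 / 2 ≤ C) (hβ₀ : 0 < β) (hβ₁ : β < 1) :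
    (Summable fun t : ℕ => min 1 (2 * C * β ^ t)) ∧
      ∑' t : ℕ, min 1 (2 * C * β ^ t) ≤ 4 * ConstrainedMDP.Lnu C β - 1 := by
  have hC0 : 0 < C := by linarith
  have hgeo := summable_geometric_of_lt_one hβ₀.le hβ₁
  have hsum : Summable fun t : ℕ => min 1 (2 * C * β ^ t) :=
    Summable.of_nonneg_of_le (fun t => le_min zero_le_one (by positivity))
      (fun t => min_le_right _ _) (hgeo.mul_left _)
  refine ⟨hsum, ?_⟩
  set x := Real.logb β (2 * C)⁻¹ with hx
  have hx0 : 0 ≤ x := Real.logb_nonneg_of_base_lt_one hβ₀ hβ₁ (by positivity)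
    (inv_le_one_of_one_le₀ (by linarith))
  set n := ⌈x⌉₊ with hn
  have hn1 : (n : ℝ) < x + 1 := Nat.ceil_lt_add_one hx0
  have hpow : 2 * C * β ^ n ≤ 1 := by
    have h1 : β ^ (n : ℝ) ≤ β ^ x :=
      Real.rpow_le_rpow_of_exponent_ge hβ₀ hβ₁.le (Nat.le_ceil x)
    rw [hx, Real.rpow_logb hβ₀ hβ₁.ne (by positivity), Real.rpow_natCast] at h1
    calc 2 * C * β ^ n ≤ 2 * C * (2 * C)⁻¹ := by gcongr
      _ = 1 := mul_inv_cancel₀ (by positivity)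
  have h2 : ∑' t : ℕ, min 1 (2 * C * β ^ t) ≤ n + (1 - β)⁻¹ := by
    rw [← hsum.sum_add_tsum_nat_add n]
    refine add_le_add ?_ ?_
    · refine (Finset.sum_le_sum fun t _ => min_le_left 1 (2 * C * β ^ t)).trans ?_
      simp
    · rw [← tsum_geometric_of_lt_one hβ₀.le hβ₁]
      refine ((summable_nat_add_iff n).2 hsum).tsum_le_tsum (fun t => ?_) hgeo
      refine (min_le_right _ _).trans ?_
      rw [pow_add, mul_comm (β ^ t), ← mul_assoc]
      exact mul_le_of_le_one_left (pow_nonneg hβ₀.le t) hpow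
  have h3 : Real.logb β C⁻¹ = x + Real.log 2 / Real.log β := by
    rw [hx, ← Real.logb, ← Real.logb_mul (by positivity) two_ne_zero]
    congr 1
    field_simp
  have h4 : -(3 / 4) * (1 - β)⁻¹ ≤ Real.log 2 / Real.log β := by
    have hlog : Real.log β ≤ -(1 - β) := by linarith [Real.log_le_sub_one_of_pos hβ₀]
    have h1b : 0 < 1 - β := by linarith
    have hlog2 : Real.log 2 < 3 / 4 := Real.log_two_lt_d9.trans (by norm_num)
    rw [← neg_le_neg_iff, ← div_neg, neg_mul, neg_neg, ← div_eq_mul_inv]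
    exact div_le_div₀ (by norm_num) hlog2.le h1b (by linarith)
  have h5 := Int.le_ceil (Real.logb β C⁻¹)
  have h6 : 1 ≤ (1 - β)⁻¹ := (one_le_inv₀ (by linarith)).2 (by linarith)
  rw [ConstrainedMDP.Lnu]
  linarith

theorem Lnu_pos {C β : ℝ} (hC : 1 / 2 ≤ C) (hβ₀ : 0 < β) (hβ₁ : β < 1) :
    0 < ConstrainedMDP.Lnu C β := by
  have h := (tsum_min_le hC hβ₀ hβ₁).2
  have : 0 ≤ ∑' t : ℕ, min 1 (2 * C * β ^ t) :=
    tsum_nonneg fun t => le_min zero_le_one (by positivity)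
  linarith

namespace ConstrainedMDP

variable {S A : Type*} [Fintype S] [DecidableEq S] [Fintype A] {m : ℕ}

/-- Under uniform ergodicity the value function of a nonnegative reward oscillates by at most the
mixing series, uniformly in the discount factor. -/
theorem valueAt_sub_le (M : ConstrainedMDP S A m) {C β : ℝ} (hC : 1 / 2 ≤ C) (hβ₀ : 0 < β)
    (hβ₁ : β < 1) {π : S → A → ℝ} (hπ : IsPolicy π) (herg : M.IsUniformlyErgodic C β π)
    {f : S → A → ℝ} {b : ℝ} (hf0 : ∀ s a, 0 ≤ f s a) (hfb : ∀ s a, f s a ≤ b) (s₁ s₂ : S) :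
    M.valueAt f π s₁ - M.valueAt f π s₂ ≤ b * (4 * Lnu C β - 1) := by
  obtain ⟨χ, -, -, -, hχ⟩ := herg
  obtain ⟨hsum, hle⟩ := tsum_min_le hC hβ₀ hβ₁
  set h : S → ℝ := fun s => ∑ a, π s a * f s a with hh
  have hh0 : ∀ s, 0 ≤ h s := fun s => Finset.sum_nonneg fun a _ => mul_nonneg (hπ.1 s a) (hf0 s a)
  have hhb : ∀ s, h s ≤ b := fun s =>
    (Finset.sum_le_sum fun a _ => mul_le_mul_of_nonneg_left (hfb s a) (hπ.1 s a)).trans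
      (by rw [← Finset.sum_mul, hπ.2, one_mul])
  have hb : 0 ≤ b := (hh0 s₁).trans (hhb s₁)
  set E : S → ℕ → ℝ := fun s t => ∑ s', M.stateDist π (Pi.single s 1) t s' * h s' with hE
  have hE0 : ∀ s t, 0 ≤ E s t := fun s t => Finset.sum_nonneg fun s' _ =>
    mul_nonneg (M.stateDist_nonneg hπ (single_one_nonneg s) t s') (hh0 s')
  have hsd : ∀ s t, ∑ s', M.stateDist π (Pi.single s 1) t s' = 1 := fun s t => by
    rw [M.stateDist_sum hπ, sum_single_one]
  have hEb : ∀ s t, E s t ≤ b := fun s t =>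
    (Finset.sum_le_sum fun s' _ => mul_le_mul_of_nonneg_left (hhb s')
      (M.stateDist_nonneg hπ (single_one_nonneg s) t s')).trans
      (by rw [← Finset.sum_mul, hsd, one_mul])
  have hv : ∀ s, M.valueAt f π s = ∑' t, M.γ ^ t * E s t := by
    intro s
    unfold valueAt
    simp_rw [hE, hh, Finset.mul_sum]
    exact tsum_congr fun t => Finset.sum_congr rfl fun s' _ => Finset.sum_congr rfl fun a _ => by
      ring
  have hS : ∀ s, Summable fun t => M.γ ^ t * E s t := fun s =>
    Summable.of_nonneg_of_le (fun t => mul_nonneg (pow_nonneg M.γ_pos.le t) (hE0 s t))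
      (fun t => mul_le_mul_of_nonneg_left (hEb s t) (pow_nonneg M.γ_pos.le t))
      ((summable_geometric_of_lt_one M.γ_pos.le M.γ_lt_one).mul_right _)
  have hdiff : ∀ t, E s₁ t - E s₂ t ≤ b * min 1 (2 * C * β ^ t) := by
    intro t
    rw [mul_min_of_nonneg _ _ hb]
    refine le_min (by linarith [hEb s₁ t, hE0 s₂ t]) ?_
    have h1 : E s₁ t - E s₂ t = ∑ s', ((M.stateDist π (Pi.single s₁ 1) t s' - χ s') -
        (M.stateDist π (Pi.single s₂ 1) t s' - χ s')) * (h s' - b / 2) := by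
      have e : ∀ s', ((M.stateDist π (Pi.single s₁ 1) t s' - χ s') -
          (M.stateDist π (Pi.single s₂ 1) t s' - χ s')) * (h s' - b / 2) =
          M.stateDist π (Pi.single s₁ 1) t s' * h s' - M.stateDist π (Pi.single s₂ 1) t s' * h s' -
          (M.stateDist π (Pi.single s₁ 1) t s' * (b / 2) -
            M.stateDist π (Pi.single s₂ 1) t s' * (b / 2)) := fun s' => by ring
      simp_rw [e, Finset.sum_sub_distrib, ← Finset.sum_mul, hsd, sub_self, sub_zero, hE]
    rw [h1]
    have h2 : ∀ s', ((M.stateDist π (Pi.single s₁ 1) t s' - χ s') -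
        (M.stateDist π (Pi.single s₂ 1) t s' - χ s')) * (h s' - b / 2) ≤
        (|M.stateDist π (Pi.single s₁ 1) t s' - χ s'| +
        |M.stateDist π (Pi.single s₂ 1) t s' - χ s'|) * (b / 2) := by
      intro s'
      refine (le_abs_self _).trans ?_
      rw [abs_mul]
      refine mul_le_mul (abs_sub _ _) ?_ (abs_nonneg _) (by positivity)
      rw [abs_le]
      constructor <;> linarith [hh0 s', hhb s']
    refine (Finset.sum_le_sum fun s' _ => h2 s').trans ?_
    rw [← Finset.sum_mul, Finset.sum_add_distrib]
    have h3 := hχ t s₁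
    have h4 := hχ t s₂
    nlinarith
  rw [hv, hv, ← (hS s₁).tsum_sub (hS s₂)]
  refine (((hS s₁).sub (hS s₂)).tsum_le_tsum (fun t => ?_) (hsum.mul_left b)).trans ?_
  · have h0 : 0 ≤ b * min 1 (2 * C * β ^ t) :=
      mul_nonneg hb (le_min zero_le_one (by positivity))
    rw [← mul_sub]
    calc M.γ ^ t * (E s₁ t - E s₂ t) ≤ M.γ ^ t * (b * min 1 (2 * C * β ^ t)) :=
          mul_le_mul_of_nonneg_left (hdiff t) (pow_nonneg M.γ_pos.le t)
      _ ≤ _ := mul_le_of_le_one_left h0 (pow_le_one₀ M.γ_pos.le M.γ_lt_one.le)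
  · rw [tsum_mul_left]
    exact mul_le_mul_of_nonneg_left hle hb

/-- Perturbation bound for the value in terms of the `ℓ¹` distance of the policies and the
oscillation `2 w` of the action values of the second one. -/
theorem abs_value_sub_le (M : ConstrainedMDP S A m) {π π' : S → A → ℝ} (hπ : IsPolicy π)
    (hπ' : IsPolicy π') {f : S → A → ℝ} {k w h : ℝ} (hw0 : 0 ≤ w)
    (hw : ∀ s a, |f s a + M.γ * ∑ s', M.P s a s' * M.valueAt f π s' - k| ≤ w)
    (hh : ∀ s, 0 < M.occ π' M.ρ s → ∑ a, |π' s a - π s a| ≤ h) :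
    |M.value f π' - M.value f π| ≤ h * w / (1 - M.γ) := by
  rw [M.value_sub_value hπ hπ']
  have h1 : h * w / (1 - M.γ) = ∑ s, M.occ π' M.ρ s * (h * w) := by
    rw [← Finset.sum_mul, M.occ_sum hπ' M.ρ_nonneg, M.ρ_sum]
    ring
  rw [h1]
  refine (Finset.abs_sum_le_sum_abs _ _).trans (Finset.sum_le_sum fun s _ => ?_)
  have hocc := M.occ_nonneg hπ' M.ρ_nonneg s
  rw [abs_mul, abs_of_nonneg hocc]
  rcases hocc.eq_or_lt with h0 | h0
  · simp [← h0]
  refine mul_le_mul_of_nonneg_left ?_ hocc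
  have h2 : ∑ a, (π' s a - π s a) * (f s a + M.γ * ∑ s', M.P s a s' * M.valueAt f π s') =
      ∑ a, (π' s a - π s a) * (f s a + M.γ * ∑ s', M.P s a s' * M.valueAt f π s' - k) := by
    simp_rw [mul_sub _ _ k, Finset.sum_sub_distrib, ← Finset.sum_mul, Finset.sum_sub_distrib,
      hπ.2, hπ'.2]
    ring
  rw [h2]
  calc _ ≤ ∑ a, |π' s a - π s a| * w := (Finset.abs_sum_le_sum_abs _ _).trans
        (Finset.sum_le_sum fun a _ => by
          rw [abs_mul]
          exact mul_le_mul_of_nonneg_left (hw s a) (abs_nonneg _))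
    _ ≤ h * w := by
        rw [← Finset.sum_mul]
        exact mul_le_mul_of_nonneg_right (hh s h0) hw0

/-- The perturbation bound without ergodicity. -/
theorem abs_value_sub_le_of_le (M : ConstrainedMDP S A m) {π π' : S → A → ℝ} (hπ : IsPolicy π)
    (hπ' : IsPolicy π') {f : S → A → ℝ} {b h : ℝ} (hf0 : ∀ s a, 0 ≤ f s a)
    (hfb : ∀ s a, f s a ≤ b) (hb : 0 ≤ b)
    (hh : ∀ s, 0 < M.occ π' M.ρ s → ∑ a, |π' s a - π s a| ≤ h) :
    |M.value f π' - M.value f π| ≤ h * b / (1 - M.γ) ^ 2 := by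
  have hg : 0 < 1 - M.γ := sub_pos.2 M.γ_lt_one
  have h1 := M.abs_value_sub_le hπ hπ' (f := f) (k := 0) (w := b / (1 - M.γ)) (h := h)
    (by positivity) (fun s a => ?_) hh
  · refine h1.trans (le_of_eq ?_)
    field_simp
  · have h2 := M.sum_P_mul_le s a (f := fun s' => M.valueAt f π s') (g := fun _ => 0)
      (c := b / (1 - M.γ)) fun s' _ => by simpa using M.valueAt_mono hπ hfb s'
    simp only [mul_zero, Finset.sum_const_zero, zero_add] at h2
    have h3 : 0 ≤ ∑ s', M.P s a s' * M.valueAt f π s' := Finset.sum_nonneg fun s' _ =>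
      mul_nonneg (M.P_nonneg _ _ _) (M.valueAt_nonneg hπ
        (fun s a => mul_nonneg (hπ.1 s a) (hf0 s a)) s')
    have h4 : b / (1 - M.γ) = b + M.γ * (b / (1 - M.γ)) := by
      field_simp
      ring
    rw [sub_zero, abs_of_nonneg (add_nonneg (hf0 s a) (mul_nonneg M.γ_pos.le h3)), h4]
    exact add_le_add (hfb s a) (mul_le_mul_of_nonneg_left h2 M.γ_pos.le)

/-- The perturbation bound around a uniformly ergodic policy: one power of `1 / (1 - γ)` is
replaced by the mixing constant. -/
theorem abs_value_sub_le_of_ergodic (M : ConstrainedMDP S A m) {C β : ℝ} (hC : 1 / 2 ≤ C)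
    (hβ₀ : 0 < β) (hβ₁ : β < 1) {π π' : S → A → ℝ} (hπ : IsPolicy π)
    (herg : M.IsUniformlyErgodic C β π) (hπ' : IsPolicy π') {f : S → A → ℝ} {b h : ℝ}
    (hf0 : ∀ s a, 0 ≤ f s a) (hfb : ∀ s a, f s a ≤ b) (hb : 0 ≤ b)
    (hh : ∀ s, 0 < M.occ π' M.ρ s → ∑ a, |π' s a - π s a| ≤ h) :
    |M.value f π' - M.value f π| ≤ h * (2 * b * Lnu C β) / (1 - M.γ) := by
  have hL := Lnu_pos hC hβ₀ hβ₁
  have hN : 0 ≤ 4 * Lnu C β - 1 := (tsum_nonneg fun t : ℕ => le_min zero_le_one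
    (by positivity)).trans (tsum_min_le hC hβ₀ hβ₁).2
  have := M.nonempty_states
  obtain ⟨s₀, hs₀⟩ := Finite.exists_min fun s => M.valueAt f π s
  set v₀ := M.valueAt f π s₀
  set W := b * (4 * Lnu C β - 1) with hW
  have hW0 : 0 ≤ W := mul_nonneg hb hN
  refine M.abs_value_sub_le hπ hπ' (k := b / 2 + M.γ * (v₀ + W / 2)) (by positivity)
    (fun s a => ?_) hh
  have h1 := M.sum_P_mul_le s a (f := fun s' => M.valueAt f π s') (g := fun _ => 0)
    (c := v₀ + W) fun s' _ => by
      linarith [M.valueAt_sub_le hC hβ₀ hβ₁ hπ herg hf0 hfb s' s₀]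
  have h2 := M.sum_P_mul_le s a (f := fun _ => 0) (g := fun s' => M.valueAt f π s')
    (c := -v₀) fun s' _ => by linarith [hs₀ s']
  simp only [mul_zero, Finset.sum_const_zero, zero_add] at h1 h2
  have h3 : |f s a - b / 2| ≤ b / 2 := by
    rw [abs_le]
    constructor <;> linarith [hf0 s a, hfb s a]
  have h4 : |∑ s', M.P s a s' * M.valueAt f π s' - (v₀ + W / 2)| ≤ W / 2 := by
    rw [abs_le]
    constructor <;> linarith
  have h5 : f s a + M.γ * ∑ s', M.P s a s' * M.valueAt f π s' -
      (b / 2 + M.γ * (v₀ + W / 2)) = (f s a - b / 2) +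
      M.γ * (∑ s', M.P s a s' * M.valueAt f π s' - (v₀ + W / 2)) := by ring
  rw [h5]
  refine (abs_add_le _ _).trans ?_
  rw [abs_mul, abs_of_pos M.γ_pos]
  have h6 : M.γ * |∑ s', M.P s a s' * M.valueAt f π s' - (v₀ + W / 2)| ≤ W / 2 :=
    (mul_le_of_le_one_left (abs_nonneg _) M.γ_lt_one.le).trans h4
  linarith

variable [Nonempty A]

/-- A maximizer of the regularized Lagrangian over policies agrees with the softmax policy on all
reachable states. -/
theorem eq_softmax_of_isMaxOn (M : ConstrainedMDP S A m) {τ μ : ℝ} (hτ : 0 < τ)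
    {l : Fin m → ℝ} {Q : S × A → ℝ} (hQ : M.softBellman τ l Q = Q) {π : S → A → ℝ}
    (hπ : IsPolicy π)
    (hmax : IsMaxOn (fun π' => M.regLagrangian τ μ π' l) {π' | IsPolicy π'} π) {s : S}
    (hs : M.Reach s) : π s = softmaxPolicy (fun x => Q x / τ) s := by
  have hsm := isPolicy_softmaxPolicy (fun x : S × A => Q x / τ)
  have h := hmax hsm
  simp only [Set.mem_ofPred_eq, M.regLagrangian_eq τ μ l hπ, M.regLagrangian_eq τ μ l hsm] at h
  have key : ∀ s, 0 < M.occ π M.ρ s → π s = softmaxPolicy (fun x => Q x / τ) s :=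
    fun s hs => M.eq_softmax_of_regValue_eq hτ hQ hπ (by linarith) hs
  exact key s (M.occ_pos_of_reach hπ (fun s hs a => by
    rw [key s hs]
    exact softmaxPolicy_pos _ _ _) hs)

/-- The dual function has an upper quadratic model with curvature `L_d`: freezing the policy at
the maximizer for `l'` loses at most `(L_d - μ) / 2 * ‖l - l'‖²` at `l`. -/
theorem regLagrangian_sub_le (M : ConstrainedMDP S A m) {C β B τ μ : ℝ} (hC : 1 / 2 ≤ C)
    (hβ₀ : 0 < β) (hβ₁ : β < 1) (hτ : 0 < τ) (herg : M.ErgodicAssumption C β B τ μ)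
    {l l' : Fin m → ℝ} (hl : l ∈ dualBox m B) {Q Q' : S × A → ℝ}
    (hQ : M.softBellman τ l Q = Q) (hQ' : M.softBellman τ l' Q' = Q') :
    M.regLagrangian τ μ (softmaxPolicy fun x => Q x / τ) l -
      M.regLagrangian τ μ (softmaxPolicy fun x => Q' x / τ) l ≤
        (M.Ld C β τ μ - μ) / 2 * ∑ i, (l i - l' i) ^ 2 := by
  obtain ⟨π, hπ, hmax, he⟩ := herg l hl
  set p := softmaxPolicy fun x => Q x / τ with hp
  set p' := softmaxPolicy fun x => Q' x / τ with hp'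
  have hpp : IsPolicy p := isPolicy_softmaxPolicy _
  have hpp' : IsPolicy p' := isPolicy_softmaxPolicy _
  have hg : 0 < 1 - M.γ := sub_pos.2 M.γ_lt_one
  set D := ∑ i : Fin m, |l i - l' i| * M.rmax i.succ with hD
  have hL := Lnu_pos hC hβ₀ hβ₁
  have hV : ∀ i, |M.V p' i - M.V π i| ≤
      D / 2 / (1 - M.γ) / τ * (2 * M.rmax i.succ * Lnu C β) / (1 - M.γ) := by
    intro i
    refine M.abs_value_sub_le_of_ergodic hC hβ₀ hβ₁ hπ he hpp' (fun s a => (M.r_pos _ s a).le)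
      (fun s a => M.r_le_rmax _ s a) (M.rmax_pos _).le fun s hs => ?_
    rw [M.eq_softmax_of_isMaxOn hτ hQ hπ hmax (M.reach_of_occ_pos hs)]
    refine le_trans (le_of_eq ?_) (M.sum_abs_softmaxPolicy_sub_le hτ hQ hQ' s)
    exact Finset.sum_congr rfl fun a _ => abs_sub_comm _ _
  have h1 : M.regLagrangian τ μ p l ≤ M.regLagrangian τ μ π l := hmax hpp
  have h2 : M.regValue τ l' π ≤ M.regValue τ l' p' := M.regValue_le_softmax hτ hQ' hπ
  rw [M.regLagrangian_eq τ μ l hpp'] at *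
  rw [M.regLagrangian_eq τ μ l hπ] at h1
  have h3 : M.regValue τ l π - M.regValue τ l p' ≤ ∑ i, (l i - l' i) * (M.V π i - M.V p' i) := by
    have e : ∑ i, (l i - l' i) * (M.V π i - M.V p' i) =
        (∑ i, l i * M.V π i - ∑ i, l i * M.V p' i) -
          (∑ i, l' i * M.V π i - ∑ i, l' i * M.V p' i) := by
      simp_rw [← Finset.sum_sub_distrib]
      exact Finset.sum_congr rfl fun i _ => by ring
    rw [e]
    simp only [regValue, M.value_rLam _ hπ, M.value_rLam _ hpp'] at h2 ⊢
    linarith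
  have h4 : ∑ i, (l i - l' i) * (M.V π i - M.V p' i) ≤
      D * (D * Lnu C β / ((1 - M.γ) ^ 2 * τ)) := by
    conv_rhs => rw [hD]
    rw [Finset.sum_mul]
    refine Finset.sum_le_sum fun i _ => (le_abs_self _).trans ?_
    rw [abs_mul, mul_assoc]
    refine mul_le_mul_of_nonneg_left ?_ (abs_nonneg _)
    rw [abs_sub_comm]
    refine (hV i).trans (le_of_eq ?_)
    rw [← hD]
    field_simp
  have h5 : D ^ 2 ≤ (∑ i, (l i - l' i) ^ 2) * M.Rmax ^ 2 := by
    rw [M.Rmax_sq]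
    refine (Finset.sum_mul_sq_le_sq_mul_sq _ _ _).trans (le_of_eq ?_)
    simp_rw [sq_abs]
  have h6 : D * (D * Lnu C β / ((1 - M.γ) ^ 2 * τ)) ≤
      (M.Ld C β τ μ - μ) / 2 * ∑ i, (l i - l' i) ^ 2 := by
    have e1 : D * (D * Lnu C β / ((1 - M.γ) ^ 2 * τ)) =
        D ^ 2 * (Lnu C β / ((1 - M.γ) ^ 2 * τ)) := by ring
    have e2 : (M.Ld C β τ μ - μ) / 2 * ∑ i, (l i - l' i) ^ 2 =
        ((∑ i, (l i - l' i) ^ 2) * M.Rmax ^ 2) * (Lnu C β / ((1 - M.γ) ^ 2 * τ)) := by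
      rw [Ld]
      ring
    rw [e1, e2]
    exact mul_le_mul_of_nonneg_right h5 (by positivity)
  linarith

end ConstrainedMDP

/-! ### Natural policy gradient as soft policy iteration -/

/-- The product rule at a zero of the second factor, where continuity of the first factor is
enough. -/
theorem hasDerivAt_mul_of_eq_zero {f g : ℝ → ℝ} {g' x : ℝ} (hf : ContinuousAt f x)
    (hg : HasDerivAt g g' x) (h0 : g x = 0) : HasDerivAt (fun y => f y * g y) (f x * g') x := by
  rw [hasDerivAt_iff_tendsto_slope] at hg ⊢
  have h : slope (fun y => f y * g y) x = fun y => f y * slope g x y := by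
    funext y
    simp only [slope_def_field, h0]
    ring
  rw [h]
  exact (hf.tendsto.mono_left nhdsWithin_le_nhds).mul hg

section Softmax

variable {S A : Type*} [DecidableEq S] [Fintype A] [DecidableEq A]

/-- The score `∂ log π_θ(a|s) / ∂ θ(x)` of a softmax policy `p`. -/
noncomputable def softmaxScore (p : S → A → ℝ) (x : S × A) (s : S) (a : A) : ℝ :=
  (if (s, a) = x then 1 else 0) - ∑ b, p s b * if (s, b) = x then 1 else 0

/-- The average of a centred function against the score picks out one action value. -/
theorem sum_mul_softmaxScore_mul (p y : S → A → ℝ) (s : S) (hy : ∑ a, p s a * y s a = 0)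
    (x : S × A) : ∑ a, p s a * softmaxScore p x s a * y s a =
      if s = x.1 then p x.1 x.2 * y x.1 x.2 else 0 := by
  obtain ⟨s₀, a₀⟩ := x
  simp_rw [softmaxScore, mul_sub, sub_mul, Finset.sum_sub_distrib]
  set c := ∑ b, p s b * if (s, b) = (s₀, a₀) then 1 else 0
  have h1 : ∑ a, p s a * c * y s a = 0 := by
    have : ∀ a, p s a * c * y s a = c * (p s a * y s a) := fun a => by ring
    simp_rw [this, ← Finset.mul_sum, hy, mul_zero]
  rw [h1, sub_zero]
  by_cases hs : s = s₀
  · subst hs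
    simp
  · simp [hs]

variable [Nonempty A]

theorem hasDerivAt_softmaxPolicy_update (θ : S × A → ℝ) (x : S × A) (s : S) (a : A) :
    HasDerivAt (fun t => softmaxPolicy (Function.update θ x t) s a)
      (softmaxPolicy θ s a * softmaxScore (softmaxPolicy θ) x s a) (θ x) := by
  have h := hasDerivAt_softmaxDist (w := fun a t => Function.update θ x t (s, a))
    (w' := fun a => if (s, a) = x then 1 else 0) (t := θ x) (fun a => by
      by_cases hx : (s, a) = x
      · subst hx
        simpa using hasDerivAt_id' (θ (s, a))
      · simpa [Function.update_of_ne hx, hx] using hasDerivAt_const (θ x) (θ (s, a))) a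
  simp only [Function.update_eq_self] at h
  exact h

theorem partialDeriv_log_softmaxPolicy (θ : S × A → ℝ) (x : S × A) (s : S) (a : A) :
    partialDeriv (fun θ' => Real.log (softmaxPolicy θ' s a)) θ x =
      softmaxScore (softmaxPolicy θ) x s a := by
  have hp := (softmaxPolicy_pos θ s a).ne'
  have h := (hasDerivAt_softmaxPolicy_update θ x s a).log
    (by simpa only [Function.update_eq_self] using hp)
  simp only [Function.update_eq_self] at h
  rw [partialDeriv, h.deriv, mul_div_cancel_left₀ _ hp]

theorem continuous_softmaxPolicy_update (θ : S × A → ℝ) (x : S × A) (s : S) (a : A) :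
    Continuous fun t => softmaxPolicy (Function.update θ x t) s a := by
  have h : ∀ b, Continuous fun t => Function.update θ x t (s, b) := fun b =>
    (continuous_apply (s, b)).comp
      (f := fun t => Function.update θ x t) (continuous_const.update x continuous_id)
  exact Continuous.div (h a).rexp (continuous_finsetSum _ fun b _ => (h b).rexp)
    fun t => (sum_exp_pos fun b => Function.update θ x t (s, b)).ne'

end Softmax

section Score

variable {S A : Type*} [Fintype S] [DecidableEq S] [Fintype A] [DecidableEq A]

theorem sum_softmaxScore_mul (p : S → A → ℝ) (w : S × A → ℝ) (s : S) (a : A) :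
    ∑ x, softmaxScore p x s a * w x = w (s, a) - ∑ b, p s b * w (s, b) := by
  simp_rw [softmaxScore, sub_mul, Finset.sum_sub_distrib, Finset.sum_mul]
  congr 1
  · simp
  · rw [Finset.sum_comm]
    refine Finset.sum_congr rfl fun b _ => ?_
    simp

end Score

namespace ConstrainedMDP

variable {S A : Type*} [Fintype S] [DecidableEq S] [Fintype A] {m : ℕ}

/-- The entropy-regularized value of `π` at a state. -/
noncomputable def softValue (M : ConstrainedMDP S A m) (τ : ℝ) (l : Fin m → ℝ)
    (π : S → A → ℝ) (s : S) : ℝ :=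
  M.valueAt (M.softReward τ l π) π s

/-- The entropy-regularized action value of `π`. -/
noncomputable def softActionValue (M : ConstrainedMDP S A m) (τ : ℝ) (l : Fin m → ℝ)
    (π : S → A → ℝ) (s : S) (a : A) : ℝ :=
  M.rLam l s a + M.γ * ∑ s', M.P s a s' * M.softValue τ l π s'

/-- The entropy-regularized advantage of `π`. -/
noncomputable def softAdvantage (M : ConstrainedMDP S A m) (τ : ℝ) (l : Fin m → ℝ)
    (π : S → A → ℝ) (s : S) (a : A) : ℝ :=
  M.softActionValue τ l π s a - τ * Real.log (π s a) - M.softValue τ l π s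

theorem softValue_eq (M : ConstrainedMDP S A m) (τ : ℝ) (l : Fin m → ℝ) {π : S → A → ℝ}
    (hπ : IsPolicy π) (s : S) : M.softValue τ l π s =
      ∑ a, π s a * (M.softActionValue τ l π s a - τ * Real.log (π s a)) := by
  rw [softValue, M.valueAt_bellman hπ]
  refine Finset.sum_congr rfl fun a _ => ?_
  rw [softReward, softActionValue]
  simp only [softValue]
  ring

theorem sum_mul_softAdvantage (M : ConstrainedMDP S A m) (τ : ℝ) (l : Fin m → ℝ)
    {π : S → A → ℝ} (hπ : IsPolicy π) (s : S) :
    ∑ a, π s a * M.softAdvantage τ l π s a = 0 := by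
  simp_rw [softAdvantage, mul_sub _ _ (M.softValue τ l π s), Finset.sum_sub_distrib,
    ← Finset.sum_mul, hπ.2, one_mul]
  rw [← M.softValue_eq τ l hπ, sub_self]

/-- The soft performance difference relative to `π'`. -/
theorem sum_occ_softReward_eq (M : ConstrainedMDP S A m) (τ : ℝ) (l : Fin m → ℝ)
    {π : S → A → ℝ} (hπ : IsPolicy π) (π' : S → A → ℝ) {d : S → ℝ} (hd : ∀ s, 0 ≤ d s) :
    ∑ s, ∑ a, M.occ π d s * π s a * M.softReward τ l π s a =
      ∑ s, d s * M.softValue τ l π' s + ∑ s, M.occ π d s *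
        (∑ a, π s a * (M.softActionValue τ l π' s a - τ * Real.log (π s a)) -
          M.softValue τ l π' s) := by
  rw [M.sum_occ_eq hπ hd _ (M.softValue τ l π')]
  congr 1
  refine Finset.sum_congr rfl fun s _ => ?_
  congr 2
  refine Finset.sum_congr rfl fun a _ => ?_
  rw [softReward, softActionValue]
  ring

theorem softValue_nonneg (M : ConstrainedMDP S A m) {τ : ℝ} (hτ : 0 < τ) {l : Fin m → ℝ}
    (hl : ∀ i, 0 ≤ l i) {π : S → A → ℝ} (hπ : IsPolicy π) (s : S) :
    0 ≤ M.softValue τ l π s := by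
  refine M.valueAt_nonneg hπ (fun s a => mul_nonneg (hπ.1 s a) ?_) s
  have h1 : π s a ≤ 1 := by
    rw [← hπ.2 s]
    exact Finset.single_le_sum (fun a _ => hπ.1 s a) (Finset.mem_univ a)
  have h2 := Real.log_nonpos (hπ.1 s a) h1
  have := M.rLam_nonneg hl s a
  rw [softReward]
  nlinarith

section PolicyGradient

variable [DecidableEq A] [Nonempty A]

/-- The entropy-regularized policy gradient theorem for softmax policies. -/
theorem partialDeriv_regValue (M : ConstrainedMDP S A m) (τ : ℝ) (l : Fin m → ℝ)
    (θ : S × A → ℝ) (x : S × A) :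
    partialDeriv (fun θ' => M.regValue τ l (softmaxPolicy θ')) θ x =
      M.occ (softmaxPolicy θ) M.ρ x.1 * (softmaxPolicy θ x.1 x.2 *
        M.softAdvantage τ l (softmaxPolicy θ) x.1 x.2) := by
  set p := softmaxPolicy θ with hp
  have hpol : IsPolicy p := isPolicy_softmaxPolicy θ
  set pt : ℝ → S → A → ℝ := fun t => softmaxPolicy (Function.update θ x t) with hpt
  have hpt0 : pt (θ x) = p := by simp [hpt, hp]
  have hptpol : ∀ t, IsPolicy (pt t) := fun t => isPolicy_softmaxPolicy _
  set G : S → ℝ → ℝ := fun s t =>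
    ∑ a, pt t s a * (M.softActionValue τ l p s a - τ * Real.log (pt t s a)) -
      M.softValue τ l p s with hG
  have hG0 : ∀ s, G s (θ x) = 0 := fun s => by
    simp only [hG, hpt0]
    rw [← M.softValue_eq τ l hpol, sub_self]
  have hGd : ∀ s, HasDerivAt (G s)
      (if s = x.1 then p x.1 x.2 * M.softAdvantage τ l p x.1 x.2 else 0) (θ x) := by
    intro s
    have hd : ∀ a, HasDerivAt (fun t => pt t s a) (p s a * softmaxScore p x s a) (θ x) :=
      fun a => hasDerivAt_softmaxPolicy_update θ x s a
    have hpos : ∀ a, 0 < p s a := fun a => softmaxPolicy_pos θ s a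
    have h1 : HasDerivAt (G s) (∑ a, (p s a * softmaxScore p x s a *
        (M.softActionValue τ l p s a - τ * Real.log (p s a)) +
        p s a * (0 - τ * (p s a * softmaxScore p x s a / p s a)))) (θ x) := by
      refine (HasDerivAt.fun_sum fun a _ => ?_).sub_const _
      have h2 := (hd a).mul ((hasDerivAt_const (θ x) (M.softActionValue τ l p s a)).sub
        (((hd a).log (by rw [hpt0]; exact (hpos a).ne')).const_mul τ))
      simp only [Pi.sub_apply, hpt0] at h2
      exact h2
    refine h1.congr_deriv ?_
    have hsc : ∑ a, p s a * softmaxScore p x s a = 0 := by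
      simp_rw [softmaxScore, mul_sub, Finset.sum_sub_distrib, ← Finset.sum_mul, hpol.2, one_mul]
      exact sub_self _
    rw [← sum_mul_softmaxScore_mul p (M.softAdvantage τ l p) s
      (M.sum_mul_softAdvantage τ l hpol s) x]
    have e : ∀ a, p s a * softmaxScore p x s a *
        (M.softActionValue τ l p s a - τ * Real.log (p s a)) +
        p s a * (0 - τ * (p s a * softmaxScore p x s a / p s a)) =
        p s a * softmaxScore p x s a * M.softAdvantage τ l p s a +
        p s a * softmaxScore p x s a * (M.softValue τ l p s - τ) := by
      intro a
      rw [softAdvantage, mul_div_cancel_left₀ _ (hpos a).ne']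
      ring
    simp_rw [e, Finset.sum_add_distrib, ← Finset.sum_mul, hsc, zero_mul, add_zero]
  have hF : (fun t => M.regValue τ l (pt t)) = fun t =>
      ∑ s, M.ρ s * M.softValue τ l p s + ∑ s, M.occ (pt t) M.ρ s * G s t := by
    funext t
    rw [M.regValue_eq τ l (hptpol t), M.value_eq (hptpol t),
      M.sum_occ_softReward_eq τ l (hptpol t) p M.ρ_nonneg]
  have hder : HasDerivAt (fun t => M.regValue τ l (pt t))
      (∑ s, M.occ p M.ρ s *
        if s = x.1 then p x.1 x.2 * M.softAdvantage τ l p x.1 x.2 else 0) (θ x) := by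
    rw [hF]
    refine (HasDerivAt.fun_sum fun s _ => ?_).const_add _
    have h := hasDerivAt_mul_of_eq_zero (M.continuous_occ_of_continuous hptpol
      (continuous_softmaxPolicy_update θ x) s).continuousAt (hGd s) (hG0 s)
    rwa [hpt0] at h
  rw [partialDeriv]
  change deriv (fun t => M.regValue τ l (pt t)) (θ x) = _
  rw [hder.deriv]
  simp

theorem fisher_mulVec (M : ConstrainedMDP S A m) (θ w : S × A → ℝ) (x : S × A) :
    (M.fisher θ).mulVec w x = ∑ s, ∑ a, M.visitation (softmaxPolicy θ) s a *
      (softmaxScore (softmaxPolicy θ) x s a *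
        (w (s, a) - ∑ b, softmaxPolicy θ s b * w (s, b))) := by
  simp only [Matrix.mulVec, dotProduct, fisher, partialDeriv_log_softmaxPolicy]
  simp_rw [← sum_softmaxScore_mul, Finset.sum_mul, Finset.mul_sum]
  rw [Finset.sum_comm]
  refine Finset.sum_congr rfl fun s _ => ?_
  rw [Finset.sum_comm]
  exact Finset.sum_congr rfl fun a _ => Finset.sum_congr rfl fun y _ => by ring

/-- The policy gradient lies in the range of the Fisher matrix: it is the image of the
advantage. -/
theorem fisher_mulVec_softAdvantage (M : ConstrainedMDP S A m) (τ : ℝ) (l : Fin m → ℝ)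
    (θ : S × A → ℝ) (x : S × A) :
    (M.fisher θ).mulVec (fun y => M.softAdvantage τ l (softmaxPolicy θ) y.1 y.2) x =
      (1 - M.γ) * (M.occ (softmaxPolicy θ) M.ρ x.1 * (softmaxPolicy θ x.1 x.2 *
        M.softAdvantage τ l (softmaxPolicy θ) x.1 x.2)) := by
  have hpol : IsPolicy (softmaxPolicy θ) := isPolicy_softmaxPolicy θ
  rw [fisher_mulVec]
  simp_rw [M.sum_mul_softAdvantage τ l hpol, sub_zero, visitation_eq]
  have h : ∀ s, ∑ a, (1 - M.γ) * (M.occ (softmaxPolicy θ) M.ρ s * softmaxPolicy θ s a) *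
      (softmaxScore (softmaxPolicy θ) x s a * M.softAdvantage τ l (softmaxPolicy θ) s a) =
      (1 - M.γ) * (M.occ (softmaxPolicy θ) M.ρ s * if s = x.1 then softmaxPolicy θ x.1 x.2 *
        M.softAdvantage τ l (softmaxPolicy θ) x.1 x.2 else 0) := by
    intro s
    rw [← sum_mul_softmaxScore_mul (softmaxPolicy θ) _ s (M.sum_mul_softAdvantage τ l hpol s) x,
      Finset.mul_sum, Finset.mul_sum]
    exact Finset.sum_congr rfl fun a _ => by ring
  simp_rw [h, ← Finset.mul_sum]
  simp

/-- The kernel of the Fisher matrix consists of the functions that are constant in the action at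
every visited state. -/
theorem eq_of_fisher_mulVec_eq_zero (M : ConstrainedMDP S A m) (θ w : S × A → ℝ)
    (h : (M.fisher θ).mulVec w = 0) {s : S} (hs : 0 < M.occ (softmaxPolicy θ) M.ρ s) (a : A) :
    w (s, a) = ∑ b, softmaxPolicy θ s b * w (s, b) := by
  set p := softmaxPolicy θ with hp
  have hpol : IsPolicy p := isPolicy_softmaxPolicy θ
  have hg : 0 < 1 - M.γ := sub_pos.2 M.γ_lt_one
  have h1 : ∑ x, w x * (M.fisher θ).mulVec w x = 0 := by simp [h]
  have h2 : ∑ x, w x * (M.fisher θ).mulVec w x =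
      ∑ s, ∑ a, M.visitation p s a * (w (s, a) - ∑ b, p s b * w (s, b)) ^ 2 := by
    simp_rw [fisher_mulVec, Finset.mul_sum]
    rw [Finset.sum_comm]
    refine Finset.sum_congr rfl fun s _ => ?_
    rw [Finset.sum_comm]
    refine Finset.sum_congr rfl fun a _ => ?_
    have e : ∀ x, w x * (M.visitation p s a * (softmaxScore p x s a *
        (w (s, a) - ∑ b, p s b * w (s, b)))) =
        M.visitation p s a * (w (s, a) - ∑ b, p s b * w (s, b)) * (softmaxScore p x s a * w x) :=
      fun x => by ring
    simp_rw [← hp, e, ← Finset.mul_sum, sum_softmaxScore_mul]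
    ring
  have hv : ∀ s a, 0 ≤ M.visitation p s a := fun s a => by
    rw [visitation_eq]
    exact mul_nonneg hg.le (mul_nonneg (M.occ_nonneg hpol M.ρ_nonneg s) (hpol.1 s a))
  have hn : ∀ s a, 0 ≤ M.visitation p s a * (w (s, a) - ∑ b, p s b * w (s, b)) ^ 2 :=
    fun s a => mul_nonneg (hv s a) (sq_nonneg _)
  rw [h2] at h1
  have h3 := (Finset.sum_eq_zero_iff_of_nonneg fun s _ => Finset.sum_nonneg fun a _ => hn s a).1
    h1 s (Finset.mem_univ s)
  have h4 := (Finset.sum_eq_zero_iff_of_nonneg fun a _ => hn s a).1 h3 a (Finset.mem_univ a)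
  have h5 : M.visitation p s a ≠ 0 := by
    rw [visitation_eq]
    exact (mul_pos hg (mul_pos hs (softmaxPolicy_pos θ s a))).ne'
  have h6 := (mul_eq_zero.1 h4).resolve_left h5
  exact sub_eq_zero.1 (pow_eq_zero_iff two_ne_zero |>.1 h6)

/-- On reachable states a natural policy gradient step with step size `(1 - γ) / τ` is a step of
soft policy iteration. -/
theorem softmaxPolicy_npgStep (M : ConstrainedMDP S A m) {τ : ℝ} (hτ : 0 < τ) (l : Fin m → ℝ)
    (θ : S × A → ℝ) {s : S} (hs : M.Reach s) :
    softmaxPolicy (M.npgStep τ l θ) s =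
      softmaxDist fun a => M.softActionValue τ l (softmaxPolicy θ) s a / τ := by
  set p := softmaxPolicy θ with hp
  have hpol : IsPolicy p := isPolicy_softmaxPolicy θ
  have hg : 0 < 1 - M.γ := sub_pos.2 M.γ_lt_one
  set adv : S × A → ℝ := fun y => M.softAdvantage τ l p y.1 y.2 with hadv
  set F := M.fisher θ with hF
  set z := (pinv F).mulVec (F.mulVec adv) with hz
  have hgrad : (fun x => partialDeriv (fun θ' => M.regValue τ l (softmaxPolicy θ')) θ x) =
      (1 - M.γ)⁻¹ • F.mulVec adv := by
    funext x
    rw [partialDeriv_regValue, Pi.smul_apply, hF, hadv, M.fisher_mulVec_softAdvantage τ l θ x,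
      smul_eq_mul, inv_mul_cancel_left₀ hg.ne']
  have hstep : M.npgStep τ l θ = θ + (1 / τ) • z := by
    rw [npgStep, hgrad, Matrix.mulVec_smul, smul_smul, ← hF, ← hz]
    congr 2
    field_simp
  have hker : F.mulVec (z - adv) = 0 := by
    rw [Matrix.mulVec_sub, hz, Matrix.mulVec_mulVec, Matrix.mulVec_mulVec, (pinv_spec F).1,
      sub_self]
  have hocc : 0 < M.occ p M.ρ s :=
    M.occ_pos_of_reach hpol (fun s _ a => softmaxPolicy_pos θ s a) hs
  obtain ⟨k, hk⟩ : ∃ k, ∀ a, z (s, a) - adv (s, a) = k :=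
    ⟨_, fun a => M.eq_of_fisher_mulVec_eq_zero θ _ hker hocc a⟩
  rw [softmaxPolicy_eq, ← softmaxDist_add_const
    (fun a => M.softActionValue τ l p s a / τ)
    (Real.log (∑ a, Real.exp (θ (s, a))) + (k - M.softValue τ l p s) / τ)]
  congr 1
  funext a
  have h1 : z (s, a) = M.softActionValue τ l p s a - τ * Real.log (p s a) -
      M.softValue τ l p s + k := by
    rw [← hk a]
    simp only [hadv, softAdvantage]
    ring
  have h2 : Real.log (p s a) = θ (s, a) - Real.log (∑ a', Real.exp (θ (s, a'))) :=
    log_softmaxDist (fun a => θ (s, a)) a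
  rw [hstep, Pi.add_apply, Pi.smul_apply, smul_eq_mul, h1, h2]
  field_simp
  ring

end PolicyGradient

/-! ### Linear convergence of the policy optimizers -/

section Convergence

theorem loop_queries {α : Type*} (f : α → α) (n : ℕ) (x : α) :
    (Counted.loop (fun y => ⟨f y, 1⟩) n x).queries = n := by
  induction n with
  | zero => rfl
  | succ n ih => rw [Counted.loop, ih]

theorem regPO_queries_le [DecidableEq A] (M : ConstrainedMDP S A m) (B δ τ : ℝ) (l : Fin m → ℝ)
    (o : RegPO) : (M.regPO B δ τ l o).queries ≤ M.innerIters B δ τ + 1 := by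
  cases o
  · simp only [regPO, loop_queries]
    exact le_rfl
  · simp only [regPO, loop_queries]
    exact Nat.le_succ _

variable [Nonempty A]

theorem softValue_le (M : ConstrainedMDP S A m) {τ : ℝ} (hτ : 0 < τ) {l : Fin m → ℝ}
    {Q : S × A → ℝ} (hQ : M.softBellman τ l Q = Q) {π : S → A → ℝ} (hπ : IsPolicy π) (s : S) :
    M.softValue τ l π s ≤ softMaximum τ fun a => Q (s, a) := by
  rw [softValue, M.valueAt_eq hπ, M.sum_softReward_eq hτ.ne' hQ hπ (single_one_nonneg s),
    sum_single_mul]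
  have : 0 ≤ ∑ s', M.occ π (Pi.single s 1) s' * klAt π (softmaxPolicy fun x => Q x / τ) s' :=
    Finset.sum_nonneg fun s' _ => mul_nonneg (M.occ_nonneg hπ (single_one_nonneg s) s')
      (klAt_nonneg hπ (isPolicy_softmaxPolicy _) (fun s a => softmaxPolicy_pos _ _ _) s')
  nlinarith

/-- Soft policy improvement: one step of soft policy iteration gains at least as much as one
application of the soft Bellman operator. -/
theorem softMaximum_le_softValue (M : ConstrainedMDP S A m) {τ : ℝ} (hτ : 0 < τ)
    {l : Fin m → ℝ} {π π' : S → A → ℝ} (hπ : IsPolicy π) (hπ' : IsPolicy π')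
    (h : ∀ s, M.Reach s → π' s = softmaxDist fun a => M.softActionValue τ l π s a / τ)
    {s : S} (hs : M.Reach s) :
    softMaximum τ (M.softActionValue τ l π s) ≤ M.softValue τ l π' s := by
  rw [softValue, M.valueAt_eq hπ', M.sum_occ_softReward_eq τ l hπ' π (single_one_nonneg s),
    sum_single_mul]
  have h1 : ∀ s', M.Reach s' → ∑ a, π' s' a *
      (M.softActionValue τ l π s' a - τ * Real.log (π' s' a)) =
      softMaximum τ (M.softActionValue τ l π s') := by
    intro s' hs'
    rw [h s' hs']
    exact sum_softmaxDist_mul_sub_log hτ.ne' _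
  have h2 : ∀ s', M.softValue τ l π s' ≤ softMaximum τ (M.softActionValue τ l π s') := by
    intro s'
    rw [M.softValue_eq τ l hπ]
    exact sum_mul_sub_log_le hτ (hπ.1 s') (hπ.2 s') _
  have h3 : ∀ s', 0 ≤ M.occ π' (Pi.single s 1) s' * (∑ a, π' s' a *
      (M.softActionValue τ l π s' a - τ * Real.log (π' s' a)) - M.softValue τ l π s') := by
    intro s'
    by_cases hs' : M.Reach s'
    · rw [h1 s' hs']
      exact mul_nonneg (M.occ_nonneg hπ' (single_one_nonneg s) s') (sub_nonneg.2 (h2 s'))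
    · rw [M.occ_eq_zero_of_not_reach π' (fun s₁ hs₁ => ?_) hs', zero_mul]
      exact Pi.single_eq_of_ne (fun hne : s₁ = s => hs₁ (hne ▸ hs)) _
  have h4 := Finset.single_le_sum (fun s' _ => h3 s') (Finset.mem_univ s)
  rw [h1 s hs] at h4
  have h5 := M.le_occ hπ' (single_one_nonneg s) s
  rw [Pi.single_eq_same] at h5
  nlinarith [h2 s]

theorem abs_softActionValue_sub_le (M : ConstrainedMDP S A m) {τ : ℝ} (hτ : 0 < τ)
    {l : Fin m → ℝ} {Q : S × A → ℝ} (hQ : M.softBellman τ l Q = Q) {π : S → A → ℝ}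
    (hπ : IsPolicy π) {c : ℝ}
    (h : ∀ s, M.Reach s → (softMaximum τ fun a => Q (s, a)) - M.softValue τ l π s ≤ c)
    {s : S} (hs : M.Reach s) (a : A) :
    0 ≤ Q (s, a) - M.softActionValue τ l π s a ∧
      Q (s, a) - M.softActionValue τ l π s a ≤ M.γ * c := by
  have h0 := congrFun hQ (s, a)
  rw [softBellman_eq] at h0
  have h1 := M.sum_P_mul_le s a (f := fun s' => softMaximum τ fun a => Q (s', a))
    (g := M.softValue τ l π) (c := c) fun s' hP => by linarith [h s' (hs.step hP)]
  have h2 := M.sum_P_mul_le s a (f := M.softValue τ l π)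
    (g := fun s' => softMaximum τ fun a => Q (s', a)) (c := 0)
    fun s' _ => by linarith [M.softValue_le hτ hQ hπ s']
  have h3 := mul_le_mul_of_nonneg_left h1 M.γ_pos.le
  have h4 := mul_le_mul_of_nonneg_left h2 M.γ_pos.le
  rw [softActionValue]
  constructor <;> linarith

/-- The soft values of the natural policy gradient iterates converge linearly on the reachable
states. The initial gap is at most `c` because soft values are nonnegative. -/
theorem npg_convergence [DecidableEq A] (M : ConstrainedMDP S A m) {τ : ℝ} (hτ : 0 < τ)
    {l : Fin m → ℝ} {Q : S × A → ℝ} (hQ : M.softBellman τ l Q = Q) (hl : ∀ i, 0 ≤ l i)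
    {c : ℝ} (hc : ∀ s, (softMaximum τ fun a => Q (s, a)) ≤ c) (n : ℕ) {s : S}
    (hs : M.Reach s) : (softMaximum τ fun a => Q (s, a)) - M.softValue τ l
      (softmaxPolicy (Counted.loop (fun θ => ⟨M.npgStep τ l θ, 1⟩) n 0).val) s ≤ M.γ ^ n * c := by
  induction n generalizing s with
  | zero =>
    have := M.softValue_nonneg hτ hl (isPolicy_softmaxPolicy
      (Counted.loop (fun θ => ⟨M.npgStep τ l θ, 1⟩) 0 (0 : S × A → ℝ)).val) s
    linarith [hc s]
  | succ n ih =>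
    set θ := (Counted.loop (fun θ => ⟨M.npgStep τ l θ, 1⟩) n (0 : S × A → ℝ)).val with hθ
    have hpol := isPolicy_softmaxPolicy θ
    have h1 := M.softMaximum_le_softValue hτ (l := l) hpol
      (isPolicy_softmaxPolicy (M.npgStep τ l θ))
      (fun s hs => M.softmaxPolicy_npgStep hτ l θ hs) hs
    have h2 := softMaximum_le_add hτ (x := fun a => Q (s, a))
      (y := M.softActionValue τ l (softmaxPolicy θ) s) (c := M.γ * (M.γ ^ n * c))
      fun a => by linarith [(M.abs_softActionValue_sub_le hτ hQ hpol (fun s hs => ih hs) hs a).2]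
    rw [Counted.loop, ← hθ]
    rw [pow_succ']
    linarith

theorem isPolicy_regPO [DecidableEq A] (M : ConstrainedMDP S A m) (B δ τ : ℝ) (l : Fin m → ℝ)
    (o : RegPO) : IsPolicy (M.regPO B δ τ l o).val := by
  cases o
  · exact isPolicy_softmaxPolicy (Counted.loop (fun θ => ⟨M.npgStep τ l θ, 1⟩) _ 0).val
  · exact isPolicy_softmaxPolicy fun x : S × A =>
      (Counted.loop (fun Q => ⟨M.softBellman τ l Q, 1⟩) _ 0).val x / τ

/-- Both policy optimizers return, on the reachable states, the softmax policy of an approximation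
of the soft-optimal action value with error `γ ^ K` times its size. -/
theorem regPO_spec [DecidableEq A] (M : ConstrainedMDP S A m) {B δ τ : ℝ} (hτ : 0 < τ)
    {l : Fin m → ℝ} {Q : S × A → ℝ} (hQ : M.softBellman τ l Q = Q) (hl : ∀ i, 0 ≤ l i)
    {c : ℝ} (hc : ∀ s, (softMaximum τ fun a => Q (s, a)) ≤ c) (hcQ : ∀ x, Q x ≤ c) (o : RegPO) :
    ∃ X : S × A → ℝ, ∀ s, M.Reach s →
      (M.regPO B δ τ l o).val s = softmaxPolicy (fun x => X x / τ) s ∧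
        ∀ a, |X (s, a) - Q (s, a)| ≤ M.γ ^ M.innerIters B δ τ * c := by
  have hc0 : 0 ≤ c :=
    (M.softMaximum_fixed_nonneg hτ hl hQ (Classical.choice M.nonempty_states)).trans (hc _)
  cases o with
  | npg =>
    set n := M.innerIters B δ τ
    set θ := (Counted.loop (fun θ => ⟨M.npgStep τ l θ, 1⟩) n (0 : S × A → ℝ)).val with hθ
    refine ⟨fun x => M.softActionValue τ l (softmaxPolicy θ) x.1 x.2, fun s hs => ⟨?_, ?_⟩⟩
    · exact M.softmaxPolicy_npgStep hτ l θ hs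
    · intro a
      have h := M.abs_softActionValue_sub_le hτ hQ (isPolicy_softmaxPolicy θ)
        (fun s hs => M.npg_convergence hτ hQ hl hc n hs) hs a
      have h2 : M.γ * (M.γ ^ n * c) ≤ M.γ ^ n * c :=
        mul_le_of_le_one_left (mul_nonneg (pow_nonneg M.γ_pos.le n) hc0) M.γ_lt_one.le
      rw [abs_le]
      constructor <;> linarith
  | softQ =>
    refine ⟨(Counted.loop (fun Q => ⟨M.softBellman τ l Q, 1⟩) (M.innerIters B δ τ) 0).val,
      fun s _ => ⟨rfl, fun a => M.softQ_convergence hτ hQ (fun x => ?_) _ _⟩⟩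
    rw [abs_of_nonneg (M.softBellman_fixed_nonneg hτ hl hQ x)]
    exact hcQ x

end Convergence

end ConstrainedMDP

/-! ### Mixing policies through their occupancies -/

/-- Normalize every row of a nonnegative matrix to a probability vector; rows of mass `0` become
uniform. -/
noncomputable def normalizeRows {S A : Type*} [Fintype A] (ν : S → A → ℝ) : S → A → ℝ :=
  open Classical in fun s a =>
    if ∑ a', ν s a' = 0 then 1 / (Fintype.card A : ℝ) else ν s a / ∑ a', ν s a'

theorem isPolicy_normalizeRows {S A : Type*} [Fintype A] [Nonempty A] {ν : S → A → ℝ}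
    (hν : ∀ s a, 0 ≤ ν s a) : IsPolicy (normalizeRows ν) := by
  constructor
  · intro s a
    unfold normalizeRows
    split_ifs
    · positivity
    · exact div_nonneg (hν s a) (Finset.sum_nonneg fun a _ => hν s a)
  · intro s
    unfold normalizeRows
    split_ifs with h
    · simp
    · rw [← Finset.sum_div, div_self h]

theorem sum_mul_normalizeRows {S A : Type*} [Fintype A] {ν : S → A → ℝ}
    (hν : ∀ s a, 0 ≤ ν s a) (s : S) (a : A) :
    (∑ a', ν s a') * normalizeRows ν s a = ν s a := by
  unfold normalizeRows
  split_ifs with h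
  · rw [h, zero_mul]
    exact ((Finset.sum_eq_zero_iff_of_nonneg fun a _ => hν s a).1 h a (Finset.mem_univ a)).symm
  · exact mul_div_cancel₀ _ h

namespace ConstrainedMDP

variable {S A : Type*} [Fintype S] [Fintype A] {m : ℕ}

/-- The flow equation determines the occupancy. -/
theorem eq_occ_of_flow (M : ConstrainedMDP S A m) {π : S → A → ℝ} (hπ : IsPolicy π)
    {d x : S → ℝ} (hd : ∀ s, 0 ≤ d s)
    (hx : ∀ s', x s' = d s' + M.γ * ∑ s, ∑ a, x s * π s a * M.P s a s') : x = M.occ π d := by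
  set e : S → ℝ := fun s => x s - M.occ π d s with he
  have h1 : ∀ s', e s' = M.γ * ∑ s, ∑ a, e s * π s a * M.P s a s' := by
    intro s'
    simp only [he]
    conv_lhs => rw [hx s', M.occ_flow hπ hd s']
    rw [add_sub_add_left_eq_sub, ← mul_sub, ← Finset.sum_sub_distrib]
    congr 1
    refine Finset.sum_congr rfl fun s _ => ?_
    rw [← Finset.sum_sub_distrib]
    exact Finset.sum_congr rfl fun a _ => by ring
  have h2 : ∑ s', |e s'| ≤ M.γ * ∑ s, |e s| := by
    have h3 : ∀ s', |e s'| ≤ M.γ * ∑ s, ∑ a, |e s| * π s a * M.P s a s' := by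
      intro s'
      conv_lhs => rw [h1 s']
      rw [abs_mul, abs_of_pos M.γ_pos]
      refine mul_le_mul_of_nonneg_left ?_ M.γ_pos.le
      refine (Finset.abs_sum_le_sum_abs _ _).trans (Finset.sum_le_sum fun s _ => ?_)
      refine (Finset.abs_sum_le_sum_abs _ _).trans (Finset.sum_le_sum fun a _ => ?_)
      rw [abs_mul, abs_mul, abs_of_nonneg (hπ.1 s a), abs_of_nonneg (M.P_nonneg s a s')]
    refine (Finset.sum_le_sum fun s' _ => h3 s').trans (le_of_eq ?_)
    rw [← Finset.mul_sum, Finset.sum_comm]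
    congr 1
    refine Finset.sum_congr rfl fun s _ => ?_
    rw [Finset.sum_comm]
    simp_rw [← Finset.mul_sum, M.P_sum, mul_one, ← Finset.mul_sum, hπ.2, mul_one]
  have h3 : 0 ≤ ∑ s, |e s| := Finset.sum_nonneg fun s _ => abs_nonneg _
  have h4 : ∑ s, |e s| = 0 := le_antisymm (by nlinarith [M.γ_lt_one]) h3
  funext s
  have := (Finset.sum_eq_zero_iff_of_nonneg fun s _ => abs_nonneg (e s)).1 h4 s
    (Finset.mem_univ s)
  exact sub_eq_zero.1 (abs_eq_zero.1 this)

/-- Values are linear along mixtures of state-action occupancies. -/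
theorem value_mix [DecidableEq S] (M : ConstrainedMDP S A m) {ι : Type*} (I : Finset ι)
    {w : ι → ℝ} (hw : ∑ t ∈ I, w t = 1) {p : ι → S → A → ℝ} (hp : ∀ t ∈ I, IsPolicy (p t))
    {π : S → A → ℝ} (hπ : IsPolicy π)
    (h : ∀ s a, (∑ t ∈ I, w t * M.occ (p t) M.ρ s) * π s a =
      ∑ t ∈ I, w t * (M.occ (p t) M.ρ s * p t s a)) (f : S → A → ℝ) :
    M.value f π = ∑ t ∈ I, w t * M.value f (p t) := by
  have hocc : (fun s => ∑ t ∈ I, w t * M.occ (p t) M.ρ s) = M.occ π M.ρ := by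
    refine M.eq_occ_of_flow hπ M.ρ_nonneg fun s' => ?_
    simp_rw [h, Finset.sum_mul]
    have h1 : ∀ t ∈ I, w t * M.occ (p t) M.ρ s' = w t * M.ρ s' +
        ∑ s, ∑ a, M.γ * (w t * (M.occ (p t) M.ρ s * p t s a) * M.P s a s') := by
      intro t ht
      conv_lhs => rw [M.occ_flow (hp t ht) M.ρ_nonneg]
      rw [mul_add]
      congr 1
      simp_rw [Finset.mul_sum]
      exact Finset.sum_congr rfl fun s _ => Finset.sum_congr rfl fun a _ => by ring
    rw [Finset.sum_congr rfl h1, Finset.sum_add_distrib, ← Finset.sum_mul, hw, one_mul,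
      Finset.sum_comm]
    congr 1
    rw [Finset.mul_sum]
    refine Finset.sum_congr rfl fun s _ => ?_
    rw [Finset.sum_comm, Finset.mul_sum]
    refine Finset.sum_congr rfl fun a _ => ?_
    rw [Finset.mul_sum]
  have h2 : ∀ t ∈ I, w t * M.value f (p t) =
      ∑ s, ∑ a, w t * (M.occ (p t) M.ρ s * p t s a) * f s a := by
    intro t ht
    rw [M.value_eq (hp t ht)]
    simp_rw [Finset.mul_sum]
    exact Finset.sum_congr rfl fun s _ => Finset.sum_congr rfl fun a _ => by ring
  rw [M.value_eq hπ, ← hocc, Finset.sum_congr rfl h2]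
  simp_rw [h, Finset.sum_mul]
  conv_rhs => rw [Finset.sum_comm]
  refine Finset.sum_congr rfl fun s _ => ?_
  rw [Finset.sum_comm]

/-- Every convex combination of values is attained by a policy. -/
theorem exists_policy_value_mix [DecidableEq S] [Nonempty A] (M : ConstrainedMDP S A m)
    {p₁ p₂ : S → A → ℝ} (h₁ : IsPolicy p₁) (h₂ : IsPolicy p₂) {x : ℝ} (hx0 : 0 ≤ x)
    (hx1 : x ≤ 1) : ∃ π, IsPolicy π ∧
      ∀ f, M.value f π = (1 - x) * M.value f p₁ + x * M.value f p₂ := by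
  set w : Bool → ℝ := fun b => if b then x else 1 - x
  set p : Bool → S → A → ℝ := fun b => if b then p₂ else p₁ with hpdef
  have hw : ∀ b, 0 ≤ w b := fun b => by cases b <;> simp [w] <;> linarith
  have hp : ∀ b, IsPolicy (p b) := fun b => by cases b <;> simp [p, h₁, h₂]
  set ν : S → A → ℝ := fun s a => ∑ b, w b * (M.occ (p b) M.ρ s * p b s a) with hν
  have hν0 : ∀ s a, 0 ≤ ν s a := fun s a => Finset.sum_nonneg fun b _ =>
    mul_nonneg (hw b) (mul_nonneg (M.occ_nonneg (hp b) M.ρ_nonneg s) ((hp b).1 s a))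
  have hsum : ∀ s, ∑ a, ν s a = ∑ b, w b * M.occ (p b) M.ρ s := fun s => by
    simp only [hν]
    rw [Finset.sum_comm]
    refine Finset.sum_congr rfl fun b _ => ?_
    rw [← Finset.mul_sum, ← Finset.mul_sum, (hp b).2, mul_one]
  refine ⟨normalizeRows ν, isPolicy_normalizeRows hν0, fun f => ?_⟩
  rw [M.value_mix Finset.univ (w := w) (p := p) (by simp [w]) (fun b _ => hp b)
    (isPolicy_normalizeRows hν0) fun s a => by rw [← hsum, sum_mul_normalizeRows hν0]]
  simp [w, p]
  ring

section Slater

variable [DecidableEq S]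

theorem V0_le (M : ConstrainedMDP S A m) {π : S → A → ℝ} (hπ : IsPolicy π) :
    M.V0 π ≤ M.rmax 0 / (1 - M.γ) := M.value_le hπ fun s a => M.r_le_rmax 0 s a

theorem V0_nonneg (M : ConstrainedMDP S A m) {π : S → A → ℝ} (hπ : IsPolicy π) :
    0 ≤ M.V0 π := M.value_nonneg hπ fun s a => mul_nonneg (hπ.1 s a) (M.r_pos _ _ _).le

theorem V_le (M : ConstrainedMDP S A m) {π : S → A → ℝ} (hπ : IsPolicy π) (i : Fin m) :
    M.V π i ≤ M.rmax i.succ / (1 - M.γ) := M.value_le hπ fun s a => M.r_le_rmax _ s a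

theorem V_nonneg (M : ConstrainedMDP S A m) {π : S → A → ℝ} (hπ : IsPolicy π) (i : Fin m) :
    0 ≤ M.V π i := M.value_nonneg hπ fun s a => mul_nonneg (hπ.1 s a) (M.r_pos _ _ _).le

theorem V0_le_optValue (M : ConstrainedMDP S A m) {π : S → A → ℝ} (hπ : IsPolicy π)
    (hfeas : ∀ i, M.c i ≤ M.V π i) : M.V0 π ≤ M.optValue := by
  refine le_csSup ⟨M.rmax 0 / (1 - M.γ), ?_⟩ ⟨π, hπ, hfeas, rfl⟩
  rintro v ⟨p, hp, -, rfl⟩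
  exact M.V0_le hp

theorem optValue_le (M : ConstrainedMDP S A m) {ξ : ℝ} (hξ : 0 < ξ) (hS : M.Slater ξ) {b : ℝ}
    (h : ∀ π, IsPolicy π → (∀ i, M.c i ≤ M.V π i) → M.V0 π ≤ b) : M.optValue ≤ b := by
  obtain ⟨π, hπ, hs⟩ := hS
  refine csSup_le ⟨_, π, hπ, fun i => by linarith [hs i], rfl⟩ ?_
  rintro v ⟨p, hp, hf, rfl⟩
  exact h p hp hf

/-- Exact penalty property: a policy that violates each constraint by at most `v` exceeds the
optimal value by at most `B v`. It becomes feasible after mixing in the fraction `v / (v + ξ)` of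
the Slater policy. -/
theorem V0_sub_le_optValue [Nonempty A] (M : ConstrainedMDP S A m) {ξ : ℝ} (hξ : 0 < ξ)
    (hS : M.Slater ξ) {π : S → A → ℝ} (hπ : IsPolicy π) {v : ℝ} (hv : 0 ≤ v)
    (hviol : ∀ i, M.c i - M.V π i ≤ v) :
    M.V0 π - M.radius ξ * v ≤ M.optValue := by
  obtain ⟨p, hp, hs⟩ := hS
  have hg : 0 < 1 - M.γ := sub_pos.2 M.γ_lt_one
  have hvx : 0 < v + ξ := by linarith
  obtain ⟨π', hπ', hval⟩ := M.exists_policy_value_mix hπ hp (x := v / (v + ξ))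
    (by positivity) ((div_le_one hvx).2 (by linarith))
  have hone : 1 - v / (v + ξ) = ξ / (v + ξ) := by
    field_simp
    ring
  have h1 : M.V0 π' ≤ M.optValue := by
    refine M.V0_le_optValue hπ' fun i => ?_
    have h2 : M.V π' i = ξ / (v + ξ) * M.V π i + v / (v + ξ) * M.V p i := by
      rw [← hone]
      exact hval _
    have h3 : ξ / (v + ξ) * (M.c i - v) + v / (v + ξ) * (M.c i + ξ) = M.c i := by
      field_simp
      ring
    rw [h2, ← h3]
    refine add_le_add (mul_le_mul_of_nonneg_left ?_ (by positivity))
      (mul_le_mul_of_nonneg_left (hs i) (by positivity))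
    linarith [hviol i]
  have h4 : M.V0 π' = (1 - v / (v + ξ)) * M.V0 π + v / (v + ξ) * M.V0 p := hval _
  have h5 : v / (v + ξ) * M.V0 π ≤ M.radius ξ * v := by
    have h6 : M.radius ξ * v = v / ξ * (M.rmax 0 / (1 - M.γ)) := by
      rw [radius]
      field_simp
    rw [h6]
    exact mul_le_mul (div_le_div_of_nonneg_left hv hξ (by linarith)) (M.V0_le hπ)
      (M.V0_nonneg hπ) (by positivity)
  have h7 : 0 ≤ v / (v + ξ) * M.V0 p := mul_nonneg (by positivity) (M.V0_nonneg hp)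
  linarith

theorem entropy_nonneg (M : ConstrainedMDP S A m) {π : S → A → ℝ} (hπ : IsPolicy π) :
    0 ≤ M.entropy π := by
  rw [entropy, M.value_eq hπ, ← Finset.sum_neg_distrib]
  refine Finset.sum_nonneg fun s _ => ?_
  rw [← Finset.sum_neg_distrib]
  refine Finset.sum_nonneg fun a _ => ?_
  have h1 : π s a ≤ 1 := by
    rw [← hπ.2 s]
    exact Finset.single_le_sum (fun a _ => hπ.1 s a) (Finset.mem_univ a)
  rw [← mul_neg]
  exact mul_nonneg (mul_nonneg (M.occ_nonneg hπ M.ρ_nonneg s) (hπ.1 s a))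
    (neg_nonneg.2 (Real.log_nonpos (hπ.1 s a) h1))

theorem entropy_le [Nonempty A] (M : ConstrainedMDP S A m) {π : S → A → ℝ} (hπ : IsPolicy π) :
    M.entropy π ≤ Real.log (Fintype.card A) / (1 - M.γ) := by
  have h : ∀ s, -∑ a, M.occ π M.ρ s * π s a * Real.log (π s a) ≤
      M.occ π M.ρ s * Real.log (Fintype.card A) := by
    intro s
    have h1 := sum_mul_sub_log_le one_pos (hπ.1 s) (hπ.2 s) fun _ => 0
    rw [softMaximum_zero, one_mul] at h1
    have h2 := mul_le_mul_of_nonneg_left h1 (M.occ_nonneg hπ M.ρ_nonneg s)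
    refine le_trans (le_of_eq ?_) h2
    rw [Finset.mul_sum, ← Finset.sum_neg_distrib]
    exact Finset.sum_congr rfl fun a _ => by ring
  rw [entropy, M.value_eq hπ, ← Finset.sum_neg_distrib]
  refine (Finset.sum_le_sum fun s _ => h s).trans (le_of_eq ?_)
  rw [← Finset.sum_mul, M.occ_sum hπ M.ρ_nonneg, M.ρ_sum]
  ring

end Slater

end ConstrainedMDP

/-! ### The accelerated gradient step -/

/-- A minimizer over the box of a function with a quadratic expansion of curvature `κ` satisfies
the three-point inequality. -/
theorem three_point_of_isMinOn {m : ℕ} {B κ : ℝ} {h : (Fin m → ℝ) → ℝ} {x A : Fin m → ℝ}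
    (hx : x ∈ dualBox m B) (hmin : IsMinOn h (dualBox m B) x)
    (hexp : ∀ l, h l = h x + ∑ i, A i * (l i - x i) + κ * ∑ i, (l i - x i) ^ 2)
    {l : Fin m → ℝ} (hl : l ∈ dualBox m B) : h x + κ * ∑ i, (l i - x i) ^ 2 ≤ h l := by
  set a := ∑ i, A i * (l i - x i) with ha
  set b := κ * ∑ i, (l i - x i) ^ 2 with hb
  have key : ∀ s : ℝ, 0 < s → s ≤ 1 → 0 ≤ a + s * b := by
    intro s hs0 hs1
    have hmem : (fun i => x i + s * (l i - x i)) ∈ dualBox m B := fun i => by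
      have := hx i
      have := hl i
      constructor <;> nlinarith
    have h1 := hmin hmem
    simp only [Set.mem_ofPred_eq] at h1
    rw [hexp fun i => x i + s * (l i - x i)] at h1
    have h2 : ∑ i, A i * (x i + s * (l i - x i) - x i) = s * a := by
      rw [ha, Finset.mul_sum]
      exact Finset.sum_congr rfl fun i _ => by ring
    have h3 : κ * ∑ i, (x i + s * (l i - x i) - x i) ^ 2 = s * (s * b) := by
      rw [hb, Finset.mul_sum, Finset.mul_sum, Finset.mul_sum, Finset.mul_sum]
      exact Finset.sum_congr rfl fun i _ => by ring
    rw [h2, h3] at h1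
    have h4 : 0 ≤ s * (a + s * b) := by linarith
    exact nonneg_of_mul_nonneg_right h4 hs0
  have ha0 : 0 ≤ a := by
    by_contra hneg
    push Not at hneg
    have h1 := key 1 one_pos le_rfl
    have hb0 : 0 < b := by linarith
    have h2 := key (-a / (2 * b)) (by apply div_pos <;> linarith)
      ((div_le_one (by linarith)).2 (by linarith))
    have h3 : -a / (2 * b) * b = -a / 2 := by field_simp
    rw [h3] at h2
    linarith
  rw [hexp l]
  linarith

/-- The one-dimensional inequality behind acceleration: with the extrapolation weights
`(1 + α) y = z + α x`, the quadratic upper model at the averaged point `(1 - α) z + α x'` is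
dominated by the average of the lower models plus the proximal term. -/
theorem accelerated_coordinate {α μ g x x' y z : ℝ} (hα0 : 0 < α) (hα1 : α < 1) (hμ : 0 < μ)
    (hy : (1 + α) * y = z + α * x) :
    g * ((1 - α) * z + α * x') + μ / (4 * α ^ 2) * ((1 - α) * z + α * x' - y) ^ 2 ≤
      (1 - α) * (g * z + μ / 2 * (z - y) ^ 2) + α * (g * x' + μ / 2 * (x' - y) ^ 2) +
        μ * (1 - α) / 2 * (x' - x) ^ 2 := by
  have hz : z = (1 + α) * y - α * x := by linarith
  have h1 : (1 - α) * z + α * x' - y = α * (α * (x' - y) + (1 - α) * (x' - x)) := by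
    rw [hz]
    ring
  have h2 : μ / (4 * α ^ 2) * (α * (α * (x' - y) + (1 - α) * (x' - x))) ^ 2 =
      μ / 4 * (α * (x' - y) + (1 - α) * (x' - x)) ^ 2 := by
    field_simp
  have h3 : (α * (x' - y) + (1 - α) * (x' - x)) ^ 2 ≤
      α * (x' - y) ^ 2 + (1 - α) * (x' - x) ^ 2 := by
    have : α * (x' - y) ^ 2 + (1 - α) * (x' - x) ^ 2 -
        (α * (x' - y) + (1 - α) * (x' - x)) ^ 2 = α * (1 - α) * (x - y) ^ 2 := by ring
    have : 0 ≤ α * (1 - α) * (x - y) ^ 2 :=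
      mul_nonneg (mul_nonneg hα0.le (by linarith)) (sq_nonneg _)
    linarith
  rw [h1, h2]
  have h4 := mul_le_mul_of_nonneg_left h3 (by positivity : 0 ≤ μ / 4)
  have h5 : 0 ≤ (1 - α) * (μ / 2 * (z - y) ^ 2) := mul_nonneg (by linarith) (by positivity)
  have h6 : 0 ≤ μ * (α * (x' - y) ^ 2) := by positivity
  have h7 : 0 ≤ μ * ((1 - α) * (x' - x) ^ 2) :=
    mul_nonneg hμ.le (mul_nonneg (by linarith) (sq_nonneg _))
  nlinarith

/-- One step of the accelerated projected gradient method. The quadratic with data `f₀`, `g`, `y`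
bounds `D` from below at the previous average `z`; with its curvature raised to `μ / (2 α²)` it
bounds `D` from above, up to the inexactness `e`, at the new average. -/
theorem accelerated_step {m : ℕ} {B α μ e f₀ : ℝ} {D : (Fin m → ℝ) → ℝ}
    {g x x' y z : Fin m → ℝ} (hα0 : 0 < α) (hα1 : α < 1) (hμ : 0 < μ)
    (hy : ∀ i, (1 + α) * y i = z i + α * x i) (hx' : x' ∈ dualBox m B)
    (hmin : IsMinOn (fun l => α / (μ * (1 - α)) * (∑ i, g i * l i + μ / 2 * ∑ i, (l i - y i) ^ 2)
      + 1 / 2 * ∑ i, (l i - x i) ^ 2) (dualBox m B) x')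
    (hlow : f₀ + ∑ i, g i * z i + μ / 2 * ∑ i, (z i - y i) ^ 2 ≤ D z)
    (hup : D ((1 - α) • z + α • x') ≤ f₀ + ∑ i, g i * ((1 - α) • z + α • x') i +
      μ / (4 * α ^ 2) * ∑ i, (((1 - α) • z + α • x') i - y i) ^ 2 + e)
    {l : Fin m → ℝ} (hl : l ∈ dualBox m B) :
    D ((1 - α) • z + α • x') + μ / 2 * ∑ i, (l i - x' i) ^ 2 ≤
      (1 - α) * (D z + μ / 2 * ∑ i, (l i - x i) ^ 2) +
        α * (f₀ + ∑ i, g i * l i + μ / 2 * ∑ i, (l i - y i) ^ 2) + e := by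
  have h1α : 0 < 1 - α := by linarith
  have h3 := three_point_of_isMinOn (κ := α / (μ * (1 - α)) * (μ / 2) + 1 / 2)
    (A := fun i => α / (μ * (1 - α)) * (g i + μ * (x' i - y i)) + (x' i - x i)) hx' hmin
    (fun l => by
      simp only [Finset.mul_sum]
      simp only [← Finset.sum_add_distrib, Finset.mul_sum]
      exact Finset.sum_congr rfl fun i _ => by ring) hl
  have h4 := Finset.sum_le_sum fun i (_ : i ∈ Finset.univ) =>
    accelerated_coordinate (g := g i) (x' := x' i) hα0 hα1 hμ (hy i)
  simp only [Finset.sum_add_distrib, ← Finset.mul_sum] at h4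
  simp only [Pi.add_apply, Pi.smul_apply, smul_eq_mul] at hup
  set Gl := ∑ i, g i * l i
  set Gx := ∑ i, g i * x' i
  set Yl := ∑ i, (l i - y i) ^ 2
  set Yx := ∑ i, (x' i - y i) ^ 2
  set Xl := ∑ i, (l i - x i) ^ 2
  set Xx := ∑ i, (x' i - x i) ^ 2
  set N := ∑ i, (l i - x' i) ^ 2
  -- multiplying the three-point inequality by `μ (1 - α)` clears the step size
  have h5 := mul_le_mul_of_nonneg_left h3 (mul_pos hμ h1α).le
  have e1 : μ * (1 - α) * (α / (μ * (1 - α)) * (Gx + μ / 2 * Yx) + 1 / 2 * Xx +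
      (α / (μ * (1 - α)) * (μ / 2) + 1 / 2) * N) =
      α * (Gx + μ / 2 * Yx) + μ * (1 - α) / 2 * Xx + μ / 2 * N := by
    field_simp
    ring
  have e2 : μ * (1 - α) * (α / (μ * (1 - α)) * (Gl + μ / 2 * Yl) + 1 / 2 * Xl) =
      α * (Gl + μ / 2 * Yl) + μ * (1 - α) / 2 * Xl := by
    field_simp
  rw [e1, e2] at h5
  have h6 := mul_le_mul_of_nonneg_left hlow h1α.le
  linarith

/-- Unrolling the contraction of the accelerated method. -/
theorem le_of_contraction {α e : ℝ} (hα0 : 0 < α) (hα1 : α < 1) {u F : ℕ → ℝ}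
    (h : ∀ t, u (t + 1) ≤ (1 - α) * u t + α * F (t + 1) + e) (he : 0 ≤ e) (T : ℕ) :
    u T ≤ (1 - α) ^ T * u 0 + ∑ t ∈ Finset.Icc 1 T, α * (1 - α) ^ (T - t) * F t + e / α := by
  induction T with
  | zero =>
    simp
    positivity
  | succ T ih =>
    have h1 := mul_le_mul_of_nonneg_left ih (by linarith : 0 ≤ 1 - α)
    rw [Finset.sum_Icc_succ_top (by omega), Nat.sub_self, pow_zero]
    have h2 : ∑ t ∈ Finset.Icc 1 T, α * (1 - α) ^ (T + 1 - t) * F t =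
        (1 - α) * ∑ t ∈ Finset.Icc 1 T, α * (1 - α) ^ (T - t) * F t := by
      rw [Finset.mul_sum]
      refine Finset.sum_congr rfl fun t ht => ?_
      rw [Nat.succ_sub (Finset.mem_Icc.1 ht).2, pow_succ]
      ring
    rw [h2]
    have h3 : (1 - α) * (e / α) + e = e / α := by
      field_simp
      ring
    rw [pow_succ]
    linarith [h T]

namespace ConstrainedMDP

/-- The output weights are the unrolled weights of the accelerated method, with the weight
`(1 - α) ^ T` of the initial point moved to the first iterate. -/
theorem sum_outputWeight_mul (α : ℝ) {T : ℕ} (hT : 1 ≤ T) (F : ℕ → ℝ) :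
    ∑ t ∈ Finset.Icc 1 T, outputWeight α T t * F t =
      ∑ t ∈ Finset.Icc 1 T, α * (1 - α) ^ (T - t) * F t + (1 - α) ^ T * F 1 := by
  have h : ∀ t ∈ Finset.Icc 1 T, outputWeight α T t * F t =
      α * (1 - α) ^ (T - t) * F t + if t = 1 then (1 - α) ^ T * F 1 else 0 := by
    intro t _
    rw [outputWeight]
    split_ifs with h1
    · subst h1
      obtain ⟨n, rfl⟩ := Nat.exists_eq_add_of_le' hT
      rw [Nat.add_sub_cancel, pow_succ]
      ring
    · ring
  rw [Finset.sum_congr rfl h, Finset.sum_add_distrib, Finset.sum_ite_eq' (Finset.Icc 1 T) 1,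
    if_pos (Finset.mem_Icc.2 ⟨le_rfl, hT⟩)]

theorem sum_outputWeight (α : ℝ) {T : ℕ} (hT : 1 ≤ T) :
    ∑ t ∈ Finset.Icc 1 T, outputWeight α T t = 1 := by
  have h := sum_outputWeight_mul α hT fun _ => 1
  simp only [mul_one] at h
  rw [h]
  clear h hT
  induction T with
  | zero => simp
  | succ T ih =>
    rw [Finset.sum_Icc_succ_top (by omega), Nat.sub_self, pow_zero]
    have h2 : ∑ t ∈ Finset.Icc 1 T, α * (1 - α) ^ (T + 1 - t) =
        (1 - α) * ∑ t ∈ Finset.Icc 1 T, α * (1 - α) ^ (T - t) := by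
      rw [Finset.mul_sum]
      refine Finset.sum_congr rfl fun t ht => ?_
      rw [Nat.succ_sub (Finset.mem_Icc.1 ht).2, pow_succ]
      ring
    rw [h2, pow_succ]
    linear_combination (1 - α) * ih

theorem outputWeight_nonneg {α : ℝ} (hα0 : 0 ≤ α) (hα1 : α ≤ 1) (T t : ℕ) :
    0 ≤ outputWeight α T t := by
  have : 0 ≤ 1 - α := by linarith
  rw [outputWeight]
  split_ifs <;> positivity

end ConstrainedMDP

/-! ### Approximate saddle points from AR-CPO -/

namespace ConstrainedMDP

variable {S A : Type*} [Fintype S] [DecidableEq S] [Fintype A] {m : ℕ}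

theorem dualBox_combination {B x : ℝ} (hx0 : 0 ≤ x) (hx1 : x ≤ 1) {l l' : Fin m → ℝ}
    (hl : l ∈ dualBox m B) (hl' : l' ∈ dualBox m B) : (1 - x) • l + x • l' ∈ dualBox m B := by
  intro i
  have := hl i
  have := hl' i
  simp only [Pi.add_apply, Pi.smul_apply, smul_eq_mul]
  constructor <;> nlinarith

theorem zero_mem_dualBox {B : ℝ} (hB : 0 ≤ B) : (0 : Fin m → ℝ) ∈ dualBox m B :=
  fun _ => ⟨le_rfl, by simpa using hB⟩

/-- The regularized Lagrangian of a fixed policy is its own quadratic expansion in the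
multiplier. -/
theorem regLagrangian_expand (M : ConstrainedMDP S A m) (τ μ : ℝ) (π : S → A → ℝ)
    (l y : Fin m → ℝ) : M.regLagrangian τ μ π l =
      (M.V0 π + τ * M.entropy π - μ / 2 * ∑ i, y i ^ 2) +
        ∑ i, (M.V π i - M.c i + μ * y i) * l i + μ / 2 * ∑ i, (l i - y i) ^ 2 := by
  have h : ∑ i, (M.V π i - M.c i + μ * y i) * l i + μ / 2 * ∑ i, (l i - y i) ^ 2 =
      ∑ i, l i * (M.V π i - M.c i) + μ / 2 * ∑ i, l i ^ 2 + μ / 2 * ∑ i, y i ^ 2 := by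
    simp_rw [Finset.mul_sum, ← Finset.sum_add_distrib]
    exact Finset.sum_congr rfl fun i _ => by ring
  rw [regLagrangian]
  linarith

/-- The extrapolation point `(1 - q) \bar λ + q λ` after `t` iterations. -/
noncomputable def extrapolation [DecidableEq A] (M : ConstrainedMDP S A m)
    (p : ARCPOParams) (o : RegPO) (t : ℕ) : Fin m → ℝ :=
  (1 - p.q) • (M.arcpo p o t).lamBar + p.q • (M.arcpo p o t).lam

theorem arcpo_mem_dualBox [DecidableEq A] (M : ConstrainedMDP S A m) {p : ARCPOParams}
    (hB : 0 ≤ p.B) (hα0 : 0 ≤ p.α) (hα1 : p.α ≤ 1) (o : RegPO) (t : ℕ) :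
    (M.arcpo p o t).lam ∈ dualBox m p.B ∧ (M.arcpo p o t).lamBar ∈ dualBox m p.B := by
  induction t with
  | zero => exact ⟨zero_mem_dualBox hB, zero_mem_dualBox hB⟩
  | succ t ih =>
    have h : (M.arcpo p o (t + 1)).lam ∈ dualBox m p.B :=
      (argminOn_dualBox_spec _ (by fun_prop) hB).1
    exact ⟨h, dualBox_combination hα0 hα1 ih.2 h⟩

theorem arcpo_queries_le [DecidableEq A] (M : ConstrainedMDP S A m) (p : ARCPOParams)
    (o : RegPO) (t : ℕ) :
    (M.arcpo p o t).queries ≤ t * (M.innerIters p.B p.δ p.τ + 2) := by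
  induction t with
  | zero => simp [arcpo]
  | succ t ih =>
    have h := M.regPO_queries_le p.B p.δ p.τ (M.extrapolation p o t) o
    change (M.arcpo p o t).queries +
      (M.regPO p.B p.δ p.τ (M.extrapolation p o t) o).queries + 1 ≤ _
    rw [Nat.succ_mul]
    omega

variable [Nonempty A]

/-- The loss in the Lagrangian at `l` from replacing the softmax-optimal policy for `y` by an
approximation of it. -/
theorem regLagrangian_sub_le_of_close (M : ConstrainedMDP S A m) {B τ μ x : ℝ} (hB : 0 ≤ B)
    (hτ : 0 < τ) (hx : 0 ≤ x) {l y : Fin m → ℝ} (hl : l ∈ dualBox m B) (hy : y ∈ dualBox m B)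
    {Q X : S × A → ℝ} (hQ : M.softBellman τ y Q = Q) {π : S → A → ℝ} (hπ : IsPolicy π)
    (hX : ∀ s, M.Reach s → π s = softmaxPolicy (fun x => X x / τ) s ∧
      ∀ a, |X (s, a) - Q (s, a)| ≤ x * τ) :
    M.regLagrangian τ μ (softmaxPolicy fun x => Q x / τ) l - M.regLagrangian τ μ π l ≤
      2 * x * τ / (1 - M.γ) + 2 * B * (m * M.Rmax) * x / (1 - M.γ) ^ 2 := by
  set p := softmaxPolicy fun x => Q x / τ with hp
  have hpp : IsPolicy p := isPolicy_softmaxPolicy _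
  have hg : 0 < 1 - M.γ := sub_pos.2 M.γ_lt_one
  have hdiv : ∀ s, M.Reach s → ∀ a, |X (s, a) / τ - Q (s, a) / τ| ≤ x := by
    intro s hs a
    rw [← sub_div, abs_div, abs_of_pos hτ, div_le_iff₀ hτ]
    exact (hX s hs).2 a
  have hkl : ∀ s, M.occ π M.ρ s * klAt π p s ≤ M.occ π M.ρ s * (2 * x) := by
    intro s
    have hocc := M.occ_nonneg hπ M.ρ_nonneg s
    rcases hocc.eq_or_lt with h0 | h0
    · simp [← h0]
    have hs := M.reach_of_occ_pos h0
    refine mul_le_mul_of_nonneg_left ?_ hocc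
    have h1 : klAt π p s ≤ ∑ a, π s a * (2 * x) := by
      refine Finset.sum_le_sum fun a _ => mul_le_mul_of_nonneg_left ?_ (hπ.1 s a)
      rw [(hX s hs).1]
      exact (le_abs_self _).trans (abs_log_softmaxDist_sub_le (hdiv s hs) a)
    rwa [← Finset.sum_mul, hπ.2, one_mul] at h1
  have h1 : M.regValue τ y p - M.regValue τ y π ≤ 2 * x * τ / (1 - M.γ) := by
    rw [M.regValue_softmax hτ.ne' hQ, M.regValue_eq_sub_kl hτ.ne' hQ hπ, sub_sub_cancel]
    have h2 := Finset.sum_le_sum fun s (_ : s ∈ Finset.univ) => hkl s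
    rw [← Finset.sum_mul, M.occ_sum hπ M.ρ_nonneg, M.ρ_sum] at h2
    refine (mul_le_mul_of_nonneg_left h2 hτ.le).trans (le_of_eq ?_)
    ring
  have hV : ∀ i, |M.V π i - M.V p i| ≤ x * M.rmax i.succ / (1 - M.γ) ^ 2 := by
    intro i
    refine M.abs_value_sub_le_of_le hpp hπ (fun s a => (M.r_pos _ s a).le)
      (fun s a => M.r_le_rmax _ s a) (M.rmax_pos _).le fun s hs => ?_
    have hr := M.reach_of_occ_pos hs
    rw [(hX s hr).1]
    exact sum_abs_softmaxDist_sub_le (k := 0) fun a => by simpa using hdiv s hr a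
  have h2 : M.regLagrangian τ μ p l - M.regLagrangian τ μ π l =
      (M.regValue τ y p - M.regValue τ y π) + ∑ i, (l i - y i) * (M.V p i - M.V π i) := by
    have e : ∑ i, (l i - y i) * (M.V p i - M.V π i) =
        (∑ i, l i * M.V p i - ∑ i, l i * M.V π i) -
          (∑ i, y i * M.V p i - ∑ i, y i * M.V π i) := by
      simp_rw [← Finset.sum_sub_distrib]
      exact Finset.sum_congr rfl fun i _ => by ring
    rw [e, M.regLagrangian_eq τ μ l hpp, M.regLagrangian_eq τ μ l hπ]
    simp only [regValue, M.value_rLam _ hpp, M.value_rLam _ hπ]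
    ring
  have h3 : ∑ i, (l i - y i) * (M.V p i - M.V π i) ≤
      2 * B * (m * M.Rmax) * x / (1 - M.γ) ^ 2 := by
    have h4 : ∀ i, (l i - y i) * (M.V p i - M.V π i) ≤
        2 * B * x / (1 - M.γ) ^ 2 * M.rmax i.succ := by
      intro i
      refine (le_abs_self _).trans ?_
      rw [abs_mul, abs_sub_comm (M.V p i)]
      have h5 : |l i - y i| ≤ 2 * B := by
        rw [abs_le]
        constructor <;> linarith [(hl i).1, (hl i).2, (hy i).1, (hy i).2]
      refine (mul_le_mul h5 (hV i) (abs_nonneg _) (by linarith)).trans (le_of_eq ?_)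
      ring
    refine (Finset.sum_le_sum fun i _ => h4 i).trans ?_
    rw [← Finset.mul_sum]
    refine (mul_le_mul_of_nonneg_left M.sum_rmax_le (by positivity)).trans (le_of_eq ?_)
    ring
  linarith

/-- Testing the saddle point inequality at `0` and at `2 B` on the violated constraints bounds the
optimality gap and, by the exact penalty property, the violation. -/
theorem isEpsOptimal_of_lagrangian (M : ConstrainedMDP S A m) {ξ ε E : ℝ} (hξ : 0 < ξ)
    (hS : M.Slater ξ) {π : S → A → ℝ} (hπ : IsPolicy π) (hE : E ≤ ε)
    (hE' : E ≤ M.radius ξ * ε)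
    (h : ∀ l ∈ dualBox m (M.radius ξ),
      M.optValue ≤ M.V0 π + ∑ i, l i * (M.V π i - M.c i) + E) : M.IsEpsOptimal ε π := by
  have hB := M.radius_pos hξ
  refine ⟨hπ, ?_, ?_⟩
  · have h1 := h 0 (zero_mem_dualBox hB.le)
    simp only [Pi.zero_apply, zero_mul, Finset.sum_const_zero] at h1
    linarith
  · set v := ∑ i, max 0 (M.c i - M.V π i) with hv
    have hv0 : 0 ≤ v := Finset.sum_nonneg fun i _ => le_max_left _ _
    have h1 := h (fun i => if M.V π i < M.c i then 2 * M.radius ξ else 0) fun i => by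
      dsimp only
      split_ifs <;> constructor <;> linarith
    have h2 : ∑ i, (if M.V π i < M.c i then 2 * M.radius ξ else 0) * (M.V π i - M.c i) =
        -(2 * M.radius ξ * v) := by
      rw [hv, Finset.mul_sum, ← Finset.sum_neg_distrib]
      refine Finset.sum_congr rfl fun i _ => ?_
      split_ifs with hi
      · rw [max_eq_right (by linarith)]
        ring
      · rw [max_eq_left (by linarith)]
        ring
    rw [h2] at h1
    have h3 := M.V0_sub_le_optValue hξ hS hπ hv0 fun i => (le_max_right 0 _).trans
      (Finset.single_le_sum (f := fun i => max 0 (M.c i - M.V π i))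
        (fun i _ => le_max_left _ _) (Finset.mem_univ i))
    have h4 : M.radius ξ * v ≤ M.radius ξ * ε := by linarith
    exact le_of_mul_le_mul_left h4 hB

section Iterates

variable [DecidableEq A]

theorem isPolicy_arcpo (M : ConstrainedMDP S A m) (p : ARCPOParams) (o : RegPO) {t : ℕ}
    (ht : 1 ≤ t) : IsPolicy (M.arcpo p o t).pol := by
  obtain ⟨t, rfl⟩ := Nat.exists_eq_add_of_le' ht
  exact M.isPolicy_regPO _ _ _ _ o

theorem outputVisitation_nonneg (M : ConstrainedMDP S A m) {p : ARCPOParams} (hα0 : 0 ≤ p.α)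
    (hα1 : p.α ≤ 1) (o : RegPO) (T : ℕ) (s : S) (a : A) : 0 ≤ M.outputVisitation p o T s a := by
  refine Finset.sum_nonneg fun t ht => mul_nonneg (outputWeight_nonneg hα0 hα1 _ _) ?_
  have hpol := M.isPolicy_arcpo p o (Finset.mem_Icc.1 ht).1
  rw [visitation_eq]
  exact mul_nonneg (sub_pos.2 M.γ_lt_one).le
    (mul_nonneg (M.occ_nonneg hpol M.ρ_nonneg s) (hpol.1 s a))

theorem isPolicy_arcpoOutput (M : ConstrainedMDP S A m) {p : ARCPOParams} (hα0 : 0 ≤ p.α)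
    (hα1 : p.α ≤ 1) (o : RegPO) (T : ℕ) : IsPolicy (M.arcpoOutput p o T) :=
  isPolicy_normalizeRows (M.outputVisitation_nonneg hα0 hα1 o T)

/-- The values of the output policy are the weighted averages of the values of the iterates. -/
theorem value_arcpoOutput (M : ConstrainedMDP S A m) {p : ARCPOParams} (hα0 : 0 ≤ p.α)
    (hα1 : p.α ≤ 1) (o : RegPO) {T : ℕ} (hT : 1 ≤ T) (f : S → A → ℝ) :
    M.value f (M.arcpoOutput p o T) =
      ∑ t ∈ Finset.Icc 1 T, outputWeight p.α T t * M.value f (M.arcpo p o t).pol := by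
  have hg : 0 < 1 - M.γ := sub_pos.2 M.γ_lt_one
  have hpol : ∀ t ∈ Finset.Icc 1 T, IsPolicy (M.arcpo p o t).pol := fun t ht =>
    M.isPolicy_arcpo p o (Finset.mem_Icc.1 ht).1
  refine M.value_mix _ (sum_outputWeight p.α hT) hpol (M.isPolicy_arcpoOutput hα0 hα1 o T)
    (fun s a => ?_) f
  have h := sum_mul_normalizeRows (M.outputVisitation_nonneg hα0 hα1 o T) s a
  change _ * M.arcpoOutput p o T s a = _ at h
  have h1 : ∀ a, M.outputVisitation p o T s a = (1 - M.γ) * ∑ t ∈ Finset.Icc 1 T,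
      outputWeight p.α T t * (M.occ (M.arcpo p o t).pol M.ρ s * (M.arcpo p o t).pol s a) := by
    intro a
    rw [outputVisitation, Finset.mul_sum]
    refine Finset.sum_congr rfl fun t _ => ?_
    rw [visitation_eq]
    ring
  have h2 : ∑ a, M.outputVisitation p o T s a = (1 - M.γ) * ∑ t ∈ Finset.Icc 1 T,
      outputWeight p.α T t * M.occ (M.arcpo p o t).pol M.ρ s := by
    simp_rw [h1]
    rw [← Finset.mul_sum, Finset.sum_comm]
    congr 1
    refine Finset.sum_congr rfl fun t ht => ?_
    rw [← Finset.mul_sum, ← Finset.mul_sum, (hpol t ht).2, mul_one]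
  rw [h2, h1, mul_assoc] at h
  exact mul_left_cancel₀ hg.ne' h

end Iterates

section SaddlePoint

variable [DecidableEq A]

/-- A bound for the soft-optimal value functions over the box. It also bounds the initial gap of
the outer iteration. -/
noncomputable def softBound (M : ConstrainedMDP S A m) (B τ : ℝ) : ℝ :=
  (M.rmax 0 + 2 * B * (m * M.Rmax) + τ * Real.log (Fintype.card A)) / (1 - M.γ)

/-- The error caused in the upper model by an inner accuracy `x`. -/
noncomputable def innerError (M : ConstrainedMDP S A m) (B τ x : ℝ) : ℝ :=
  2 * x * τ / (1 - M.γ) + 2 * B * (m * M.Rmax) * x / (1 - M.γ) ^ 2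

/-- The convergence of AR-CPO in terms of the Lagrangians of its iterates. The witnesses are the
last averaged multiplier `lb` and the maximizer `p₀` of the regularized value at the multiplier
`0`. -/
theorem exists_lagrangian_bound (M : ConstrainedMDP S A m) {ξ C β τ μ δ x : ℝ} (hξ : 0 < ξ)
    (hC : 1 / 2 ≤ C) (hβ₀ : 0 < β) (hβ₁ : β < 1) (hτ : 0 < τ) (hμ : 0 < μ) (hx : 0 ≤ x)
    (herg : M.ErgodicAssumption C β (M.radius ξ) τ μ)
    (hinner : M.γ ^ M.innerIters (M.radius ξ) δ τ * M.softBound (M.radius ξ) τ ≤ x * τ)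
    (o : RegPO) (T : ℕ) :
    ∃ (lb : Fin m → ℝ) (p₀ : S → A → ℝ), lb ∈ dualBox m (M.radius ξ) ∧ IsPolicy p₀ ∧
      ∀ π, IsPolicy π → ∀ l ∈ dualBox m (M.radius ξ),
        M.regLagrangian τ μ π lb ≤
          (1 - (M.params ξ C β τ μ δ).α) ^ T *
            (M.regLagrangian τ μ p₀ 0 + μ / 2 * ∑ i, l i ^ 2) +
          ∑ t ∈ Finset.Icc 1 T,
            (M.params ξ C β τ μ δ).α * (1 - (M.params ξ C β τ μ δ).α) ^ (T - t) *
              M.regLagrangian τ μ (M.arcpo (M.params ξ C β τ μ δ) o t).pol l +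
          M.innerError (M.radius ξ) τ x / (M.params ξ C β τ μ δ).α := by
  have hg : 0 < 1 - M.γ := sub_pos.2 M.γ_lt_one
  have hB : 0 ≤ M.radius ξ := (M.radius_pos hξ).le
  have hL := Lnu_pos hC hβ₀ hβ₁
  have hLd : μ ≤ M.Ld C β τ μ := by
    rw [Ld]
    have : 0 ≤ 2 * M.Rmax ^ 2 * Lnu C β / ((1 - M.γ) ^ 2 * τ) := by positivity
    linarith
  have hLd0 : 0 < M.Ld C β τ μ := hμ.trans_le hLd
  set p := M.params ξ C β τ μ δ with hp
  set α := p.α with hα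
  have hαsq : α ^ 2 = μ / (2 * M.Ld C β τ μ) := Real.sq_sqrt (by positivity)
  have hα0 : 0 < α := Real.sqrt_pos.2 (by positivity)
  have hα1 : α < 1 := by
    have h1 : α ^ 2 ≤ 1 / 2 := by
      rw [hαsq, div_le_div_iff₀ (by positivity) two_pos]
      linarith
    nlinarith
  have hq : p.q = α / (1 + α) := by
    have h1 : μ / M.Ld C β τ μ = 2 * α ^ 2 := by
      rw [hαsq]
      field_simp
    change (2 * α - μ / M.Ld C β τ μ) / (2 - μ / M.Ld C β τ μ) = _
    rw [h1, div_eq_div_iff (by nlinarith) (by positivity)]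
    ring
  have hq0 : 0 ≤ p.q := by rw [hq]; positivity
  have hq1 : p.q ≤ 1 := by
    rw [hq, div_le_one (by positivity)]
    linarith
  choose Q hQ using fun l : Fin m → ℝ => M.exists_softBellman_eq_self (A := A) hτ l
  set D : (Fin m → ℝ) → ℝ := fun l =>
    M.regLagrangian τ μ (softmaxPolicy fun x => Q l x / τ) l with hD
  have hDmax : ∀ π, IsPolicy π → ∀ l, M.regLagrangian τ μ π l ≤ D l := by
    intro π hπ l
    simp only [hD]
    rw [M.regLagrangian_eq τ μ l hπ, M.regLagrangian_eq τ μ l (isPolicy_softmaxPolicy _)]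
    linarith [M.regValue_le_softmax hτ (hQ l) hπ]
  have hmem := fun t => M.arcpo_mem_dualBox (p := p) hB hα0.le hα1.le o t
  have hymem : ∀ t, M.extrapolation p o t ∈ dualBox m (M.radius ξ) := fun t =>
    dualBox_combination hq0 hq1 (hmem t).2 (hmem t).1
  have he0 : 0 ≤ M.innerError (M.radius ξ) τ x := by
    have := M.Rmax_nonneg
    rw [innerError]
    positivity
  refine ⟨(M.arcpo p o T).lamBar, softmaxPolicy fun x => Q 0 x / τ, (hmem T).2,
    isPolicy_softmaxPolicy _, fun π hπ l hl => ?_⟩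
  have hstep : ∀ t, D (M.arcpo p o (t + 1)).lamBar +
      μ / 2 * ∑ i, (l i - (M.arcpo p o (t + 1)).lam i) ^ 2 ≤
      (1 - α) * (D (M.arcpo p o t).lamBar + μ / 2 * ∑ i, (l i - (M.arcpo p o t).lam i) ^ 2) +
        α * M.regLagrangian τ μ (M.arcpo p o (t + 1)).pol l +
          M.innerError (M.radius ξ) τ x := by
    intro t
    set y := M.extrapolation p o t with hy
    set pol := (M.arcpo p o (t + 1)).pol with hpol
    have hpp : IsPolicy pol := M.isPolicy_arcpo p o (Nat.le_add_left 1 t)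
    set z := (M.arcpo p o t).lamBar
    set x₀ := (M.arcpo p o t).lam
    set x₁ := (M.arcpo p o (t + 1)).lam with hx₁
    have hz : (M.arcpo p o (t + 1)).lamBar = (1 - α) • z + α • x₁ := rfl
    have hx₁mem : x₁ ∈ dualBox m (M.radius ξ) := (hmem (t + 1)).1
    have hmin : IsMinOn (fun l : Fin m → ℝ => α / (μ * (1 - α)) *
        (∑ i, (M.V pol i - M.c i + μ * y i) * l i + μ / 2 * ∑ i, (l i - y i) ^ 2)
        + 1 / 2 * ∑ i, (l i - x₀ i) ^ 2) (dualBox m (M.radius ξ)) x₁ :=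
      (argminOn_dualBox_spec _ (by fun_prop) hB).2
    have hyx : ∀ i, (1 + α) * y i = z i + α * x₀ i := by
      intro i
      have : y i = (1 - p.q) * z i + p.q * x₀ i := rfl
      rw [this, hq]
      field_simp
      ring
    obtain ⟨X, hX⟩ := M.regPO_spec (B := M.radius ξ) (δ := δ) hτ (hQ y)
      (fun i => (hymem t i).1) (c := M.softBound (M.radius ξ) τ)
      (fun s => M.softMaximum_fixed_le hτ (M.rLam_le (hymem t)) (hQ y) s)
      (fun x => by
        have h1 := M.softBellman_fixed_le hτ (M.rLam_le (hymem t)) (hQ y) x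
        have h2 := mul_nonneg hτ.le (log_card_nonneg (A := A))
        rw [softBound]
        linarith) o
    have hclose := M.regLagrangian_sub_le_of_close (μ := μ) hB hτ hx (hmem (t + 1)).2
      (hymem t) (hQ y) hpp fun s hs => ⟨(hX s hs).1, fun a => ((hX s hs).2 a).trans hinner⟩
    have hsmooth := M.regLagrangian_sub_le hC hβ₀ hβ₁ hτ herg (hmem (t + 1)).2 (hQ _) (hQ y)
    have hcurv : (M.Ld C β τ μ - μ) / 2 + μ / 2 = μ / (4 * α ^ 2) := by
      rw [hαsq]
      field_simp
      ring
    have := accelerated_step (D := D) (e := M.innerError (M.radius ξ) τ x)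
      (f₀ := M.V0 pol + τ * M.entropy pol - μ / 2 * ∑ i, y i ^ 2)
      (g := fun i => M.V pol i - M.c i + μ * y i) hα0 hα1 hμ hyx hx₁mem hmin
      (by
        rw [← M.regLagrangian_expand τ μ pol z y]
        exact hDmax pol hpp z)
      (by
        rw [← hz]
        have h1 := M.regLagrangian_expand τ μ pol (M.arcpo p o (t + 1)).lamBar y
        rw [← hcurv]
        rw [innerError]
        simp only [hD]
        linarith) hl
    rw [hz, M.regLagrangian_expand τ μ pol l y]
    exact this
  have h := le_of_contraction hα0 hα1
    (u := fun t => D (M.arcpo p o t).lamBar + μ / 2 * ∑ i, (l i - (M.arcpo p o t).lam i) ^ 2)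
    (F := fun t => M.regLagrangian τ μ (M.arcpo p o t).pol l) hstep he0 T
  have h0 : D (M.arcpo p o 0).lamBar + μ / 2 * ∑ i, (l i - (M.arcpo p o 0).lam i) ^ 2 =
      M.regLagrangian τ μ (softmaxPolicy fun x => Q 0 x / τ) 0 + μ / 2 * ∑ i, l i ^ 2 := by
    simp [arcpo, hD]
  rw [h0] at h
  have h1 : 0 ≤ μ / 2 * ∑ i, (l i - (M.arcpo p o T).lam i) ^ 2 :=
    mul_nonneg (by positivity) (Finset.sum_nonneg fun i _ => sq_nonneg _)
  have h2 := hDmax π hπ (M.arcpo p o T).lamBar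
  linarith

/-- The output of AR-CPO is an approximate solution of the saddle point problem: its Lagrangian
at every multiplier of the box almost dominates the constrained optimum. -/
theorem optValue_le_lagrangian (M : ConstrainedMDP S A m) {ξ C β τ μ δ x : ℝ} (hξ : 0 < ξ)
    (hC : 1 / 2 ≤ C) (hβ₀ : 0 < β) (hβ₁ : β < 1) (hτ : 0 < τ) (hμ : 0 < μ) (hx : 0 ≤ x)
    (hS : M.Slater ξ) (herg : M.ErgodicAssumption C β (M.radius ξ) τ μ)
    (hinner : M.γ ^ M.innerIters (M.radius ξ) δ τ * M.softBound (M.radius ξ) τ ≤ x * τ)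
    (hα0 : 0 < (M.params ξ C β τ μ δ).α) (hα1 : (M.params ξ C β τ μ δ).α ≤ 1)
    (o : RegPO) {T : ℕ} (hT : 1 ≤ T) {l : Fin m → ℝ} (hl : l ∈ dualBox m (M.radius ξ)) :
    M.optValue ≤ M.V0 (M.arcpoOutput (M.params ξ C β τ μ δ) o T) +
      ∑ i, l i * (M.V (M.arcpoOutput (M.params ξ C β τ μ δ) o T) i - M.c i) +
      (τ * Real.log (Fintype.card A) / (1 - M.γ) + μ / 2 * (m * (2 * M.radius ξ) ^ 2) +
        (1 - (M.params ξ C β τ μ δ).α) ^ T * M.softBound (M.radius ξ) τ +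
        M.innerError (M.radius ξ) τ x / (M.params ξ C β τ μ δ).α) := by
  have hg : 0 < 1 - M.γ := sub_pos.2 M.γ_lt_one
  have hB : 0 ≤ M.radius ξ := (M.radius_pos hξ).le
  obtain ⟨lb, p₀, hlb, hp₀, hbound⟩ := M.exists_lagrangian_bound (δ := δ) hξ hC hβ₀ hβ₁ hτ hμ hx
    herg hinner o T
  set p := M.params ξ C β τ μ δ with hp
  set W : ℕ → ℝ := fun t => outputWeight p.α T t with hW
  have hWsum : ∑ t ∈ Finset.Icc 1 T, W t = 1 := sum_outputWeight p.α hT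
  have hpol : ∀ t ∈ Finset.Icc 1 T, IsPolicy (M.arcpo p o t).pol := fun t ht =>
    M.isPolicy_arcpo p o (Finset.mem_Icc.1 ht).1
  have hlow : ∀ π, IsPolicy π → (∀ i, M.c i ≤ M.V π i) →
      M.V0 π ≤ M.regLagrangian τ μ π lb := by
    intro π hπ hf
    have h1 : 0 ≤ ∑ i, lb i * (M.V π i - M.c i) := Finset.sum_nonneg fun i _ =>
      mul_nonneg (hlb i).1 (sub_nonneg.2 (hf i))
    have h2 : 0 ≤ τ * M.entropy π := mul_nonneg hτ.le (M.entropy_nonneg hπ)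
    have h3 : 0 ≤ μ / 2 * ∑ i, lb i ^ 2 :=
      mul_nonneg (by positivity) (Finset.sum_nonneg fun i _ => sq_nonneg _)
    rw [regLagrangian]
    linarith
  have hsq : μ / 2 * ∑ i, l i ^ 2 ≤ μ / 2 * (m * (2 * M.radius ξ) ^ 2) := by
    refine mul_le_mul_of_nonneg_left ?_ (by positivity)
    have : ∑ i : Fin m, l i ^ 2 ≤ ∑ _i : Fin m, (2 * M.radius ξ) ^ 2 :=
      Finset.sum_le_sum fun i _ => pow_le_pow_left₀ (hl i).1 (hl i).2 2
    simpa using this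
  have havg : ∑ t ∈ Finset.Icc 1 T, W t * M.regLagrangian τ μ (M.arcpo p o t).pol l ≤
      M.V0 (M.arcpoOutput p o T) + ∑ i, l i * (M.V (M.arcpoOutput p o T) i - M.c i) +
        τ * Real.log (Fintype.card A) / (1 - M.γ) + μ / 2 * (m * (2 * M.radius ξ) ^ 2) := by
    have e0 : M.V0 (M.arcpoOutput p o T) =
        ∑ t ∈ Finset.Icc 1 T, W t * M.V0 (M.arcpo p o t).pol :=
      M.value_arcpoOutput hα0.le hα1 o hT _
    have e1 : ∀ i, M.V (M.arcpoOutput p o T) i - M.c i =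
        ∑ t ∈ Finset.Icc 1 T, W t * (M.V (M.arcpo p o t).pol i - M.c i) := by
      intro i
      simp_rw [mul_sub, Finset.sum_sub_distrib, ← Finset.sum_mul, hWsum, one_mul]
      rw [sub_left_inj]
      exact M.value_arcpoOutput hα0.le hα1 o hT _
    have e2 : ∑ i, l i * (M.V (M.arcpoOutput p o T) i - M.c i) = ∑ t ∈ Finset.Icc 1 T,
        W t * ∑ i, l i * (M.V (M.arcpo p o t).pol i - M.c i) := by
      simp_rw [e1, Finset.mul_sum]
      rw [Finset.sum_comm]
      exact Finset.sum_congr rfl fun t _ => Finset.sum_congr rfl fun i _ => by ring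
    have e3 : τ * Real.log (Fintype.card A) / (1 - M.γ) + μ / 2 * (m * (2 * M.radius ξ) ^ 2) =
        ∑ t ∈ Finset.Icc 1 T, W t * (τ * Real.log (Fintype.card A) / (1 - M.γ) +
          μ / 2 * (m * (2 * M.radius ξ) ^ 2)) := by
      rw [← Finset.sum_mul, hWsum, one_mul]
    rw [add_assoc, e0, e2, e3, ← Finset.sum_add_distrib, ← Finset.sum_add_distrib]
    refine Finset.sum_le_sum fun t ht => ?_
    rw [← mul_add, ← mul_add]
    refine mul_le_mul_of_nonneg_left ?_ (outputWeight_nonneg hα0.le hα1 _ _)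
    have h1 := mul_le_mul_of_nonneg_left (M.entropy_le (hpol t ht)) hτ.le
    rw [regLagrangian]
    rw [← mul_div_assoc] at h1
    linarith
  have hfirst : M.regLagrangian τ μ p₀ 0 + μ / 2 * ∑ i, l i ^ 2 -
      M.regLagrangian τ μ (M.arcpo p o 1).pol l ≤ M.softBound (M.radius ξ) τ := by
    have hp1 := M.isPolicy_arcpo p o le_rfl
    obtain ⟨ps, hps, hslater⟩ := hS
    have hc : ∀ i, M.c i ≤ M.rmax i.succ / (1 - M.γ) := fun i => by
      linarith [hslater i, M.V_le hps i]
    have h1 : ∑ i, l i * (M.c i - M.V (M.arcpo p o 1).pol i) ≤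
        2 * M.radius ξ * (m * M.Rmax) / (1 - M.γ) := by
      have h2 : ∀ i, l i * (M.c i - M.V (M.arcpo p o 1).pol i) ≤
          2 * M.radius ξ / (1 - M.γ) * M.rmax i.succ := by
        intro i
        have h3 : M.c i - M.V (M.arcpo p o 1).pol i ≤ M.rmax i.succ / (1 - M.γ) := by
          linarith [hc i, M.V_nonneg hp1 i]
        have h4 : 0 ≤ M.rmax i.succ / (1 - M.γ) := div_nonneg (M.rmax_pos _).le hg.le
        refine (mul_le_mul_of_nonneg_left h3 (hl i).1).trans ?_
        refine (mul_le_mul_of_nonneg_right (hl i).2 h4).trans (le_of_eq ?_)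
        ring
      refine (Finset.sum_le_sum fun i _ => h2 i).trans ?_
      rw [← Finset.mul_sum]
      refine (mul_le_mul_of_nonneg_left M.sum_rmax_le (by positivity)).trans (le_of_eq ?_)
      ring
    have h5 : ∑ i, l i * (M.c i - M.V (M.arcpo p o 1).pol i) =
        -∑ i, l i * (M.V (M.arcpo p o 1).pol i - M.c i) := by
      rw [← Finset.sum_neg_distrib]
      exact Finset.sum_congr rfl fun i _ => by ring
    have h6 := mul_le_mul_of_nonneg_left (M.entropy_le hp₀) hτ.le
    have h7 : 0 ≤ τ * M.entropy (M.arcpo p o 1).pol :=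
      mul_nonneg hτ.le (M.entropy_nonneg hp1)
    have h8 := M.V0_le hp₀
    have h9 := M.V0_nonneg hp1
    rw [← mul_div_assoc] at h6
    simp only [regLagrangian, softBound, add_div, Pi.zero_apply, zero_mul,
      Finset.sum_const_zero, ne_eq, OfNat.ofNat_ne_zero, not_false_eq_true, zero_pow, mul_zero]
    linarith
  refine M.optValue_le hξ hS fun π hπ hf => ?_
  have h1 := (hlow π hπ hf).trans (hbound π hπ l hl)
  have h2 := sum_outputWeight_mul p.α hT fun t => M.regLagrangian τ μ (M.arcpo p o t).pol l
  have h3 := mul_le_mul_of_nonneg_left hfirst (pow_nonneg (by linarith : 0 ≤ 1 - p.α) T)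
  simp only [hW] at havg
  linarith

end SaddlePoint

end ConstrainedMDP

/-! ### Parameter choices -/

/-- Geometric decay written as a power of `y`. -/
theorem one_sub_pow_le_pow {α y : ℝ} (hα : α ≤ 1) (hy : 0 < y) {T n : ℕ}
    (h : n * Real.log (1 / y) ≤ α * T) : (1 - α) ^ T ≤ y ^ n := by
  calc (1 - α) ^ T ≤ Real.exp (-α) ^ T :=
        pow_le_pow_left₀ (by linarith) (Real.one_sub_le_exp_neg α) T
    _ = Real.exp (-(α * T)) := by
        rw [← Real.exp_nat_mul]
        ring_nf
    _ ≤ Real.exp (n * Real.log y) := by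
        rw [one_div, Real.log_inv] at h
        exact Real.exp_le_exp.2 (by linarith)
    _ = y ^ n := by rw [Real.exp_nat_mul, Real.exp_log hy]

namespace ConstrainedMDP

variable {S A : Type*} [Fintype S] [Fintype A] {m : ℕ}

/-- The step size `α` is of order `(1 - γ)^{5/2} ε`; `h` stands for `(1 - γ)^{1/2}`. -/
theorem stepSize_bounds (M : ConstrainedMDP S A m) {ξ C β τ μ δ κτ κμ ε h : ℝ}
    (hL : 0 < Lnu C β) (hκτ : 0 < κτ) (hκμ : 0 < κμ) (hε0 : 0 < ε) (hε1 : ε ≤ 1) (hh0 : 0 < h)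
    (hh1 : h ≤ 1) (hg : 1 - M.γ = h ^ 2) (hτ : τ = κτ * (1 - M.γ) * ε)
    (hμ : μ = κμ * (1 - M.γ) ^ 2 * ε) :
    1 / √(2 * (1 + 2 * M.Rmax ^ 2 * Lnu C β / (κτ * κμ))) * (h ^ 5 * ε) ≤
      (M.params ξ C β τ μ δ).α ∧ (M.params ξ C β τ μ δ).α ≤ 1 := by
  have hb0 : 0 ≤ 2 * M.Rmax ^ 2 * Lnu C β := by positivity
  set b := 2 * M.Rmax ^ 2 * Lnu C β with hb
  have hy0 : 0 < h ^ 5 * ε := by positivity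
  have hy1 : (h ^ 5 * ε) ^ 2 ≤ 1 :=
    pow_le_one₀ hy0.le (mul_le_one₀ (pow_le_one₀ hh0.le hh1) hε0.le hε1)
  have hμ0 : 0 < μ := by rw [hμ, hg]; positivity
  have hratio : μ / (2 * M.Ld C β τ μ) =
      (h ^ 5 * ε) ^ 2 / (2 * ((h ^ 5 * ε) ^ 2 + b / (κτ * κμ))) := by
    have hLd : M.Ld C β τ μ = b / ((1 - M.γ) ^ 2 * τ) + μ := rfl
    rw [hLd, hτ, hμ, hg]
    field_simp
    ring
  constructor
  · refine Real.le_sqrt_of_sq_le ?_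
    rw [mul_pow, div_pow, one_pow, Real.sq_sqrt (by positivity), hratio, one_div_mul_eq_div]
    gcongr
  · change √_ ≤ 1
    refine Real.sqrt_le_iff.2 ⟨zero_le_one, ?_⟩
    rw [one_pow]
    have hLd : μ ≤ M.Ld C β τ μ := by
      have : 0 ≤ b / ((1 - M.γ) ^ 2 * τ) := by
        rw [hτ, hg]
        positivity
      change μ ≤ b / ((1 - M.γ) ^ 2 * τ) + μ
      linarith
    rw [div_le_one (by linarith)]
    linarith

/-- The number of inner iterations is of order `log / (1 - γ)`. -/
theorem innerIters_le (M : ConstrainedMDP S A m) {B δ τ Y : ℝ} (hY : 0 ≤ Y)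
    (h : Real.log (2 * (M.rmax 0 + B * M.Rmax) / ((1 - M.γ) * δ * τ)) ≤ Y) :
    (M.innerIters B δ τ : ℝ) ≤ Y / (1 - M.γ) + 1 := by
  have hg : 0 < 1 - M.γ := sub_pos.2 M.γ_lt_one
  have hlog : 1 - M.γ ≤ Real.log (1 / M.γ) := by
    rw [one_div, Real.log_inv]
    linarith [Real.log_le_sub_one_of_pos M.γ_pos]
  have hle : Real.log (2 * (M.rmax 0 + B * M.Rmax) / ((1 - M.γ) * δ * τ)) /
      Real.log (1 / M.γ) ≤ Y / (1 - M.γ) :=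
    (div_le_div_of_nonneg_right h (hg.le.trans hlog)).trans
      (div_le_div_of_nonneg_left hY hg hlog)
  refine le_trans ?_ (Nat.ceil_lt_add_one (div_nonneg hY hg.le)).le
  exact_mod_cast Nat.ceil_mono hle

variable [Nonempty A]

theorem softBound_le (M : ConstrainedMDP S A m) {ξ τ : ℝ} (hξ : 0 < ξ)
    (hτlog : τ * Real.log (Fintype.card A) ≤ M.rmax 0) :
    M.softBound (M.radius ξ) τ ≤
      2 * (1 + m) * (M.rmax 0 + M.radius ξ * M.Rmax) / (1 - M.γ) := by
  have hg : 0 < 1 - M.γ := sub_pos.2 M.γ_lt_one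
  have h1 := (M.radius_pos hξ).le
  have h2 := M.Rmax_nonneg
  have h3 := M.rmax_pos 0
  rw [softBound]
  gcongr
  have h4 : 0 ≤ M.radius ξ * M.Rmax := mul_nonneg h1 h2
  have h5 : (0 : ℝ) ≤ m * M.rmax 0 := by positivity
  linarith

theorem rmax_add_radius_mul_le (M : ConstrainedMDP S A m) {ξ : ℝ} (hξ : 0 < ξ) :
    M.rmax 0 + M.radius ξ * M.Rmax ≤ M.rmax 0 * (1 + M.Rmax / ξ) / (1 - M.γ) := by
  have hg : 0 < 1 - M.γ := sub_pos.2 M.γ_lt_one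
  have h3 := M.rmax_pos 0
  have h1 : M.rmax 0 ≤ M.rmax 0 / (1 - M.γ) := by
    rw [le_div_iff₀ hg]
    nlinarith [M.γ_pos]
  have h2 : M.rmax 0 * (1 + M.Rmax / ξ) / (1 - M.γ) =
      M.rmax 0 / (1 - M.γ) + M.radius ξ * M.Rmax := by
    rw [radius]
    field_simp
  rw [h2]
  linarith

/-- The number `K` of inner iterations brings the policy optimizers to the accuracy
`(1 + m) δ`. -/
theorem inner_accuracy (M : ConstrainedMDP S A m) {ξ τ δ : ℝ} (hξ : 0 < ξ) (hτ : 0 < τ)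
    (hδ : 0 < δ) (hτlog : τ * Real.log (Fintype.card A) ≤ M.rmax 0) :
    M.γ ^ M.innerIters (M.radius ξ) δ τ * M.softBound (M.radius ξ) τ ≤ (1 + m) * δ * τ := by
  have hg : 0 < 1 - M.γ := sub_pos.2 M.γ_lt_one
  have h1 := (M.radius_pos hξ).le
  have h2 := M.Rmax_nonneg
  have h3 := M.rmax_pos 0
  set X := 2 * (M.rmax 0 + M.radius ξ * M.Rmax) / ((1 - M.γ) * δ * τ) with hX
  have hX0 : 0 < X := by positivity
  set K := M.innerIters (M.radius ξ) δ τ with hK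
  have hlog : 0 < Real.log (1 / M.γ) :=
    Real.log_pos ((one_lt_div M.γ_pos).2 M.γ_lt_one)
  have hKX : Real.log X ≤ K * Real.log (1 / M.γ) := by
    rw [← div_le_iff₀ hlog]
    exact Nat.le_ceil _
  have hpow : M.γ ^ K * X ≤ 1 := by
    rw [one_div, Real.log_inv] at hKX
    rw [← Real.exp_log (pow_pos M.γ_pos K), ← Real.exp_log hX0, ← Real.exp_add, Real.log_pow,
      Real.exp_le_one_iff]
    linarith
  calc M.γ ^ K * M.softBound (M.radius ξ) τ ≤
        M.γ ^ K * (2 * (1 + m) * (M.rmax 0 + M.radius ξ * M.Rmax) / (1 - M.γ)) :=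
        mul_le_mul_of_nonneg_left (M.softBound_le hξ hτlog) (pow_nonneg M.γ_pos.le K)
    _ = M.γ ^ K * X * ((1 + m) * δ * τ) := by
        rw [hX]
        field_simp
    _ ≤ 1 * ((1 + m) * δ * τ) := mul_le_mul_of_nonneg_right hpow (by positivity)
    _ = _ := one_mul _

end ConstrainedMDP

/-! ### Optimality and query count -/

namespace ConstrainedMDP

variable {S A : Type*} [Fintype S] [DecidableEq S] [Fintype A] [DecidableEq A] [Nonempty A]
  {m : ℕ}

/-- Optimality of the output. The four error terms of the saddle point inequality (entropy,
dual regularization, outer iteration, inner iteration) each use a quarter of the budget `σ ε`,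
where `σ ≤ 1` and `σ ≤ B`. Below `h` stands for `(1 - γ)^{1/2}`. -/
theorem isEpsOptimal_arcpoOutput (M : ConstrainedMDP S A m)
    {ξ C β τ μ δ ε h σ κτ κμ κδ κT cα : ℝ} {n T : ℕ} (hξ : 0 < ξ) (hC : 1 / 2 ≤ C)
    (hβ₀ : 0 < β) (hβ₁ : β < 1) (hσ : σ = M.rmax 0 / (1 + M.rmax 0 + ξ))
    (hκτ : κτ = σ / (4 * (1 + Real.log (Fintype.card A))))
    (hκμ : κμ = σ * ξ ^ 2 / (8 * M.rmax 0 ^ 2 * (m + 1)))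
    (hcα : cα = 1 / √(2 * (1 + 2 * M.Rmax ^ 2 * Lnu C β / (κτ * κμ))))
    (hκδ : κδ = σ * cα / (8 * (1 + m) * (κτ + M.rmax 0 * (m * M.Rmax) / ξ)))
    (hn : 2 * (1 + m) * (M.rmax 0 * (1 + M.Rmax / ξ)) * (1 / 2) ^ n ≤ σ / 4)
    (hκT : cα * κT = n + 3) (hε0 : 0 < ε) (hε1 : ε ≤ 1 / 2)
    (hh0 : 0 < h) (hh1 : h ≤ 1) (hg : 1 - M.γ = h ^ 2)
    (hτ : τ = κτ * (1 - M.γ) * ε) (hμ : μ = κμ * (1 - M.γ) ^ 2 * ε)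
    (hδ : δ = κδ * (1 - M.γ) ^ 6 * ε ^ 2)
    (hT : κT * (1 / (h ^ 5 * ε)) * Real.log (1 / ((1 - M.γ) * ε)) ≤ T)
    (hS : M.Slater ξ) (herg : M.ErgodicAssumption C β (M.radius ξ) τ μ) (o : RegPO) :
    M.IsEpsOptimal ε (M.arcpoOutput (M.params ξ C β τ μ δ) o T) := by
  have hr0 := M.rmax_pos 0
  have hR := M.Rmax_nonneg
  have hL := Lnu_pos hC hβ₀ hβ₁
  have hlogA := log_card_nonneg (A := A)
  have hBpos := M.radius_pos hξ
  set r₀ := M.rmax 0 with hr₀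
  set R := M.Rmax with hRdef
  set a := Real.log (Fintype.card A) with ha
  have hσ0 : 0 < σ := by rw [hσ]; positivity
  have hσ1 : σ ≤ 1 := by
    rw [hσ, div_le_one (by positivity)]
    linarith
  have hσr : σ ≤ r₀ := by
    rw [hσ]
    exact div_le_self hr0.le (by linarith)
  have hκτ0 : 0 < κτ := by rw [hκτ]; positivity
  have hκμ0 : 0 < κμ := by rw [hκμ]; positivity
  have hcα0 : 0 < cα := by rw [hcα]; positivity
  have hmR : 0 ≤ r₀ * (m * R) / ξ := by positivity
  have hκδ0 : 0 < κδ := by rw [hκδ]; positivity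
  have hκτa : κτ * a ≤ σ / 4 := by
    have e : κτ * a = σ / 4 * (a / (1 + a)) := by
      rw [hκτ]
      field_simp
    rw [e]
    exact mul_le_of_le_one_right (by positivity) (div_le_one_of_le₀ (by linarith) (by linarith))
  rw [hg] at hτ hμ hδ hT
  have hτ0 : 0 < τ := by rw [hτ]; positivity
  have hμ0 : 0 < μ := by rw [hμ]; positivity
  have hδ0 : 0 < δ := by rw [hδ]; positivity
  have hh2 : h ^ 2 ≤ 1 := pow_le_one₀ hh0.le hh1
  have hε2 : ε ≤ 1 := by linarith
  obtain ⟨hαlow, hα1⟩ := M.stepSize_bounds (ξ := ξ) (τ := τ) (μ := μ) (δ := δ) hL hκτ0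
    hκμ0 hε0 hε2 hh0 hh1 hg (by rw [hg]; exact hτ) (by rw [hg]; exact hμ)
  rw [← hRdef, ← hcα] at hαlow
  set α := (M.params ξ C β τ μ δ).α with hα
  have hα0 : 0 < α := (mul_pos hcα0 (by positivity)).trans_le hαlow
  have hτlog : τ * a ≤ r₀ := by
    calc τ * a = κτ * a * (h ^ 2 * ε) := by rw [hτ]; ring
      _ ≤ σ / 4 * (h ^ 2 * ε) := mul_le_mul_of_nonneg_right hκτa (by positivity)
      _ ≤ σ / 4 * 1 := mul_le_mul_of_nonneg_left
          (mul_le_one₀ hh2 hε0.le hε2) (by positivity)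
      _ ≤ r₀ := by linarith
  have hinner := M.inner_accuracy hξ hτ0 hδ0 hτlog
  have hB : M.radius ξ = r₀ / (h ^ 2 * ξ) := by rw [radius, hg]
  -- the entropy of the iterates
  have hE1 : τ * a / (1 - M.γ) ≤ σ * ε / 4 := by
    rw [hg, hτ]
    have : κτ * h ^ 2 * ε * a / h ^ 2 = κτ * a * ε := by field_simp
    rw [this]
    linarith [mul_le_mul_of_nonneg_right hκτa hε0.le]
  -- the quadratic regularization of the multiplier
  have hE2 : μ / 2 * (m * (2 * M.radius ξ) ^ 2) ≤ σ * ε / 4 := by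
    rw [hB, hμ, hκμ]
    have : σ * ξ ^ 2 / (8 * r₀ ^ 2 * (m + 1)) * (h ^ 2) ^ 2 * ε / 2 *
        (m * (2 * (r₀ / (h ^ 2 * ξ))) ^ 2) = σ * ε / 4 * (m / (m + 1)) := by
      field_simp
      ring
    rw [this]
    refine mul_le_of_le_one_right (by positivity) ?_
    rw [div_le_one (by positivity)]
    linarith
  -- the number of outer iterations makes `(1 - α) ^ T` at most `((1 - γ) ε) ^ (n + 3)`
  have hy0 : 0 < h ^ 2 * ε := by positivity
  have hlog0 : 0 < Real.log (1 / (h ^ 2 * ε)) := by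
    refine Real.log_pos ((one_lt_div hy0).2 ?_)
    linarith [mul_le_of_le_one_left hε0.le hh2]
  have hκT0 : 0 < κT := by
    have : 0 < cα * κT := by rw [hκT]; positivity
    exact (pos_iff_pos_of_mul_pos this).1 hcα0
  have hdecay : (1 - α) ^ T ≤ (h ^ 2 * ε) ^ (n + 3) := by
    refine one_sub_pow_le_pow hα1 hy0 ?_
    calc ((n + 3 : ℕ) : ℝ) * Real.log (1 / (h ^ 2 * ε)) =
          cα * (h ^ 5 * ε) * (κT * (1 / (h ^ 5 * ε)) * Real.log (1 / (h ^ 2 * ε))) := by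
          push_cast
          rw [← hκT]
          field_simp
      _ ≤ α * T := mul_le_mul hαlow hT (by positivity) hα0.le
  have hE3 : (1 - α) ^ T * M.softBound (M.radius ξ) τ ≤ σ * ε / 4 := by
    have h1 : M.softBound (M.radius ξ) τ ≤
        2 * (1 + m) * (r₀ * (1 + R / ξ)) / (h ^ 2) ^ 2 := by
      refine (M.softBound_le hξ hτlog).trans ?_
      have h2 := M.rmax_add_radius_mul_le hξ
      rw [hg] at h2 ⊢
      have e : 2 * (1 + (m : ℝ)) * (r₀ * (1 + R / ξ)) / (h ^ 2) ^ 2 =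
          2 * (1 + (m : ℝ)) * (r₀ * (1 + R / ξ) / h ^ 2) / h ^ 2 := by
        field_simp
      rw [e]
      gcongr
    have h3 : 0 ≤ 2 * (1 + (m : ℝ)) * (r₀ * (1 + R / ξ)) := by positivity
    have h4 : (h ^ 2 * ε) ^ (n + 3) ≤ (1 / 2) ^ n * ((h ^ 2) ^ 2 * ε) := by
      have h5 : (h ^ 2 * ε) ^ n ≤ (1 / 2) ^ n := by
        refine pow_le_pow_left₀ hy0.le ?_ n
        linarith [mul_le_of_le_one_left hε0.le hh2]
      have h6 : (h ^ 2 * ε) ^ 3 ≤ (h ^ 2) ^ 2 * ε := by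
        have h7 : h ^ 2 * ε ^ 2 ≤ 1 := mul_le_one₀ hh2 (by positivity) (pow_le_one₀ hε0.le hε2)
        calc (h ^ 2 * ε) ^ 3 = (h ^ 2) ^ 2 * ε * (h ^ 2 * ε ^ 2) := by ring
          _ ≤ (h ^ 2) ^ 2 * ε * 1 := mul_le_mul_of_nonneg_left h7 (by positivity)
          _ = _ := mul_one _
      rw [pow_add]
      exact mul_le_mul h5 h6 (by positivity) (by positivity)
    calc (1 - α) ^ T * M.softBound (M.radius ξ) τ ≤
          (1 / 2) ^ n * ((h ^ 2) ^ 2 * ε) *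
            (2 * (1 + m) * (r₀ * (1 + R / ξ)) / (h ^ 2) ^ 2) := by
          refine mul_le_mul (hdecay.trans h4) h1 ?_ (by positivity)
          rw [softBound]
          refine div_nonneg ?_ (by rw [hg]; positivity)
          positivity
      _ = 2 * (1 + m) * (r₀ * (1 + R / ξ)) * (1 / 2) ^ n * ε := by field_simp
      _ ≤ σ / 4 * ε := mul_le_mul_of_nonneg_right hn hε0.le
      _ = _ := by ring
  -- the inexactness of the inner loop, amplified by `1 / α`
  have hE4 : M.innerError (M.radius ξ) τ ((1 + m) * δ) / α ≤ σ * ε / 4 := by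
    have h1 : M.innerError (M.radius ξ) τ ((1 + m) * δ) ≤
        2 * (1 + m) * (κτ + r₀ * (m * R) / ξ) * δ / (h ^ 2) ^ 3 := by
      rw [innerError, hg, hB, hτ, ← hRdef]
      have e1 : 2 * ((1 + m) * δ) * (κτ * h ^ 2 * ε) / h ^ 2 +
          2 * (r₀ / (h ^ 2 * ξ)) * (m * R) * ((1 + m) * δ) / (h ^ 2) ^ 2 =
          2 * (1 + m) * (κτ * (ε * (h ^ 2) ^ 3) + r₀ * (m * R) / ξ) * δ / (h ^ 2) ^ 3 := by
        field_simp
      rw [e1]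
      have h2 : κτ * (ε * (h ^ 2) ^ 3) ≤ κτ :=
        mul_le_of_le_one_right hκτ0.le
          (mul_le_one₀ hε2 (by positivity) (pow_le_one₀ (by positivity) hh2))
      gcongr
    rw [div_le_iff₀ hα0]
    calc M.innerError (M.radius ξ) τ ((1 + m) * δ) ≤
          2 * (1 + m) * (κτ + r₀ * (m * R) / ξ) * δ / (h ^ 2) ^ 3 := h1
      _ = σ * ε / 4 * (cα * (h ^ 5 * ε)) * h := by
          rw [hδ, hκδ]
          field_simp
          ring
      _ ≤ σ * ε / 4 * (cα * (h ^ 5 * ε)) * 1 := mul_le_mul_of_nonneg_left hh1 (by positivity)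
      _ ≤ σ * ε / 4 * α := by
          rw [mul_one]
          exact mul_le_mul_of_nonneg_left hαlow (by positivity)
  have hT1 : 1 ≤ T := by
    have : (0 : ℝ) < T := lt_of_lt_of_le (by positivity) hT
    exact_mod_cast this
  refine M.isEpsOptimal_of_lagrangian (E := σ * ε) hξ hS
    (M.isPolicy_arcpoOutput hα0.le hα1 o T) (mul_le_of_le_one_left hε0.le hσ1)
    (mul_le_mul_of_nonneg_right ?_ hε0.le) fun l hl => ?_
  · rw [hB, hσ, div_le_div_iff₀ (by positivity) (by positivity)]
    have : h ^ 2 * ξ ≤ 1 * ξ := mul_le_mul_of_nonneg_right hh2 hξ.le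
    exact mul_le_mul_of_nonneg_left (by linarith) hr0.le
  · have := M.optValue_le_lagrangian hξ hC hβ₀ hβ₁ hτ0 hμ0
      (by positivity : 0 ≤ (1 + m) * δ) hS herg hinner hα0 hα1 o hT1 hl
    linarith

/-- The query count: `T` outer iterations of `K + 2` queries each. -/
theorem arcpo_queries_le_log_sq (M : ConstrainedMDP S A m)
    {ξ C β τ μ δ ε h κτ κδ κT : ℝ} {T : ℕ} (hξ : 0 < ξ) (hκτ : 0 < κτ) (hκδ : 0 < κδ)
    (hκT : 0 < κT) (hε0 : 0 < ε) (hε1 : ε ≤ 1 / 2) (hh0 : 0 < h) (hh1 : h ≤ 1)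
    (hg : 1 - M.γ = h ^ 2) (hτ : τ = κτ * (1 - M.γ) * ε)
    (hδ : δ = κδ * (1 - M.γ) ^ 6 * ε ^ 2)
    (hT : (T : ℝ) ≤ κT * (1 / (h ^ 5 * ε)) * Real.log (1 / ((1 - M.γ) * ε)) + 1) (o : RegPO) :
    ((M.arcpo (M.params ξ C β τ μ δ) o T).queries : ℝ) ≤
      (κT + 1) * (2 * |Real.log (2 * (M.rmax 0 * (1 + M.Rmax / ξ)) / (κτ * κδ))| + 15) *
        (1 / (h ^ 7 * ε)) * Real.log (1 / (h ^ 7 * ε)) ^ 2 := by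
  have hr0 := M.rmax_pos 0
  have hR := M.Rmax_nonneg
  have hBpos := M.radius_pos hξ
  have hh2 : h ^ 2 ≤ 1 := pow_le_one₀ hh0.le hh1
  rw [hg] at hτ hδ hT
  set cX := 2 * (M.rmax 0 * (1 + M.Rmax / ξ)) / (κτ * κδ) with hcX
  have hcX0 : 0 < cX := by positivity
  set G := 1 / (h ^ 7 * ε) with hG
  set LG := Real.log G with hLG
  have hy0 : 0 < h ^ 2 * ε := by positivity
  have hlogle : Real.log (1 / (h ^ 2 * ε)) ≤ LG := by
    refine Real.log_le_log (by positivity) (one_div_le_one_div_of_le (by positivity) ?_)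
    have : h ^ 7 ≤ h ^ 2 := pow_le_pow_of_le_one hh0.le hh1 (by norm_num)
    gcongr
  have hhalf : ∀ k : ℕ, 2 ≤ 1 / (h ^ k * ε) := by
    intro k
    have h1 : h ^ k ≤ 1 := pow_le_one₀ hh0.le hh1
    rw [le_div_iff₀ (by positivity)]
    linarith [mul_le_of_le_one_left hε0.le h1]
  have hLG2 : 1 / 2 ≤ LG := by
    have h1 := Real.log_le_log two_pos (hhalf 7)
    have h2 := Real.log_two_gt_d9
    norm_num at h2
    linarith
  have hlogX : Real.log (2 * (M.rmax 0 + M.radius ξ * M.Rmax) / ((1 - M.γ) * δ * τ)) ≤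
      |Real.log cX| + 9 * LG := by
    have h1 : 2 * (M.rmax 0 + M.radius ξ * M.Rmax) / ((1 - M.γ) * δ * τ) ≤
        cX * (1 / (h ^ 2 * ε)) ^ 9 := by
      have h2 := M.rmax_add_radius_mul_le hξ
      rw [hg] at h2 ⊢
      have e : cX * (1 / (h ^ 2 * ε)) ^ 9 =
          2 * (M.rmax 0 * (1 + M.Rmax / ξ) / h ^ 2) / (h ^ 2 * δ * τ) * (1 / ε ^ 6) := by
        rw [hcX, hδ, hτ]
        field_simp
      rw [e]
      have h3 : 1 ≤ 1 / ε ^ 6 := by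
        rw [le_div_iff₀ (by positivity), one_mul]
        exact pow_le_one₀ hε0.le (by linarith)
      have hδ0 : 0 < δ := by rw [hδ]; positivity
      have hτ0 : 0 < τ := by rw [hτ]; positivity
      refine le_trans ?_ (le_mul_of_one_le_right (by positivity) h3)
      gcongr
    have hpos : 0 < 2 * (M.rmax 0 + M.radius ξ * M.Rmax) / ((1 - M.γ) * δ * τ) := by
      rw [hg, hδ, hτ]
      positivity
    have h4 := Real.log_le_log hpos h1
    rw [Real.log_mul hcX0.ne' (by positivity), Real.log_pow] at h4
    push_cast at h4
    linarith [le_abs_self (Real.log cX)]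
  have hK := M.innerIters_le (by positivity) hlogX
  rw [hg] at hK
  have hK2 : (M.innerIters (M.radius ξ) δ τ : ℝ) + 2 ≤
      (2 * |Real.log cX| + 15) * LG / h ^ 2 := by
    have h1 : |Real.log cX| ≤ 2 * |Real.log cX| * LG := by
      linarith [mul_le_mul_of_nonneg_left hLG2 (abs_nonneg (Real.log cX))]
    have h2 : (3 : ℝ) ≤ 6 * LG / h ^ 2 := by
      rw [le_div_iff₀ (by positivity)]
      linarith
    have h3 : (|Real.log cX| + 9 * LG) / h ^ 2 ≤ (2 * |Real.log cX| * LG + 9 * LG) / h ^ 2 := by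
      gcongr
    have h4 : (2 * |Real.log cX| + 15) * LG / h ^ 2 =
        (2 * |Real.log cX| * LG + 9 * LG) / h ^ 2 + 6 * LG / h ^ 2 := by ring
    linarith
  have hT2 : (T : ℝ) ≤ (κT + 1) * (1 / (h ^ 5 * ε)) * LG := by
    have h1 : κT * (1 / (h ^ 5 * ε)) * Real.log (1 / (h ^ 2 * ε)) ≤
        κT * (1 / (h ^ 5 * ε)) * LG := mul_le_mul_of_nonneg_left hlogle (by positivity)
    have h2 : 1 ≤ 1 / (h ^ 5 * ε) * LG := by
      linarith [mul_le_mul (hhalf 5) hLG2 (by norm_num) (by positivity)]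
    linarith
  have hq : ((M.arcpo (M.params ξ C β τ μ δ) o T).queries : ℝ) ≤
      T * (M.innerIters (M.radius ξ) δ τ + 2) := by
    exact_mod_cast M.arcpo_queries_le (M.params ξ C β τ μ δ) o T
  calc _ ≤ (T : ℝ) * (M.innerIters (M.radius ξ) δ τ + 2) := hq
    _ ≤ ((κT + 1) * (1 / (h ^ 5 * ε)) * LG) * ((2 * |Real.log cX| + 15) * LG / h ^ 2) :=
        mul_le_mul hT2 hK2 (by positivity) (by positivity)
    _ = _ := by
        rw [hG]
        field_simp

end ConstrainedMDP

theorem corollary1 (m nA : ℕ) (r₀ R ξ C β : ℝ) (hξ : 0 < ξ) (hC : 1 / 2 ≤ C)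
    (hβ₀ : 0 < β) (hβ₁ : β < 1) :
    ∃ (κτ κμ κδ κT a : ℝ) (k : ℕ), 0 < κτ ∧ 0 < κμ ∧ 0 < κδ ∧ 0 < κT ∧ 0 < a ∧
      ∀ (S A : Type*) [Fintype S] [DecidableEq S] [Fintype A] [DecidableEq A]
        (M : ConstrainedMDP S A m) (ε τ μ δ : ℝ) (T : ℕ),
        Fintype.card A = nA → M.rmax 0 = r₀ → M.Rmax = R →
        0 < ε → ε ≤ 1 / 2 →
        τ = κτ * (1 - M.γ) * ε →
        μ = κμ * (1 - M.γ) ^ 2 * ε →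
        δ = κδ * (1 - M.γ) ^ k * ε ^ 2 →
        T = ⌈κT * (1 / ((1 - M.γ) ^ (5 / 2 : ℝ) * ε)) * Real.log (1 / ((1 - M.γ) * ε))⌉₊ →
        M.Slater ξ →
        M.ErgodicAssumption C β (M.radius ξ) τ μ →
        ∀ o : RegPO,
          M.IsEpsOptimal ε (M.arcpoOutput (M.params ξ C β τ μ δ) o T) ∧
          ((M.arcpo (M.params ξ C β τ μ δ) o T).queries : ℝ) ≤
            a * (1 / ((1 - M.γ) ^ (7 / 2 : ℝ) * ε)) *
              Real.log (1 / ((1 - M.γ) ^ (7 / 2 : ℝ) * ε)) ^ 2 := by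
  by_cases hpar : 0 < r₀ ∧ 0 ≤ R ∧ 0 < nA
  swap
  · -- no constrained MDP with a policy has these parameters
    refine ⟨1, 1, 1, 1, 1, 0, one_pos, one_pos, one_pos, one_pos, one_pos, ?_⟩
    intro S A _ _ _ _ M ε τ μ δ T hA hr hR _ _ _ _ _ _ hS _ o
    refine absurd ?_ hpar
    have : Nonempty A := by
      obtain ⟨π, hπ, -⟩ := hS
      by_contra hne
      rw [not_nonempty_iff] at hne
      have := hπ.2 (Classical.choice M.nonempty_states)
      simp at this
    exact ⟨hr ▸ M.rmax_pos 0, hR ▸ M.Rmax_nonneg, hA ▸ Fintype.card_pos⟩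
  obtain ⟨hr0, hR0, hnA⟩ := hpar
  have hL := Lnu_pos hC hβ₀ hβ₁
  have hlog : 0 ≤ Real.log nA := Real.log_nonneg (by exact_mod_cast hnA)
  obtain ⟨σ, hσ⟩ : ∃ σ, σ = r₀ / (1 + r₀ + ξ) := ⟨_, rfl⟩
  have hσ0 : 0 < σ := by rw [hσ]; positivity
  obtain ⟨κτ, hκτ⟩ : ∃ κτ, κτ = σ / (4 * (1 + Real.log nA)) := ⟨_, rfl⟩
  have hκτ0 : 0 < κτ := by rw [hκτ]; positivity
  obtain ⟨κμ, hκμ⟩ : ∃ κμ, κμ = σ * ξ ^ 2 / (8 * r₀ ^ 2 * (m + 1)) := ⟨_, rfl⟩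
  have hκμ0 : 0 < κμ := by rw [hκμ]; positivity
  obtain ⟨cα, hcα⟩ : ∃ cα, cα =
    1 / √(2 * (1 + 2 * R ^ 2 * ConstrainedMDP.Lnu C β / (κτ * κμ))) := ⟨_, rfl⟩
  have hcα0 : 0 < cα := by rw [hcα]; positivity
  obtain ⟨κδ, hκδ⟩ : ∃ κδ, κδ = σ * cα / (8 * (1 + m) * (κτ + r₀ * (m * R) / ξ)) := ⟨_, rfl⟩
  have hκδ0 : 0 < κδ := by rw [hκδ]; positivity
  obtain ⟨n, hn⟩ : ∃ n : ℕ, 2 * (1 + m) * (r₀ * (1 + R / ξ)) * (1 / 2) ^ n ≤ σ / 4 := by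
    have hpos : 0 < 2 * (1 + m) * (r₀ * (1 + R / ξ)) := by positivity
    obtain ⟨n, hn⟩ := exists_pow_lt_of_lt_one
      (show 0 < σ / 4 / (2 * (1 + m) * (r₀ * (1 + R / ξ))) by positivity)
      (show (1 / 2 : ℝ) < 1 by norm_num)
    exact ⟨n, by rw [mul_comm]; exact ((lt_div_iff₀ hpos).1 hn).le⟩
  refine ⟨κτ, κμ, κδ, (n + 3) / cα,
    ((n + 3) / cα + 1) * (2 * |Real.log (2 * (r₀ * (1 + R / ξ)) / (κτ * κδ))| + 15), 6,
    hκτ0, hκμ0, hκδ0, by positivity, by positivity, ?_⟩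
  intro S A _ _ _ _ M ε τ μ δ T hA hr hR hε0 hε1 hτ hμ hδ hT hS herg o
  have : Nonempty A := Fintype.card_pos_iff.1 (hA ▸ hnA)
  have hg0 : 0 < 1 - M.γ := sub_pos.2 M.γ_lt_one
  have hg : 1 - M.γ = √(1 - M.γ) ^ 2 := (Real.sq_sqrt hg0.le).symm
  have hh0 : 0 < √(1 - M.γ) := Real.sqrt_pos.2 hg0
  have hh1 : √(1 - M.γ) ≤ 1 := Real.sqrt_le_iff.2 ⟨zero_le_one, by linarith [M.γ_pos]⟩
  have hrpow : ∀ k : ℕ, (1 - M.γ) ^ ((k : ℝ) / 2) = √(1 - M.γ) ^ k := by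
    intro k
    rw [Real.sqrt_eq_rpow, ← Real.rpow_natCast, ← Real.rpow_mul hg0.le]
    ring_nf
  have h5 : (1 - M.γ) ^ (5 / 2 : ℝ) = √(1 - M.γ) ^ 5 := by exact_mod_cast hrpow 5
  have h7 : (1 - M.γ) ^ (7 / 2 : ℝ) = √(1 - M.γ) ^ 7 := by exact_mod_cast hrpow 7
  rw [h5] at hT
  rw [h7]
  subst hA hr hR
  have hlogy : 0 ≤ Real.log (1 / ((1 - M.γ) * ε)) := by
    refine Real.log_nonneg ((one_le_div (by positivity)).2 ?_)
    nlinarith [M.γ_pos]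
  refine ⟨M.isEpsOptimal_arcpoOutput hξ hC hβ₀ hβ₁ hσ hκτ hκμ hcα hκδ hn
    (mul_div_cancel₀ _ hcα0.ne') hε0 hε1 hh0 hh1 hg hτ hμ hδ (hT ▸ Nat.le_ceil _) hS herg o,
    M.arcpo_queries_le_log_sq hξ hκτ0 hκδ0 (by positivity) hε0 hε1 hh0 hh1 hg hτ hδ ?_ o⟩
  rw [hT]
  exact (Nat.ceil_lt_add_one (by positivity)).le
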